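/- Write $\mathbb C\{x\}$ and $\mathbb C\{x,y\}$ for the rings of convergent complex power series. A fractional power series is an element of $\mathbb C\{x\}^*=\bigcup_{m\ge 1}\mathbb C\{x^{1/m}\}$. For $g\in\mathbb C\{x,y\}$ let $\operatorname{Zer} g$ be the set of Newton--Puiseux roots of $g$, that is, the fractional power series $\gamma$ of positive order with $g(x,\gamma(x))=0$. For a fractional power series $\alpha$ put $\operatorname{cont}(\alpha,g)=\max\{\operatorname{ord}_x(\alpha-\gamma):\gamma\in\operatorname{Zer} g\}$. Let $f\in\mathbb C\{x\}[y]$ be an irreducible Weierstrass polynomial, that is, an irreducible monic polynomial in $y$ whose non-leading coefficients vanish at $x=0$. Let $(b_0,b_1,\dots,b_g)$ be its Puiseux characteristic: $b_0=\deg_y f$, $b_1<\dots<b_g$, and $\{b_1/b_0,\dots,b_g/b_0\}$ is the set of the orders $\operatorname{ord}_x(\gamma-\gamma')$ for $\gamma\ne\gamma'$ in $\operatorname{Zer} f$. Put $l_i=\gcd(b_0,\dots,b_i)$ for $0\le i\le g$ and $n_i=l_{i-1}/l_i$ for $1\le i\le g$. Let $0\le k\le g-1$ and let $f^{(k)}$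 be the $k$-th characteristic approximate root of $f$, that is, the unique monic polynomial in $\mathbb C\{x\}[y]$ such that $\deg_y\bigl(f-(f^{(k)})^{l_k}\bigr)<b_0-b_0/l_k$ (where the zero polynomial has degree $-\infty$). Put $\operatorname{jac}(g,h)=\frac{\partial g}{\partial x}\frac{\partial h}{\partial y}-\frac{\partial g}{\partial y}\frac{\partial h}{\partial x}$, and let $(r,s)_0=\dim_{\mathbb C}\mathbb C\{x,y\}/(r,s)$ denote the intersection multiplicity at the origin. Then there are $\Gamma^{(k+1)},\dots,\Gamma^{(g)}\in\mathbb C\{x,y\}$, not necessarily irreducible, such that $$\operatorname{jac}(f^{(k)},f)=\Gamma^{(k+1)}\cdots\Gamma^{(g)},$$ $x$ is coprime to the product $\Gamma^{(k+2)}\cdots\Gamma^{(g)}$ in $\mathbb C\{x,y\}$, and 1. if $\alpha$ is a Newton--Puiseux root of $\Gamma^{(k+1)}$, then $\operatorname{cont}(\alpha,f)<b_{k+1}/b_0$; 2. if $\alpha$ is a Newton--Puiseux root of $\Gamma^{(i)}$ with $k+2\le i\le g$, then $\operatorname{cont}(\alpha,f)=b_i/b_0$; 3. $(\Gamma^{(i)},x)_0=n_1\cdots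 n_{i-1}(n_i-1)$ for $k+2\le i\le g$. -/

import Mathlib

/-! Plane branches over the ring of convergent complex power series: Newton-Puiseux roots, contact,
Puiseux characteristic, approximate roots, jacobian, intersection multiplicity. -/

namespace PlaneBranch

noncomputable section

/-- A formal power series converges if it converges absolutely on some polydisc of radius
`r > 0`. -/
def IsConvergent {σ : Type*} (φ : MvPowerSeries σ ℂ) : Prop :=
  ∃ r : ℝ, 0 < r ∧ Summable fun e : σ →₀ ℕ => ‖MvPowerSeries.coeff e φ‖ * r ^ e.degree

theorem IsConvergent.exists_lt {σ : Type*} {φ : MvPowerSeries σ ℂ} {r s : ℝ} (hs : 0 < s)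
    (hsr : s ≤ r) (h : Summable fun e : σ →₀ ℕ => ‖MvPowerSeries.coeff e φ‖ * r ^ e.degree) :
    Summable fun e : σ →₀ ℕ => ‖MvPowerSeries.coeff e φ‖ * s ^ e.degree := by
  refine h.of_nonneg_of_le (fun e => by positivity) (fun e => ?_)
  gcongr

theorem IsConvergent.monomial {σ : Type*} (d : σ →₀ ℕ) (c : ℂ) :
    IsConvergent (MvPowerSeries.monomial d c) := by
  classical
  refine ⟨1, one_pos, summable_of_ne_finset_zero (s := {d}) fun e he => ?_⟩
  rw [MvPowerSeries.coeff_monomial_ne (by simpa using he)]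
  simp

theorem IsConvergent.add {σ : Type*} {φ ψ : MvPowerSeries σ ℂ} (hφ : IsConvergent φ)
    (hψ : IsConvergent ψ) : IsConvergent (φ + ψ) := by
  obtain ⟨r, hr, h⟩ := hφ
  obtain ⟨s, hs, k⟩ := hψ
  have hm : 0 < min r s := lt_min hr hs
  refine ⟨min r s, hm, ((IsConvergent.exists_lt hm (min_le_left _ _) h).add
    (IsConvergent.exists_lt hm (min_le_right _ _) k)).of_nonneg_of_le
    (fun e => by positivity) (fun e => ?_)⟩
  rw [← add_mul, map_add]
  gcongr
  exact norm_add_le _ _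

theorem summable_antidiagonal {A : Type*} [AddCommMonoid A] [Finset.HasAntidiagonal A]
    {u v : A → ℝ} (hu : Summable u) (hv : Summable v) (hu0 : 0 ≤ u) (hv0 : 0 ≤ v) :
    Summable fun n => ∑ p ∈ Finset.HasAntidiagonal.antidiagonal n, u p.1 * v p.2 :=
  summable_sum_mul_antidiagonal_of_summable_mul (hu.mul_of_nonneg hv hu0 hv0)

theorem IsConvergent.mul {σ : Type*} {φ ψ : MvPowerSeries σ ℂ} (hφ : IsConvergent φ)
    (hψ : IsConvergent ψ) : IsConvergent (φ * ψ) := by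
  classical
  obtain ⟨r, hr, h⟩ := hφ
  obtain ⟨s, hs, k⟩ := hψ
  have hm : 0 < min r s := lt_min hr hs
  have h' := IsConvergent.exists_lt hm (min_le_left _ _) h
  have k' := IsConvergent.exists_lt hm (min_le_right _ _) k
  have hp := summable_antidiagonal h' k' (fun e => mul_nonneg (norm_nonneg _) (pow_nonneg hm.le _))
    (fun e => mul_nonneg (norm_nonneg _) (pow_nonneg hm.le _))
  refine ⟨min r s, hm, hp.of_nonneg_of_le
    (fun e => mul_nonneg (norm_nonneg _) (pow_nonneg hm.le _)) (fun e => ?_)⟩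
  rw [MvPowerSeries.coeff_mul]
  refine (mul_le_mul_of_nonneg_right (norm_sum_le _ _) (pow_nonneg hm.le _)).trans (le_of_eq ?_)
  rw [Finset.sum_mul]
  refine Finset.sum_congr rfl fun p hp => ?_
  rw [← Finset.HasAntidiagonal.mem_antidiagonal.1 hp, map_add, pow_add, norm_mul]
  ring

/-- The ring of convergent complex power series in the variables `σ`. -/
def convergentSeries (σ : Type*) : Subalgebra ℂ (MvPowerSeries σ ℂ) where
  carrier := {φ | IsConvergent φ}
  mul_mem' := IsConvergent.mul
  add_mem' := IsConvergent.add
  algebraMap_mem' c := IsConvergent.monomial 0 c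

/-- `ℂ{x}`. -/
def Cx : Type := convergentSeries Unit

instance : CommRing Cx := inferInstanceAs (CommRing (convergentSeries Unit))

/-- The inclusion of `ℂ{x}` in `ℂ⟦x⟧`; note that `PowerSeries ℂ` is `MvPowerSeries Unit ℂ`. -/
def Cx.incl : Cx →+* PowerSeries ℂ := (convergentSeries Unit).val.toRingHom

/-- `ℂ{x,y}`, with `x` the variable `0` and `y` the variable `1`. -/
def Cxy : Type := convergentSeries (Fin 2)

instance : CommRing Cxy := inferInstanceAs (CommRing (convergentSeries (Fin 2)))

instance : Algebra ℂ Cxy := inferInstanceAs (Algebra ℂ (convergentSeries (Fin 2)))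

/-- The inclusion of `ℂ{x,y}` in `ℂ⟦x,y⟧`. -/
def Cxy.incl : Cxy →ₐ[ℂ] MvPowerSeries (Fin 2) ℂ := (convergentSeries (Fin 2)).val

/-- The element `x` of `ℂ{x,y}`. -/
def xVar : Cxy :=
  (⟨MvPowerSeries.X 0, IsConvergent.monomial _ 1⟩ : convergentSeries (Fin 2))

/-- The series in `x, y` defined by a polynomial in `ℂ{x}[y]`. -/
def toSeries : Polynomial Cx →+* MvPowerSeries (Fin 2) ℂ :=
  Polynomial.eval₂RingHom
    ((MvPowerSeries.rename (R := ℂ) (fun _ : Unit => (0 : Fin 2))).toRingHom.comp Cx.incl)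
    (MvPowerSeries.X 1)

/-- `f ∈ ℂ{x}[y]` is a Weierstrass polynomial: `f = y ^ n + a₁(x) y ^ (n-1) + ⋯ + aₙ(x)` with
`aᵢ(0) = 0`. -/
def IsWeierstrass (f : Polynomial Cx) : Prop :=
  f.Monic ∧ ∀ i < f.natDegree, PowerSeries.constantCoeff (Cx.incl (f.coeff i)) = 0

/-- The order embedding `k ↦ k / m` of `ℕ` in `ℚ`. -/
def divEmb (m : ℕ+) : ℕ ↪o ℚ :=
  OrderEmbedding.ofStrictMono (fun k => (k : ℚ) / (m : ℕ)) fun a b hab => by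
    have hm : (0 : ℚ) < ((m : ℕ) : ℚ) := by exact_mod_cast m.pos
    have hab' : (a : ℚ) < b := by exact_mod_cast hab
    exact div_lt_div_of_pos_right hab' hm

/-- The fractional power series `φ(x ^ (1/m))`, as a Hahn series with rational exponents. -/
def fracSeries (m : ℕ+) (φ : PowerSeries ℂ) : HahnSeries ℚ ℂ :=
  HahnSeries.embDomain (divEmb m) (HahnSeries.toPowerSeries.symm φ)

/-- The set `Zer g` of Newton-Puiseux roots of `g`: the convergent fractional power series
`γ(x) = φ(x ^ (1/m))` of positive order with `g(x, γ(x)) = 0`, that is, `g(t ^ m, φ(t)) = 0`. -/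
def Zer (g : MvPowerSeries (Fin 2) ℂ) : Set (HahnSeries ℚ ℂ) :=
  {γ | ∃ (m : ℕ+) (φ : PowerSeries ℂ), IsConvergent φ ∧ PowerSeries.constantCoeff φ = 0 ∧
    γ = fracSeries m φ ∧
    MvPowerSeries.subst ![(PowerSeries.X : PowerSeries ℂ) ^ (m : ℕ), φ] g = 0}

/-- The contact order `O(δ, δ') = ord_x (δ - δ')`, which is `⊤` when `δ = δ'`. -/
def contactOrder (δ δ' : HahnSeries ℚ ℂ) : WithTop ℚ := (δ - δ').orderTop

/-- `cont(α, f) = c`: the number `c` is the maximum of `O(α, γ)` over the Newton-Puiseux roots `γ`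
of `f`. -/
def IsContact (α : HahnSeries ℚ ℂ) (f : MvPowerSeries (Fin 2) ℂ) (c : WithTop ℚ) : Prop :=
  IsGreatest (contactOrder α '' Zer f) c

/-- `(b 0, …, b g)` is the Puiseux characteristic of the irreducible Weierstrass polynomial `f`:
`b 0` is the degree of `f`, `b 1 < ⋯ < b g`, and the contact orders between different
Newton-Puiseux roots of `f` are the numbers `b 1 / b 0, …, b g / b 0`. (The values `b i` with
`i > g` are irrelevant.) -/
structure IsPuiseuxCharacteristic (f : Polynomial Cx) (g : ℕ) (b : ℕ → ℕ) : Prop where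
  zero : b 0 = f.natDegree
  strictMono : StrictMonoOn b (Set.Icc 1 g)
  contacts : {c : WithTop ℚ | ∃ γ ∈ Zer (toSeries f), ∃ γ' ∈ Zer (toSeries f),
      γ ≠ γ' ∧ c = contactOrder γ γ'} =
    (fun i : ℕ => (((b i : ℚ) / (b 0 : ℚ) : ℚ) : WithTop ℚ)) '' Set.Icc 1 g

/-- `l k = gcd (b 0, …, b k)`. -/
def charGcd (b : ℕ → ℕ) (k : ℕ) : ℕ := (Finset.range (k + 1)).gcd b

/-- `n i = l (i-1) / l i`, for `i ≥ 1`; the division is exact. -/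
def charQuot (b : ℕ → ℕ) (i : ℕ) : ℕ := charGcd b (i - 1) / charGcd b i

/-- `h` is the `p`-th approximate root of the monic polynomial `f` of degree `d`, where `p ∣ d`:
`h` is monic and `deg (f - h ^ p) < d - d / p`. -/
def IsApproximateRoot {A : Type*} [CommRing A] (p : ℕ) (f h : Polynomial A) : Prop :=
  h.Monic ∧ (f - h ^ p).degree < ((f.natDegree - f.natDegree / p : ℕ) : WithBot ℕ)

/-- The jacobian determinant `jac(g, f) = g_x f_y - g_y f_x`. -/
def jac (g f : MvPowerSeries (Fin 2) ℂ) : MvPowerSeries (Fin 2) ℂ :=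
  MvPowerSeries.pderiv ℂ 0 g * MvPowerSeries.pderiv ℂ 1 f -
    MvPowerSeries.pderiv ℂ 1 g * MvPowerSeries.pderiv ℂ 0 f

/-- The intersection multiplicity `(r, s)₀ = dim_ℂ ℂ{x,y} / (r, s)`. -/
def interMult (r s : Cxy) : ℕ∞ :=
  Cardinal.toENat (Module.rank ℂ (Cxy ⧸ Ideal.span {r, s}))

end

end PlaneBranch

/-! ### Hahn series with rational exponents: monodromy and the Euler derivation. -/

namespace PlaneBranch

noncomputable section

open HahnSeries

/-! The roots of `f` are the `N = b 0` monodromy conjugates of one series `γ`, and the proof counts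
the roots of `J = jac(f^(k), f)` in balls around them. On the ball with center `lam` and radius `h`,
put `y = lam + x^h z`. A polynomial `P` then becomes `x^A (F(z) + ...)`, and when `F ≠ 0` its degree
is the number of roots of `P` in the ball (`natDegree_eq_ballCount`). If `f` and `f^(k)` have
initial forms `F`, `G` of weights `A`, `B`, then `J` has the form `B G F' - A F G'` in weight `A + B
- h - 1` (`HasInit.jac`), so two initial forms give a root count for `J`.

Take the ball of radius `b_{k+1}/N` about `γ`, and let `a` be the coefficient of `γ` there. The
conjugates of `γ` in the ball give `f` the form `const * (z^n - a^n)^l` with `n = n_{k+1}`, `l =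
l_{k+1}`, of weight `l_k B`. The approximate root has the form `c z` of weight `B`
(`IsBranch.hasInit_approximateRoot`): this holds for the minimal polynomial of the truncation of
`γ`, and the Newton iteration leading from it to the approximate root leaves the initial form
unchanged. The leading terms in the jacobian form cancel, leaving `const * (z^n - a^n)^(l-1)`. On a
smaller ball about `γ` the form of `f^(k)` is the nonzero constant `c a`, since `a ≠ 0`. The form of
`J` is then a multiple of `F'`, of degree `l_i - 1` when the radius lies between `b_i/N` and
`b_{i+1}/N` (`IsBranch.ballCount_jacPoly`).

Summing over conjugate balls, `N/l_i * (l_i - 1)` roots of `J` have contact at least `h` with `f`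
for `h` just above `b_i/N`, and this number is constant up to the next exponent. It is already
attained at `b_{k+1}/N` itself, and it is zero beyond `b_g/N` because `l_g = 1`. So the roots of
contact at least `b_{k+1}/N` have contact exactly `b_i/N` for some `i ≥ k+2`, and differences of the
counts give `n_1 ... n_{i-1} (n_i - 1)` of them for each `i`.

The roots of one given contact are monodromy invariant, hence they are the roots of a Weierstrass
polynomial over the convergent series (`exists_isWeierstrass_of_roots`). These polynomials are the
factors of index at least `k+2`: being Weierstrass they are coprime to `x`, and their intersection
number with `x` is their degree. The cofactor is the factor of index `k+1`. -/

/-- The field of Hahn series with rational exponents, in which the fractional power series live. -/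
abbrev HQ : Type := HahnSeries ℚ ℂ

theorem le_orderTop_iff {a : HQ} {h : ℚ} :
    (h : WithTop ℚ) ≤ a.orderTop ↔ ∀ q < h, a.coeff q = 0 := by
  rw [le_orderTop_iff_forall]
  simp only [WithTop.coe_lt_coe]

theorem coeff_mul_eq_zero {a b : HQ} {A B : ℚ} (ha : ∀ q < A, a.coeff q = 0)
    (hb : ∀ q < B, b.coeff q = 0) : ∀ q < A + B, (a * b).coeff q = 0 := by
  rw [← le_orderTop_iff] at *
  rw [orderTop_mul, WithTop.coe_add]
  exact add_le_add ha hb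

/-- `A` and `B` are only lower bounds for the orders, so the coefficients there may vanish; initial
forms equal to zero are therefore allowed later. -/
theorem coeff_mul_add {a b : HQ} {A B : ℚ} (ha : ∀ q < A, a.coeff q = 0)
    (hb : ∀ q < B, b.coeff q = 0) : (a * b).coeff (A + B) = a.coeff A * b.coeff B := by
  rw [coeff_mul]
  by_cases h : a.coeff A = 0 ∨ b.coeff B = 0
  · rw [Finset.sum_eq_zero]
    · rcases h with h | h <;> simp [h]
    · rintro ⟨i, j⟩ hij
      rw [Finset.mem_antidiagonal] at hij
      obtain ⟨hi, hj, hs⟩ := hij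
      rcases lt_trichotomy i A with h1 | h1 | h1
      · exact absurd (ha i h1) hi
      · have : j = B := by linarith
        subst h1 this
        rcases h with h | h <;> simp [h]
      · exact absurd (hb j (by linarith)) hj
  · push Not at h
    rw [Finset.sum_eq_single (A, B)]
    · rintro ⟨i, j⟩ hij hne
      rw [Finset.mem_antidiagonal] at hij
      obtain ⟨hi, hj, hs⟩ := hij
      rcases lt_trichotomy i A with h1 | h1 | h1
      · exact absurd (ha i h1) hi
      · have : j = B := by linarith
        subst h1 this
        exact absurd rfl hne
      · exact absurd (hb j (by linarith)) hj
    · intro hn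
      exact absurd (by simp [Finset.mem_antidiagonal, h]) hn

/-- The power `x ^ q` of the variable. -/
def xpow (q : ℚ) : HQ := single q 1

theorem xpow_add (p q : ℚ) : xpow (p + q) = xpow p * xpow q := by
  simp [xpow, single_mul_single]

theorem xpow_zero : xpow 0 = 1 := rfl

theorem xpow_ne_zero (q : ℚ) : xpow q ≠ 0 := by simp [xpow]

theorem coeff_xpow_mul (p q : ℚ) (a : HQ) : (xpow p * a).coeff q = a.coeff (q - p) := by
  rw [mul_comm, xpow, coeff_mul_single, mul_one]

theorem orderTop_xpow (q : ℚ) : (xpow q).orderTop = q := orderTop_single one_ne_zero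

theorem xpow_pow (q : ℚ) (n : ℕ) : xpow q ^ n = xpow (n * q) := by
  simp [xpow]

/-- The embedding `φ ↦ φ(x ^ (1/m))` of `ℂ⟦t⟧`. -/
def emb (m : ℕ+) : PowerSeries ℂ →+* HQ :=
  (embDomainRingHom
    ({ toFun := fun k : ℕ => (k : ℚ) / (m : ℕ)
       map_zero' := by simp
       map_add' := fun a b => by push_cast; ring } : ℕ →+ ℚ)
    (divEmb m).injective (fun _ _ => (divEmb m).le_iff_le)).comp
      (HahnSeries.toPowerSeries.symm : PowerSeries ℂ ≃+* HahnSeries ℕ ℂ).toRingHom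

theorem emb_apply (m : ℕ+) (φ : PowerSeries ℂ) : emb m φ = fracSeries m φ := rfl

theorem coeff_emb_div (m : ℕ+) (φ : PowerSeries ℂ) (k : ℕ) :
    (emb m φ).coeff ((k : ℚ) / (m : ℕ)) = PowerSeries.coeff k φ := by
  have : (k : ℚ) / (m : ℕ) = divEmb m k := rfl
  rw [emb_apply, fracSeries, this, embDomain_coeff, coeff_toPowerSeries_symm]

theorem coeff_emb_of_ne (m : ℕ+) (φ : PowerSeries ℂ) (q : ℚ)
    (hq : ∀ k : ℕ, (k : ℚ) / (m : ℕ) ≠ q) : (emb m φ).coeff q = 0 := by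
  rw [emb_apply, fracSeries, embDomain_of_notMem_range]
  rintro ⟨k, rfl⟩
  exact hq k rfl

theorem emb_injective (m : ℕ+) : Function.Injective (emb m) := by
  intro a b hab
  ext k
  rw [← coeff_emb_div m, hab, coeff_emb_div]

theorem orderTop_emb_nonneg (m : ℕ+) (φ : PowerSeries ℂ) : 0 ≤ (emb m φ).orderTop := by
  rw [← WithTop.coe_zero, le_orderTop_iff]
  intro q hq
  refine coeff_emb_of_ne m φ q fun k hk => ?_
  have : (0 : ℚ) ≤ (k : ℚ) / (m : ℕ) := by positivity
  linarith

theorem coeff_zero_emb (m : ℕ+) (φ : PowerSeries ℂ) :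
    (emb m φ).coeff 0 = PowerSeries.constantCoeff φ := by
  have := coeff_emb_div m φ 0
  simpa using this

theorem orderTop_emb_pos_iff (m : ℕ+) (φ : PowerSeries ℂ) :
    0 < (emb m φ).orderTop ↔ PowerSeries.constantCoeff φ = 0 := by
  rw [← coeff_zero_emb m]
  constructor
  · intro h
    exact coeff_eq_zero_of_lt_orderTop h
  · intro h
    refine lt_of_le_of_ne (orderTop_emb_nonneg m φ) fun h0 => ?_
    exact coeff_orderTop_ne h0.symm h

theorem emb_expand (m k n : ℕ+) (h : (n : ℕ) = k * m) (φ : PowerSeries ℂ) :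
    emb n (φ.expand k k.ne_zero) = emb m φ := by
  have hm : ((m : ℕ) : ℚ) ≠ 0 := by positivity
  have hk : ((k : ℕ) : ℚ) ≠ 0 := by positivity
  have hn : ((n : ℕ) : ℚ) ≠ 0 := by positivity
  ext q
  by_cases hq : ∃ j : ℕ, (j : ℚ) / (n : ℕ) = q
  · obtain ⟨j, rfl⟩ := hq
    rw [coeff_emb_div]
    by_cases hj : (k : ℕ) ∣ j
    · obtain ⟨i, rfl⟩ := hj
      rw [PowerSeries.coeff_expand_mul]
      have : ((k * i : ℕ) : ℚ) / (n : ℕ) = (i : ℚ) / (m : ℕ) := by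
        rw [h]; push_cast; field_simp
      rw [this, coeff_emb_div]
    · rw [PowerSeries.coeff_expand_of_not_dvd _ _ _ hj, coeff_emb_of_ne]
      intro i hi
      apply hj
      refine ⟨i, ?_⟩
      rw [h] at hi
      push_cast at hi
      field_simp at hi
      have : i * (k : ℕ) = j := by exact_mod_cast hi
      rw [← this, mul_comm]
  · push Not at hq
    rw [coeff_emb_of_ne _ _ _ hq, coeff_emb_of_ne]
    intro i hi
    apply hq (k * i)
    rw [h, ← hi]
    push_cast
    field_simp

/-- The values of the monodromy character: `q ↦ exp (2πi j q)`. -/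
def chr (j : ℤ) (q : ℚ) : ℂ := Complex.exp (2 * Real.pi * Complex.I * (j * q))

theorem chr_add_right (j : ℤ) (p q : ℚ) : chr j (p + q) = chr j p * chr j q := by
  rw [chr, chr, chr, ← Complex.exp_add]; congr 1; push_cast; ring

theorem chr_add_left (i j : ℤ) (q : ℚ) : chr (i + j) q = chr i q * chr j q := by
  rw [chr, chr, chr, ← Complex.exp_add]; congr 1; push_cast; ring

theorem chr_zero_right (j : ℤ) : chr j 0 = 1 := by simp [chr]

theorem chr_zero_left (q : ℚ) : chr 0 q = 1 := by simp [chr]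

theorem chr_ne_zero (j : ℤ) (q : ℚ) : chr j q ≠ 0 := Complex.exp_ne_zero _

theorem chr_eq_one_iff (j : ℤ) (q : ℚ) : chr j q = 1 ↔ ∃ n : ℤ, j * q = n := by
  rw [chr, Complex.exp_eq_one_iff]
  have hpi : (2 * Real.pi * Complex.I : ℂ) ≠ 0 := Complex.two_pi_I_ne_zero
  refine exists_congr fun n => ?_
  rw [mul_comm (2 * Real.pi * Complex.I : ℂ), mul_left_inj' hpi]
  exact_mod_cast Iff.rfl

theorem chr_natCast_mul (d j : ℕ) (q : ℚ) : chr ((d * j : ℕ) : ℤ) q = chr d q ^ j := by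
  rw [chr, chr, ← Complex.exp_nat_mul]; congr 1; push_cast; ring

/-- The series `Σ χ(q) a_q x^q`, for a function `χ` on exponents. -/
def scale (χ : ℚ → ℂ) (a : HQ) : HQ where
  coeff q := χ q * a.coeff q
  isPWO_support' := a.isPWO_support.mono fun q hq => by
    simp only [Function.mem_support, mem_support] at *
    exact right_ne_zero_of_mul hq

theorem coeff_scale (χ : ℚ → ℂ) (a : HQ) (q : ℚ) : (scale χ a).coeff q = χ q * a.coeff q := rfl

theorem support_scale_subset (χ : ℚ → ℂ) (a : HQ) : (scale χ a).support ⊆ a.support := by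
  intro q hq
  simp only [mem_support, coeff_scale] at *
  exact right_ne_zero_of_mul hq

/-- Scaling coefficients can shrink the support (the Euler derivation kills the exponent 0), so two
products can be compared termwise only over a common, larger index set. -/
theorem coeff_mul_of_support_subset {a b : HQ} {s t : Set ℚ} (hs : s.IsPWO) (ht : t.IsPWO)
    (ha : a.support ⊆ s) (hb : b.support ⊆ t) (q : ℚ) :
    (a * b).coeff q = ∑ ij ∈ Finset.antidiagonal hs ht q, a.coeff ij.1 * b.coeff ij.2 := by
  rw [coeff_mul]
  refine Finset.sum_subset (fun ij h => ?_) (fun ij h hn => ?_)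
  · rw [Finset.mem_antidiagonal] at *
    exact ⟨ha h.1, hb h.2.1, h.2.2⟩
  · rw [Finset.mem_antidiagonal] at *
    by_contra h0
    exact hn ⟨left_ne_zero_of_mul h0, right_ne_zero_of_mul h0, h.2.2⟩

/-- The monodromy `x^q ↦ exp (2πi j q) x^q`. -/
def twist (j : ℤ) : HQ →+* HQ where
  toFun := scale (chr j)
  map_zero' := by ext; simp [coeff_scale]
  map_add' a b := by ext; simp [coeff_scale, mul_add]
  map_one' := by
    ext q
    rw [coeff_scale, coeff_one]
    split_ifs with h
    · rw [h, chr_zero_right, mul_one]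
    · simp
  map_mul' a b := by
    ext q
    rw [coeff_scale, coeff_mul, coeff_mul_of_support_subset a.isPWO_support b.isPWO_support
      (support_scale_subset _ _) (support_scale_subset _ _), Finset.mul_sum]
    refine Finset.sum_congr rfl fun ij h => ?_
    rw [Finset.mem_antidiagonal] at h
    rw [← h.2.2, chr_add_right, coeff_scale, coeff_scale]
    ring

theorem coeff_twist (j : ℤ) (a : HQ) (q : ℚ) : (twist j a).coeff q = chr j q * a.coeff q := rfl

theorem twist_add (i j : ℤ) (a : HQ) : twist (i + j) a = twist i (twist j a) := by
  ext q
  rw [coeff_twist, coeff_twist, coeff_twist, chr_add_left, mul_assoc]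

theorem twist_zero (a : HQ) : twist 0 a = a := by
  ext q
  rw [coeff_twist, chr_zero_left, one_mul]

theorem orderTop_twist (j : ℤ) (a : HQ) : (twist j a).orderTop = a.orderTop := by
  refine eq_of_forall_le_iff fun c => ?_
  rw [le_orderTop_iff_forall, le_orderTop_iff_forall]
  simp only [coeff_twist, mul_eq_zero, chr_ne_zero, false_or]

theorem twist_injective (j : ℤ) : Function.Injective (twist j) := (twist j).injective

/-- For `j = m > 0`, invariance says that all exponents lie in `(1/m)ℤ`: bounded denominators are
expressed through monodromy. -/
theorem twist_eq_self_iff (j : ℤ) (a : HQ) :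
    twist j a = a ↔ ∀ q, a.coeff q ≠ 0 → ∃ n : ℤ, j * q = n := by
  constructor
  · intro h q hq
    rw [← chr_eq_one_iff]
    have := congrArg (fun b : HQ => b.coeff q) h
    simp only [coeff_twist] at this
    exact mul_right_cancel₀ hq (this.trans (one_mul _).symm)
  · intro h
    ext q
    rw [coeff_twist]
    by_cases hq : a.coeff q = 0
    · simp [hq]
    · rw [(chr_eq_one_iff j q).2 (h q hq), one_mul]

theorem twist_mul_eq_self {m : ℤ} {a : HQ} (h : twist m a = a) (k : ℤ) : twist (m * k) a = a := by
  rw [twist_eq_self_iff] at *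
  intro q hq
  obtain ⟨n, hn⟩ := h q hq
  refine ⟨n * k, ?_⟩
  push_cast
  rw [← hn]
  ring

theorem twist_emb (m : ℕ+) (φ : PowerSeries ℂ) : twist (m : ℕ) (emb m φ) = emb m φ := by
  rw [twist_eq_self_iff]
  intro q hq
  have : ∃ k : ℕ, (k : ℚ) / (m : ℕ) = q := by
    by_contra h
    push Not at h
    exact hq (coeff_emb_of_ne m φ q h)
  obtain ⟨k, rfl⟩ := this
  refine ⟨k, ?_⟩
  have hm : ((m : ℕ) : ℚ) ≠ 0 := by positivity
  push_cast
  field_simp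

theorem twist_emb_one (j : ℤ) (φ : PowerSeries ℂ) : twist j (emb 1 φ) = emb 1 φ := by
  have := twist_mul_eq_self (twist_emb 1 φ) j
  simpa using this

/-- A series with nonnegative order and exponents in `(1/m)ℤ` is a power series in `x^(1/m)`. -/
theorem exists_emb_eq (m : ℕ+) {a : HQ} (h : twist (m : ℕ) a = a) (h0 : 0 ≤ a.orderTop) :
    ∃ φ, emb m φ = a := by
  have hm : ((m : ℕ) : ℚ) ≠ 0 := by positivity
  have hm' : (0 : ℚ) < ((m : ℕ) : ℚ) := by positivity
  refine ⟨PowerSeries.mk fun k => a.coeff ((k : ℚ) / (m : ℕ)), ?_⟩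
  ext q
  by_cases hq : ∃ j : ℕ, (j : ℚ) / (m : ℕ) = q
  · obtain ⟨j, rfl⟩ := hq
    rw [coeff_emb_div, PowerSeries.coeff_mk]
  · push Not at hq
    rw [coeff_emb_of_ne _ _ _ hq]
    by_contra hne
    obtain ⟨n, hn⟩ := (twist_eq_self_iff _ _).1 h q (Ne.symm hne)
    have hq0 : 0 ≤ q := by
      by_contra hlt
      push Not at hlt
      rw [← WithTop.coe_zero, le_orderTop_iff] at h0
      exact hne (h0 q hlt).symm
    have hn0 : 0 ≤ n := by
      have : (0 : ℚ) ≤ n := by rw [← hn]; push_cast; positivity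
      exact_mod_cast this
    obtain ⟨k, rfl⟩ := Int.eq_ofNat_of_zero_le hn0
    apply hq k
    push_cast at hn
    rw [div_eq_iff hm, mul_comm, hn]

theorem twist_den_xpow (q : ℚ) : twist q.den (xpow q) = xpow q := by
  rw [twist_eq_self_iff]
  intro p hp
  have : p = q := by
    by_contra h
    exact hp (coeff_single_of_ne h)
  subst this
  exact ⟨p.num, by simp⟩

/-- The Euler derivation `x d/dx`. -/
def euler : HQ →+ HQ where
  toFun := scale fun q => (q : ℂ)
  map_zero' := by ext; simp [coeff_scale]
  map_add' a b := by ext; simp [coeff_scale, mul_add]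

theorem coeff_euler (a : HQ) (q : ℚ) : (euler a).coeff q = q * a.coeff q := rfl

theorem support_euler_subset (a : HQ) : (euler a).support ⊆ a.support := support_scale_subset _ _

theorem euler_mul (a b : HQ) : euler (a * b) = euler a * b + a * euler b := by
  ext q
  rw [HahnSeries.coeff_add, coeff_euler, coeff_mul,
    coeff_mul_of_support_subset a.isPWO_support b.isPWO_support
      (support_euler_subset _) (subset_refl _),
    coeff_mul_of_support_subset a.isPWO_support b.isPWO_support
      (subset_refl _) (support_euler_subset _), Finset.mul_sum, ← Finset.sum_add_distrib]
  refine Finset.sum_congr rfl fun ij h => ?_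
  rw [Finset.mem_antidiagonal] at h
  rw [← h.2.2, coeff_euler, coeff_euler]
  push_cast
  ring

end

end PlaneBranch

/-! ### Formal power series algebraic over `ℂ{x}` converge. -/

namespace PlaneBranch

noncomputable section

open Polynomial

theorem isConvergent_iff_summable (φ : PowerSeries ℂ) :
    IsConvergent φ ↔ ∃ r : ℝ, 0 < r ∧ Summable fun n : ℕ => ‖PowerSeries.coeff n φ‖ * r ^ n := by
  refine exists_congr fun r => and_congr_right fun _ => ?_
  let e : ℕ ≃ (Unit →₀ ℕ) :=
    { toFun := fun n => Finsupp.single () n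
      invFun := fun v => v ()
      left_inv := fun n => by simp
      right_inv := fun v => by ext; simp }
  rw [← e.summable_iff]
  refine iff_of_eq (congrArg Summable (funext fun n => ?_))
  simp [e, PowerSeries.coeff, Finsupp.degree_single]

theorem isConvergent_iff_bounded (φ : PowerSeries ℂ) :
    IsConvergent φ ↔ ∃ r : ℝ, 0 < r ∧ ∃ K : ℝ, ∀ n : ℕ, ‖PowerSeries.coeff n φ‖ * r ^ n ≤ K := by
  rw [isConvergent_iff_summable]
  constructor
  · rintro ⟨r, hr, h⟩
    exact ⟨r, hr, _, fun n => h.le_tsum n fun j _ => by positivity⟩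
  · rintro ⟨r, hr, K, hK⟩
    refine ⟨r / 2, by positivity, Summable.of_nonneg_of_le (fun n => by positivity) (fun n => ?_)
      ((summable_geometric_two).mul_left K)⟩
    rw [div_pow, one_div, inv_pow, mul_div_assoc', div_eq_mul_inv]
    exact mul_le_mul_of_nonneg_right (hK n) (by positivity)

theorem isConvergent_X_pow (k : ℕ) : IsConvergent ((PowerSeries.X : PowerSeries ℂ) ^ k) := by
  rw [PowerSeries.X_pow_eq]
  exact IsConvergent.monomial _ _

theorem IsConvergent.of_X_pow_mul {k : ℕ} {φ : PowerSeries ℂ}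
    (h : IsConvergent (PowerSeries.X ^ k * φ)) : IsConvergent φ := by
  rw [isConvergent_iff_bounded] at *
  obtain ⟨r, hr, K, hK⟩ := h
  refine ⟨r, hr, K / r ^ k, fun n => ?_⟩
  have := hK (n + k)
  rw [PowerSeries.coeff_X_pow_mul] at this
  rw [le_div_iff₀ (by positivity), mul_assoc, ← pow_add]
  exact this

/-- Halving the radius absorbs the factor `n + 1 ≤ 2^n`. -/
theorem IsConvergent.derivative {φ : PowerSeries ℂ} (h : IsConvergent φ) :
    IsConvergent (PowerSeries.derivative ℂ φ) := by
  rw [isConvergent_iff_bounded] at *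
  obtain ⟨r, hr, K, hK⟩ := h
  refine ⟨r / 2, by positivity, K / r, fun n => ?_⟩
  have h1 := hK (n + 1)
  have h2 : ((n : ℝ) + 1) ≤ 2 ^ n := by exact_mod_cast Nat.lt_two_pow_self (n := n)
  rw [PowerSeries.coeff_derivative, norm_mul, le_div_iff₀ hr, div_pow]
  have h3 : ‖((n : ℂ) + 1)‖ = (n : ℝ) + 1 := by
    have : ((n : ℂ) + 1) = ((n + 1 : ℕ) : ℂ) := by push_cast; ring
    rw [this, Complex.norm_natCast]; push_cast; ring
  rw [h3]
  calc _ = (‖PowerSeries.coeff (n + 1) φ‖ * r ^ (n + 1)) * (((n : ℝ) + 1) / 2 ^ n) := by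
        rw [pow_succ]; ring
    _ ≤ (‖PowerSeries.coeff (n + 1) φ‖ * r ^ (n + 1)) * 1 := by
        gcongr
        rw [div_le_one (by positivity)]
        exact h2
    _ ≤ K := by rw [mul_one]; exact h1

theorem isConvergent_expand_iff {k : ℕ} (hk : k ≠ 0) {φ : PowerSeries ℂ} :
    IsConvergent (φ.expand k hk) ↔ IsConvergent φ := by
  rw [isConvergent_iff_bounded, isConvergent_iff_bounded]
  constructor
  · rintro ⟨r, hr, K, hK⟩
    refine ⟨r ^ k, by positivity, K, fun n => ?_⟩
    have := hK (k * n)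
    rwa [PowerSeries.coeff_expand_mul, pow_mul] at this
  · rintro ⟨r, hr, K, hK⟩
    have hm : 0 < min r 1 := lt_min hr one_pos
    refine ⟨min r 1, hm, K, fun n => ?_⟩
    have hK0 : 0 ≤ K := le_trans (by positivity) (hK 0)
    by_cases hn : k ∣ n
    · obtain ⟨j, rfl⟩ := hn
      rw [PowerSeries.coeff_expand_mul]
      refine le_trans ?_ (hK j)
      gcongr
      calc (min r 1) ^ (k * j) ≤ (min r 1) ^ j :=
            pow_le_pow_of_le_one hm.le (min_le_right _ _) (Nat.le_mul_of_pos_left j (by omega))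
        _ ≤ r ^ j := pow_le_pow_left₀ hm.le (min_le_left _ _) j
    · rw [PowerSeries.coeff_expand_of_not_dvd _ _ _ hn]
      simpa using hK0

/-- A convergent series, as an element of `ℂ{x}`. -/
def Cx.mk (φ : PowerSeries ℂ) (h : IsConvergent φ) : Cx := (⟨φ, h⟩ : convergentSeries Unit)

@[simp]
theorem Cx.incl_mk (φ : PowerSeries ℂ) (h : IsConvergent φ) : Cx.incl (Cx.mk φ h) = φ := rfl

theorem Cx.incl_injective : Function.Injective Cx.incl := Subtype.val_injective

theorem Cx.isConvergent_incl (a : Cx) : IsConvergent (Cx.incl a) := a.2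

instance : IsDomain Cx := inferInstanceAs (IsDomain (convergentSeries Unit))

instance : Algebra ℂ Cx := inferInstanceAs (Algebra ℂ (convergentSeries Unit))

instance : CharZero Cx := Algebra.charZero_of_charZero ℂ Cx

theorem Cx.incl_algebraMap (c : ℂ) : Cx.incl (algebraMap ℂ Cx c) = PowerSeries.C c := rfl

/-- The partial sums of `Σ |a_n| r^n`. -/
def partialNorm (r : ℝ) (M : ℕ) (φ : PowerSeries ℂ) : ℝ :=
  ∑ n ∈ Finset.range (M + 1), ‖PowerSeries.coeff n φ‖ * r ^ n

theorem partialNorm_nonneg {r : ℝ} (hr : 0 ≤ r) (M : ℕ) (φ : PowerSeries ℂ) :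
    0 ≤ partialNorm r M φ := Finset.sum_nonneg fun n _ => by positivity

theorem partialNorm_add_le {r : ℝ} (hr : 0 ≤ r) (M : ℕ) (φ ψ : PowerSeries ℂ) :
    partialNorm r M (φ + ψ) ≤ partialNorm r M φ + partialNorm r M ψ := by
  rw [partialNorm, partialNorm, partialNorm, ← Finset.sum_add_distrib]
  refine Finset.sum_le_sum fun n _ => ?_
  rw [← add_mul, map_add]
  gcongr
  exact norm_add_le _ _

/-- The pairs of exponents with sum at most `M` lie in the square of pairs with both entries at most
`M`, and all terms are nonnegative. Partial sums are used because convergence is not known in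
advance. -/
theorem partialNorm_mul_le {r : ℝ} (hr : 0 ≤ r) (M : ℕ) (φ ψ : PowerSeries ℂ) :
    partialNorm r M (φ * ψ) ≤ partialNorm r M φ * partialNorm r M ψ := by
  have h1 : partialNorm r M (φ * ψ) ≤ ∑ n ∈ Finset.range (M + 1),
      ∑ p ∈ Finset.HasAntidiagonal.antidiagonal n, (‖PowerSeries.coeff p.1 φ‖ * r ^ p.1) *
        (‖PowerSeries.coeff p.2 ψ‖ * r ^ p.2) := by
    refine Finset.sum_le_sum fun n _ => ?_
    rw [PowerSeries.coeff_mul]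
    refine (mul_le_mul_of_nonneg_right (norm_sum_le _ _) (by positivity)).trans (le_of_eq ?_)
    rw [Finset.sum_mul]
    refine Finset.sum_congr rfl fun p hp => ?_
    rw [← Finset.HasAntidiagonal.mem_antidiagonal.1 hp, norm_mul, pow_add]
    ring
  refine h1.trans ?_
  rw [partialNorm, partialNorm, Finset.sum_mul_sum, ← Finset.sum_product', Finset.sum_sigma']
  refine le_trans (le_of_eq (Finset.sum_image (s := (Finset.range (M + 1)).sigma
    fun n => Finset.HasAntidiagonal.antidiagonal n) (g := fun x : (_ : ℕ) × ℕ × ℕ => x.2)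
    (f := fun p : ℕ × ℕ => (‖PowerSeries.coeff p.1 φ‖ * r ^ p.1) *
        (‖PowerSeries.coeff p.2 ψ‖ * r ^ p.2)) ?_).symm) ?_
  · rintro ⟨n, p⟩ h ⟨n', p'⟩ h' (rfl : p = p')
    simp only [Finset.coe_sigma, Set.mem_sigma_iff, Finset.mem_coe,
      Finset.HasAntidiagonal.mem_antidiagonal] at h h'
    obtain rfl : n = n' := by rw [← h.2, ← h'.2]
    rfl
  · refine Finset.sum_le_sum_of_subset_of_nonneg (fun p hp => ?_) fun p _ _ => by positivity
    simp only [Finset.mem_image, Finset.mem_sigma, Finset.mem_range,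
      Finset.HasAntidiagonal.mem_antidiagonal,
      Sigma.exists] at hp
    obtain ⟨n, q, ⟨hn, hq⟩, rfl⟩ := hp
    simp only [Finset.mem_product, Finset.mem_range]
    omega

theorem partialNorm_one (r : ℝ) (M : ℕ) : partialNorm r M 1 = 1 := by
  rw [partialNorm, Finset.sum_eq_single 0]
  · simp
  · intro n _ hn
    simp [PowerSeries.coeff_one, hn]
  · simp

theorem partialNorm_pow_le {r : ℝ} (hr : 0 ≤ r) (M : ℕ) (φ : PowerSeries ℂ) (i : ℕ) :
    partialNorm r M (φ ^ i) ≤ partialNorm r M φ ^ i := by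
  induction i with
  | zero => simp [partialNorm_one]
  | succ i ih =>
    rw [pow_succ, pow_succ]
    refine (partialNorm_mul_le hr M _ _).trans ?_
    gcongr
    exact partialNorm_nonneg hr M φ

theorem partialNorm_sum_le {r : ℝ} (hr : 0 ≤ r) (M : ℕ) {ι : Type*} (s : Finset ι)
    (φ : ι → PowerSeries ℂ) :
    partialNorm r M (∑ i ∈ s, φ i) ≤ ∑ i ∈ s, partialNorm r M (φ i) := by
  classical
  induction s using Finset.induction_on with
  | empty => simp [partialNorm]
  | insert a s ha ih =>
    rw [Finset.sum_insert ha, Finset.sum_insert ha]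
    exact (partialNorm_add_le hr M _ _).trans (by gcongr)

theorem partialNorm_X_mul (r : ℝ) (M : ℕ) (φ : PowerSeries ℂ) :
    partialNorm r (M + 1) (PowerSeries.X * φ) = r * partialNorm r M φ := by
  rw [partialNorm, Finset.sum_range_succ', partialNorm, Finset.mul_sum]
  simp only [PowerSeries.coeff_succ_X_mul, PowerSeries.coeff_zero_X_mul, norm_zero, zero_mul,
    add_zero]
  exact Finset.sum_congr rfl fun n _ => by ring

theorem partialNorm_mono {r s : ℝ} (hr : 0 ≤ r) (hrs : r ≤ s) (M : ℕ) (φ : PowerSeries ℂ) :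
    partialNorm r M φ ≤ partialNorm s M φ :=
  Finset.sum_le_sum fun n _ => by gcongr

theorem IsConvergent.partialNorm_le {φ : PowerSeries ℂ} (h : IsConvergent φ) :
    ∃ r : ℝ, 0 < r ∧ ∃ K : ℝ, ∀ M, partialNorm r M φ ≤ K := by
  obtain ⟨r, hr, h⟩ := (isConvergent_iff_summable φ).1 h
  exact ⟨r, hr, _, fun M => h.sum_le_tsum _ fun n _ => by positivity⟩

theorem exists_uniform_partialNorm_le {ι : Type*} (s : Finset ι) (φ : ι → PowerSeries ℂ)
    (h : ∀ i ∈ s, IsConvergent (φ i)) :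
    ∃ r : ℝ, 0 < r ∧ ∃ K : ℝ, 0 ≤ K ∧ ∀ i ∈ s, ∀ M, partialNorm r M (φ i) ≤ K := by
  classical
  induction s using Finset.induction_on with
  | empty => exact ⟨1, one_pos, 0, le_rfl, by simp⟩
  | insert a s ha ih =>
    obtain ⟨r, hr, K, hK0, hK⟩ := ih fun i hi => h i (Finset.mem_insert_of_mem hi)
    obtain ⟨r', hr', K', hK'⟩ := (h a (Finset.mem_insert_self _ _)).partialNorm_le
    have hm : 0 < min r r' := lt_min hr hr'
    refine ⟨min r r', hm, max K K', le_max_of_le_left hK0, fun i hi M => ?_⟩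
    rcases Finset.mem_insert.1 hi with rfl | hi
    · exact ((partialNorm_mono hm.le (min_le_right _ _) M _).trans (hK' M)).trans (le_max_right _ _)
    · exact ((partialNorm_mono hm.le (min_le_left _ _) M _).trans (hK i hi M)).trans
        (le_max_left _ _)

/-- The solution of a fixed point equation `χ = a + x T(x, χ)` with convergent data converges. -/
theorem isConvergent_of_fixed_point {χ : PowerSeries ℂ} {a : Cx} {T : Cx[X]}
    (h : χ = Cx.incl a + PowerSeries.X * T.eval₂ Cx.incl χ) : IsConvergent χ := by
  obtain ⟨r₁, hr₁, K₁, hK₁0, hK₁⟩ := exists_uniform_partialNorm_le (Finset.range (T.natDegree + 1))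
    (fun i => Cx.incl (T.coeff i)) fun i _ => Cx.isConvergent_incl _
  obtain ⟨r₂, hr₂, K₂, hK₂⟩ := (Cx.isConvergent_incl a).partialNorm_le
  have hK₂0 : 0 ≤ K₂ := (partialNorm_nonneg hr₂.le 0 _).trans (hK₂ 0)
  set D : ℝ := ∑ i ∈ Finset.range (T.natDegree + 1), K₁ * (K₂ + 1) ^ i with hD
  have hD0 : 0 ≤ D := Finset.sum_nonneg fun i _ => by positivity
  -- `D` bounds `T(x, χ)` as long as `χ` is bounded by `K₂ + 1`; the radius is chosen with `r * D ≤
  -- 1`, so that the bound `K₂ + 1` reproduces itself.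
  set r : ℝ := min (min r₁ r₂) (1 / (D + 1)) with hr
  have hr0 : 0 < r := lt_min (lt_min hr₁ hr₂) (by positivity)
  have hr1 : r ≤ r₁ := (min_le_left _ _).trans (min_le_left _ _)
  have hr2 : r ≤ r₂ := (min_le_left _ _).trans (min_le_right _ _)
  have hrD : r * D ≤ 1 := by
    have : r ≤ 1 / (D + 1) := min_le_right _ _
    rw [le_div_iff₀ (by positivity)] at this
    nlinarith
  -- The factor `x` in front of `T` makes the induction possible: the partial sum of order `M + 1`
  -- of `x T` involves only that of order `M` of `T`.
  have key : ∀ M, partialNorm r M χ ≤ K₂ + 1 := by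
    intro M
    induction M with
    | zero =>
      have : partialNorm r 0 χ = partialNorm r 0 (Cx.incl a) := by
        simp only [partialNorm, zero_add, Finset.range_one, Finset.sum_singleton]
        rw [h]
        simp
      rw [this]
      exact ((partialNorm_mono hr0.le hr2 0 _).trans (hK₂ 0)).trans (by linarith)
    | succ M ih =>
      have hT : partialNorm r M (T.eval₂ Cx.incl χ) ≤ D := by
        rw [eval₂_eq_sum_range]
        refine (partialNorm_sum_le hr0.le M _ _).trans (Finset.sum_le_sum fun i hi => ?_)
        refine (partialNorm_mul_le hr0.le M _ _).trans ?_
        refine mul_le_mul ((partialNorm_mono hr0.le hr1 M _).trans (hK₁ i hi M))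
          ((partialNorm_pow_le hr0.le M _ _).trans ?_) (partialNorm_nonneg hr0.le _ _) hK₁0
        exact pow_le_pow_left₀ (partialNorm_nonneg hr0.le _ _) ih i
      rw [h]
      refine (partialNorm_add_le hr0.le _ _ _).trans (add_le_add
        ((partialNorm_mono hr0.le hr2 _ _).trans (hK₂ _)) ?_)
      rw [partialNorm_X_mul]
      exact (mul_le_mul_of_nonneg_left hT hr0.le).trans hrD
  rw [isConvergent_iff_bounded]
  refine ⟨r, hr0, K₂ + 1, fun n => le_trans ?_ (key n)⟩
  exact Finset.single_le_sum (f := fun n => ‖PowerSeries.coeff n χ‖ * r ^ n)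
    (fun i _ => by positivity) (Finset.mem_range.2 (Nat.lt_succ_self n))

/-- The quadratic remainder is kept as a polynomial over `R` evaluated at `s`, the form required of
`T` in `isConvergent_of_fixed_point`. -/
theorem eval₂_eq_taylor_two {R S : Type*} [CommRing R] [CommRing S] (i : R →+* S) (P : R[X])
    (a : R) (s : S) :
    P.eval₂ i (i a + s) = i (P.eval a) + s * i (P.derivative.eval a) +
      s ^ 2 * ((taylor a P).divX.divX).eval₂ i s := by
  have h1 : P.eval₂ i (i a + s) = (taylor a P).eval₂ i s := by
    rw [taylor_apply, eval₂_comp]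
    simp [add_comm]
  have h2 : taylor a P = (taylor a P).divX.divX * X ^ 2 + C (P.derivative.eval a) * X +
      C (P.eval a) := by
    conv_lhs => rw [← divX_mul_X_add (taylor a P), ← divX_mul_X_add (taylor a P).divX]
    rw [taylor_coeff_zero, coeff_divX, zero_add, taylor_coeff_one]
    ring
  rw [h1]
  conv_lhs => rw [h2]
  simp only [eval₂_add, eval₂_mul, eval₂_X_pow, eval₂_C, eval₂_X]
  ring

/-- A formal power series with a simple polynomial equation over `ℂ{x}` converges. -/
theorem isConvergent_of_simple_root {φ : PowerSeries ℂ} {P : Cx[X]}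
    (h : P.eval₂ Cx.incl φ = 0) (h' : P.derivative.eval₂ Cx.incl φ ≠ 0) : IsConvergent φ := by
  obtain ⟨e, u, hu, he⟩ : ∃ (e : ℕ) (u : PowerSeries ℂ), PowerSeries.constantCoeff u ≠ 0 ∧
      P.derivative.eval₂ Cx.incl φ = PowerSeries.X ^ e * u :=
    ⟨_, _, PowerSeries.constantCoeff_divXPowOrder_eq_zero_iff.not.2 h',
      (PowerSeries.X_pow_order_mul_divXPowOrder).symm⟩
  -- With `e` the order of `P'(φ)`, truncating just beyond `x^e` is Newton's condition: `P(a)` is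
  -- then divisible by `x^(2e+1)`, and the remainder `χ` solves a fixed point equation.
  obtain ⟨a, χ, hφ⟩ : ∃ (a : Cx) (χ : PowerSeries ℂ),
      φ = Cx.incl a + PowerSeries.X ^ (e + 1) * χ := by
    refine ⟨Cx.mk (PowerSeries.trunc (e + 1) φ : ℂ[X]) ?_, _,
      (PowerSeries.eq_X_pow_mul_shift_add_trunc (e + 1) φ).trans (add_comm _ _)⟩
    rw [isConvergent_iff_summable]
    refine ⟨1, one_pos, summable_of_ne_finset_zero (s := Finset.range (e + 1)) fun n hn => ?_⟩
    rw [Polynomial.coeff_coe, PowerSeries.coeff_trunc, if_neg (by simpa using hn)]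
    simp
  set E := ((taylor a P).divX.divX).eval₂ Cx.incl (PowerSeries.X ^ (e + 1) * χ) with hE
  have h0 : Cx.incl (P.eval a) + PowerSeries.X ^ (e + 1) * χ * Cx.incl (P.derivative.eval a) +
      (PowerSeries.X ^ (e + 1) * χ) ^ 2 * E = 0 := by
    rw [← eval₂_eq_taylor_two, ← hφ, h]
  -- `P'(a)` and `P'(φ)` differ by a multiple of `x^(e+1)`, so both have order exactly `e`.
  obtain ⟨v, hv0, hv⟩ : ∃ v : PowerSeries ℂ, PowerSeries.constantCoeff v ≠ 0 ∧
      Cx.incl (P.derivative.eval a) = PowerSeries.X ^ e * v := by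
    have h2 := eval₂_eq_taylor_two Cx.incl P.derivative a (PowerSeries.X ^ (e + 1) * χ)
    rw [← hφ, he] at h2
    refine ⟨u - PowerSeries.X * (χ * Cx.incl (P.derivative.derivative.eval a) +
      χ ^ 2 * PowerSeries.X ^ (e + 1) * (((taylor a P.derivative).divX.divX).eval₂ Cx.incl
        (PowerSeries.X ^ (e + 1) * χ))), by simpa using hu, ?_⟩
    rw [mul_sub, h2]
    ring
  have hvc : IsConvergent v := IsConvergent.of_X_pow_mul (k := e) (hv ▸ Cx.isConvergent_incl _)
  -- This is `P(a) / x^(2e+1)`, hence convergent although it is written in terms of `χ`.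
  set q : PowerSeries ℂ := -(v * χ + PowerSeries.X * χ ^ 2 * E) with hq
  have hqc : IsConvergent q := by
    refine IsConvergent.of_X_pow_mul (k := 2 * e + 1) ?_
    have : PowerSeries.X ^ (2 * e + 1) * q = Cx.incl (P.eval a) := by
      rw [hv] at h0
      rw [hq]
      linear_combination (-1 : PowerSeries ℂ) * h0
    rw [this]
    exact Cx.isConvergent_incl _
  set c := PowerSeries.constantCoeff v with hc
  obtain ⟨w, hw⟩ : ∃ w, v = PowerSeries.C c + PowerSeries.X * w :=
    ⟨_, by rw [← PowerSeries.sub_const_eq_X_mul_shift]; ring⟩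
  have hwc : IsConvergent w := by
    refine IsConvergent.of_X_pow_mul (k := 1) ?_
    have : PowerSeries.X ^ 1 * w = v + Cx.incl (algebraMap ℂ Cx (-c)) := by
      rw [Cx.incl_algebraMap, hw, map_neg, pow_one]
      ring
    rw [this]
    exact hvc.add (Cx.isConvergent_incl _)
  have hcc : PowerSeries.C c⁻¹ * PowerSeries.C c = (1 : PowerSeries ℂ) := by
    rw [← map_mul, inv_mul_cancel₀ hv0, map_one]
  have hχ : IsConvergent χ := by
    -- The relation `v χ = -q - x χ² E` with `v = c + x w` is solved for the term `c χ`.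
    refine isConvergent_of_fixed_point (a := algebraMap ℂ Cx (-c⁻¹) * Cx.mk q hqc)
      (T := C (algebraMap ℂ Cx (-c⁻¹)) * (C (Cx.mk w hwc) * X + X ^ 2 *
        ((taylor a P).divX.divX).comp (C (Cx.mk _ (isConvergent_X_pow (e + 1))) * X))) ?_
    simp only [eval₂_add, eval₂_mul, eval₂_C, eval₂_X_pow, eval₂_X, map_mul, Cx.incl_algebraMap,
      eval₂_comp, Cx.incl_mk, map_neg, eval₂_neg]
    rw [← hE, hq]
    linear_combination (-χ) * hcc - (PowerSeries.C c⁻¹ * χ) * hw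
  rw [hφ]
  exact (Cx.isConvergent_incl a).add ((isConvergent_X_pow _).mul hχ)

/-- A formal power series that is algebraic over `ℂ{x}` converges. -/
theorem isConvergent_of_root {φ : PowerSeries ℂ} {P : Cx[X]} (hP : P ≠ 0)
    (h : P.eval₂ Cx.incl φ = 0) : IsConvergent φ := by
  induction hn : P.natDegree using Nat.strong_induction_on generalizing P with
  | _ n ih =>
    by_cases h' : P.derivative.eval₂ Cx.incl φ = 0
    · have hd : P.natDegree ≠ 0 := by
        intro h0
        rw [eq_C_of_natDegree_eq_zero h0, eval₂_C] at h
        rw [eq_C_of_natDegree_eq_zero h0, (map_eq_zero_iff _ Cx.incl_injective).1 h, C_0] at hP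
        exact hP rfl
      refine ih _ ?_ (P := P.derivative) ?_ h' rfl
      · rw [← hn]
        exact natDegree_derivative_lt hd
      · intro h0
        exact hd (derivative_eq_zero.1 h0)
    · exact isConvergent_of_simple_root h h'

end

end PlaneBranch

/-! ### The Newton-Puiseux theorem. -/

namespace PlaneBranch

noncomputable section

open Polynomial

instance : IsAdicComplete (IsLocalRing.maximalIdeal (PowerSeries ℂ)) (PowerSeries ℂ) := by
  rw [PowerSeries.maximalIdeal_eq_span_X]
  infer_instance

theorem residue_eq_zero_iff_constantCoeff (a : PowerSeries ℂ) :
    IsLocalRing.residue (PowerSeries ℂ) a = 0 ↔ PowerSeries.constantCoeff a = 0 := by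
  rw [IsLocalRing.residue_eq_zero_iff, PowerSeries.maximalIdeal_eq_span_X,
    Ideal.mem_span_singleton, PowerSeries.X_dvd_iff]

/-- Hensel's lemma: a monic polynomial over `ℂ⟦t⟧` whose reduction has the root `0`, but is not a
power of the variable, has a proper monic factor. -/
theorem exists_monic_factor {P : (PowerSeries ℂ)[X]}
    (h0 : PowerSeries.constantCoeff (P.coeff 0) = 0) {i : ℕ} (hi : i < P.natDegree)
    (hne : PowerSeries.constantCoeff (P.coeff i) ≠ 0) :
    ∃ Q : (PowerSeries ℂ)[X], Q.Monic ∧ Q ∣ P ∧ 0 < Q.natDegree ∧ Q.natDegree < P.natDegree := by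
  set A := PowerSeries ℂ
  have hg : ((P : PowerSeries A)).map (IsLocalRing.residue A) ≠ 0 := by
    intro h
    have := congrArg (PowerSeries.coeff i) h
    rw [PowerSeries.coeff_map, Polynomial.coeff_coe, map_zero,
      residue_eq_zero_iff_constantCoeff] at this
    exact hne this
  -- Weierstrass preparation in `y` over the complete ring `ℂ⟦t⟧`: the degree of `Q` is the order in
  -- `y` of the reduction of `P`, which is positive by `h0` and at most `i`.
  obtain ⟨Q, u, H⟩ := PowerSeries.exists_isWeierstrassFactorization hg
  have hQ : Q.Monic := H.isDistinguishedAt.monic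
  have hord := H.natDegree_eq_toNat_order_map
  have hle : Q.natDegree ≤ i := by
    rw [hord]
    refine ENat.toNat_le_of_le_natCast (PowerSeries.order_le _ ?_)
    rw [PowerSeries.coeff_map, Polynomial.coeff_coe, Ne, residue_eq_zero_iff_constantCoeff]
    exact hne
  have hpos : 0 < Q.natDegree := by
    rw [Nat.pos_iff_ne_zero]
    intro h
    rw [h] at hord
    have h1 : ((P : PowerSeries A).map (IsLocalRing.residue A)).order ≠ ⊤ := by
      rwa [Ne, PowerSeries.order_eq_top]
    have h2 : ((P : PowerSeries A).map (IsLocalRing.residue A)).order = 0 := by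
      rw [← ENat.natCast_toNat h1, ← hord]; rfl
    have h3 := (PowerSeries.order_eq_nat (n := 0)).1 h2
    apply h3.1
    rw [PowerSeries.coeff_map, Polynomial.coeff_coe, residue_eq_zero_iff_constantCoeff]
    exact h0
  refine ⟨Q, hQ, ?_, hpos, by omega⟩
  rw [← modByMonic_eq_zero_iff_dvd hQ]
  have hD := H.isDistinguishedAt.isWeierstrassDivisorAt'
  have hn : ((Q : PowerSeries A).map
      (Ideal.Quotient.mk (IsLocalRing.maximalIdeal A))).order.toNat = Q.natDegree := by
    have := congrArg ENat.toNat (H.isDistinguishedAt.coe_natDegree_eq_order_map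
      (Q : PowerSeries A) 1 (by
        rw [PowerSeries.constantCoeff_one, ← Ideal.ne_top_iff_one]
        exact (IsLocalRing.maximalIdeal.isMaximal A).ne_top) (by simp))
    exact this.symm
  -- `P = Q u` holds with a power series `u` in `y`. Uniqueness of Weierstrass division identifies
  -- this with the polynomial division of `P` by `Q`, whose remainder is therefore zero.
  refine (hD.eq_of_mul_add_eq_mul_add (q := (P /ₘ Q : A[X])) (q' := u) (r' := 0) ?_ ?_ ?_).2
  · rw [hn, ← degree_eq_natDegree hQ.ne_zero]
    exact degree_modByMonic_lt _ hQ
  · rw [degree_zero]; exact WithBot.bot_lt_coe _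
  · rw [Polynomial.coe_zero, add_zero, ← H.eq_mul, ← Polynomial.coe_mul, ← Polynomial.coe_add,
      add_comm, modByMonic_add_div]

/-- The subfield of `HQ` of formal Puiseux series. -/
def pui : Subfield HQ where
  carrier := {a | ∃ m : ℕ+, twist (m : ℕ) a = a}
  mul_mem' := by
    rintro a b ⟨m, hm⟩ ⟨n, hn⟩
    refine ⟨m * n, ?_⟩
    have h1 := twist_mul_eq_self hm (n : ℕ)
    have h2 := twist_mul_eq_self hn (m : ℕ)
    rw [mul_comm] at h2
    rw [PNat.mul_coe, Nat.cast_mul, map_mul, h1, h2]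
  one_mem' := ⟨1, map_one _⟩
  add_mem' := by
    rintro a b ⟨m, hm⟩ ⟨n, hn⟩
    refine ⟨m * n, ?_⟩
    have h1 := twist_mul_eq_self hm (n : ℕ)
    have h2 := twist_mul_eq_self hn (m : ℕ)
    rw [mul_comm] at h2
    rw [PNat.mul_coe, Nat.cast_mul, map_add, h1, h2]
  zero_mem' := ⟨1, map_zero _⟩
  neg_mem' := by
    rintro a ⟨m, hm⟩
    exact ⟨m, by rw [map_neg, hm]⟩
  inv_mem' := by
    rintro a ⟨m, hm⟩
    exact ⟨m, by rw [map_inv₀, hm]⟩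

theorem mem_pui {a : HQ} : a ∈ pui ↔ ∃ m : ℕ+, twist (m : ℕ) a = a := Iff.rfl

theorem emb_mem_pui (m : ℕ+) (φ : PowerSeries ℂ) : emb m φ ∈ pui := ⟨m, twist_emb m φ⟩

theorem xpow_mem_pui (q : ℚ) : xpow q ∈ pui := ⟨⟨q.den, q.den_pos⟩, twist_den_xpow q⟩

theorem exists_common_twist {ι : Type*} (s : Finset ι) (a : ι → HQ) (h : ∀ i ∈ s, a i ∈ pui) :
    ∃ m : ℕ+, ∀ i ∈ s, twist (m : ℕ) (a i) = a i := by
  classical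
  induction s using Finset.induction_on with
  | empty => exact ⟨1, by simp⟩
  | insert j s hj ih =>
    obtain ⟨m, hm⟩ := ih fun i hi => h i (Finset.mem_insert_of_mem hi)
    obtain ⟨n, hn⟩ := h j (Finset.mem_insert_self _ _)
    refine ⟨m * n, fun i hi => ?_⟩
    rw [PNat.mul_coe, Nat.cast_mul]
    rcases Finset.mem_insert.1 hi with rfl | hi
    · rw [mul_comm]; exact twist_mul_eq_self hn _
    · exact twist_mul_eq_self (hm i hi) _

/-- A monic polynomial with coefficients of nonnegative order that are Puiseux series comes from
`ℂ⟦t⟧[y]`. -/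
theorem exists_map_emb_eq {P : HQ[X]} (hP : P.Monic) (h : ∀ i, P.coeff i ∈ pui)
    (h0 : ∀ i, 0 ≤ (P.coeff i).orderTop) :
    ∃ (m : ℕ+) (Q : (PowerSeries ℂ)[X]), Q.map (emb m) = P ∧ Q.natDegree = P.natDegree ∧
      Q.Monic := by
  obtain ⟨m, hm⟩ := exists_common_twist (Finset.range (P.natDegree + 1)) P.coeff fun i _ => h i
  refine ⟨m, lifts_and_natDegree_eq_and_monic ?_ hP⟩
  rw [lifts_iff_coeff_lifts]
  intro i
  by_cases hi : i ∈ Finset.range (P.natDegree + 1)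
  · exact exists_emb_eq m (hm i hi) (h0 i)
  · refine ⟨0, ?_⟩
    rw [map_zero, coeff_eq_zero_of_natDegree_lt]
    simpa using hi

theorem monic_taylor {R : Type*} [CommRing R] {P : R[X]} (hP : P.Monic) (s : R) :
    (taylor s P).Monic := by
  nontriviality R
  rw [taylor_apply]
  exact hP.comp (monic_X_add_C s) (by simp)

/-- Used twice in Newton's algorithm: to choose the shift that kills the subleading coefficient, and
to see that an `n`-fold root of a polynomial without that coefficient must be 0. -/
theorem taylor_coeff_natDegree_sub_one {R : Type*} [CommRing R] {P : R[X]} (hP : P.Monic)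
    (hn : 0 < P.natDegree) (s : R) :
    (taylor s P).coeff (P.natDegree - 1) = P.coeff (P.natDegree - 1) + P.natDegree * s := by
  obtain ⟨n, hn'⟩ : ∃ n, P.natDegree = n + 1 := ⟨P.natDegree - 1, by omega⟩
  rw [taylor_coeff, hn', Nat.add_sub_cancel]
  rw [eval_eq_sum_range' (n := 2)]
  · have h1 : P.coeff (n + 1) = 1 := by rw [← hn']; exact hP.coeff_natDegree
    simp [Finset.sum_range_succ, hasseDeriv_coeff, add_comm 1 n, h1]
  · refine lt_of_le_of_lt (natDegree_hasseDeriv_le _ _) ?_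
    omega

theorem order_emb_nonneg (m : ℕ+) (φ : PowerSeries ℂ) : 0 ≤ (emb m φ).order :=
  HahnSeries.zero_le_orderTop_iff.1 (orderTop_emb_nonneg m φ)

/-- Newton's algorithm: a monic polynomial over `ℂ⟦t⟧` has a Puiseux root. -/
theorem exists_puiseux_root (n : ℕ) : 0 < n → ∀ (m : ℕ+) (P : (PowerSeries ℂ)[X]), P.Monic →
    P.natDegree = n → ∃ α ∈ pui, 0 ≤ α.orderTop ∧ (P.map (emb m)).eval α = 0 := by
  induction n using Nat.strong_induction_on with
  | _ n ih =>
  intro hn m P hP hdeg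
  set s : PowerSeries ℂ := -(PowerSeries.C (n : ℂ)⁻¹ * P.coeff (n - 1)) with hs
  have hncast : ((n : ℕ) : PowerSeries ℂ) = PowerSeries.C (n : ℂ) := by simp
  have hP1 : (taylor s P).coeff (n - 1) = 0 := by
    have := taylor_coeff_natDegree_sub_one hP (by omega) s
    rw [hdeg] at this
    rw [this, hs, hncast, mul_neg, ← mul_assoc, ← map_mul,
      mul_inv_cancel₀ (by exact_mod_cast hn.ne'),
      map_one, one_mul, add_neg_cancel]
  set P₁ := taylor s P with hP₁
  have hP₁m : P₁.Monic := monic_taylor hP s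
  have hP₁d : P₁.natDegree = n := by rw [hP₁, natDegree_taylor, hdeg]
  suffices h : ∃ α ∈ pui, 0 ≤ α.orderTop ∧ (P₁.map (emb m)).eval α = 0 by
    obtain ⟨α, h1, h2, h3⟩ := h
    refine ⟨α + emb m s, add_mem h1 (emb_mem_pui _ _), ?_, ?_⟩
    · exact le_trans (le_min h2 (orderTop_emb_nonneg _ _))
        HahnSeries.min_orderTop_le_orderTop_add
    · rw [hP₁, taylor_apply, Polynomial.map_comp, eval_comp] at h3
      simpa using h3
  by_cases hex : ∃ i < n, P₁.coeff i ≠ 0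
  swap
  · push Not at hex
    refine ⟨0, zero_mem _, by simp, ?_⟩
    rw [← coeff_zero_eq_eval_zero, coeff_map, hex 0 hn, map_zero]
  classical
  set S := (Finset.range n).filter fun i => P₁.coeff i ≠ 0 with hS
  have hSne : S.Nonempty := by
    obtain ⟨i, h1, h2⟩ := hex
    exact ⟨i, by simp [hS, h1, h2]⟩
  -- The minimal slope `h` on the Newton polygon: the substitution `y = x^h z` leaves all
  -- coefficients of nonnegative order and makes that of index `i₀` a unit.
  obtain ⟨i₀, hi₀, hmin⟩ := S.exists_min_image
    (fun i => (emb m (P₁.coeff i)).order / ((n - i : ℕ) : ℚ)) hSne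
  set h : ℚ := (emb m (P₁.coeff i₀)).order / ((n - i₀ : ℕ) : ℚ) with hh
  have hh0 : 0 ≤ h := div_nonneg (order_emb_nonneg _ _) (by positivity)
  have hi₀' : i₀ < n ∧ P₁.coeff i₀ ≠ 0 := by simpa [hS] using hi₀
  set P₂ := scaleRoots (P₁.map (emb m)) (xpow (-h)) with hP₂
  have hmd : (P₁.map (emb m)).natDegree = n := by rw [hP₁m.natDegree_map, hP₁d]
  have hP₂m : P₂.Monic := (monic_scaleRoots_iff _).2 (hP₁m.map _)
  have hP₂d : P₂.natDegree = n := by rw [hP₂, natDegree_scaleRoots, hmd]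
  have hP₂c : ∀ i, P₂.coeff i = xpow (-((n - i : ℕ) * h)) * emb m (P₁.coeff i) := by
    intro i
    rw [hP₂, coeff_scaleRoots, coeff_map, hmd, xpow_pow, mul_comm]
    congr 2; ring
  have hord : ∀ i, 0 ≤ (P₂.coeff i).orderTop := by
    intro i
    by_cases hi : P₁.coeff i = 0
    · rw [hP₂c, hi]; simp
    rw [hP₂c, HahnSeries.orderTop_mul, orderTop_xpow]
    have hne : emb m (P₁.coeff i) ≠ 0 := by
      rwa [Ne, map_eq_zero_iff _ (emb_injective m)]
    rw [← HahnSeries.order_eq_orderTop_of_ne_zero hne]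
    norm_cast
    rcases lt_trichotomy i n with hin | hin | hin
    · have := hmin i (by simp [hS, hin, hi])
      rw [le_div_iff₀ (by exact_mod_cast (by omega : 0 < n - i))] at this
      rw [mul_comm] at this
      linarith
    · subst hin
      have := order_emb_nonneg m (P₁.coeff i)
      simpa using this
    · exact absurd (coeff_eq_zero_of_natDegree_lt (by omega)) hi
  have hmem : ∀ i, P₂.coeff i ∈ pui := fun i => by
    rw [hP₂c]; exact mul_mem (xpow_mem_pui _) (emb_mem_pui _ _)
  obtain ⟨m', Q, hQ, hQd, hQm⟩ := exists_map_emb_eq hP₂m hmem hord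
  rw [hP₂d] at hQd
  have hQc : ∀ i, PowerSeries.constantCoeff (Q.coeff i) = (P₂.coeff i).coeff 0 := by
    intro i
    rw [← hQ, coeff_map, coeff_zero_emb]
  have hQi₀ : PowerSeries.constantCoeff (Q.coeff i₀) ≠ 0 := by
    have hne : emb m (P₁.coeff i₀) ≠ 0 := by
      rw [Ne, map_eq_zero_iff _ (emb_injective m)]; exact hi₀'.2
    rw [hQc, hP₂c, coeff_xpow_mul, hh, mul_div_cancel₀ _ (by
      exact_mod_cast (by omega : n - i₀ ≠ 0)), zero_sub, neg_neg]
    exact HahnSeries.coeff_order_eq_zero.not.2 hne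
  have hQn : PowerSeries.constantCoeff (Q.coeff (n - 1)) = 0 := by
    rw [hQc, hP₂c, hP1, map_zero, mul_zero]; rfl
  suffices hsuff : ∃ β ∈ pui, 0 ≤ β.orderTop ∧ (Q.map (emb m')).eval β = 0 by
    obtain ⟨β, hβ1, hβ2, hβ3⟩ := hsuff
    rw [hQ] at hβ3
    refine ⟨xpow h * β, mul_mem (xpow_mem_pui _) hβ1, ?_, ?_⟩
    · rw [HahnSeries.orderTop_mul, orderTop_xpow]
      exact add_nonneg (by exact_mod_cast hh0) hβ2
    · have h1 := scaleRoots_eval₂_mul (p := P₁.map (emb m)) (RingHom.id HQ) (xpow h * β) (xpow (-h))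
      rw [RingHom.id_apply, ← mul_assoc, ← xpow_add, neg_add_cancel, xpow_zero, one_mul] at h1
      have h2 : eval₂ (RingHom.id HQ) β P₂ = 0 := hβ3
      rw [h2] at h1
      have h3 := (mul_eq_zero.1 h1.symm).resolve_left (pow_ne_zero _ (xpow_ne_zero _))
      exact h3
  set Qb := Q.map (PowerSeries.constantCoeff (R := ℂ)) with hQb
  have hQbm : Qb.Monic := hQm.map _
  have hQbd : Qb.natDegree = n := by rw [hQb, hQm.natDegree_map, hQd]
  obtain ⟨c, hc⟩ := IsAlgClosed.exists_root Qb (by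
    rw [degree_eq_natDegree hQbm.ne_zero, hQbd]; exact_mod_cast hn.ne')
  set T := taylor (PowerSeries.C c) Q with hT
  have hTm : T.Monic := monic_taylor hQm _
  have hTd : T.natDegree = n := by rw [hT, natDegree_taylor, hQd]
  have hTb : T.map (PowerSeries.constantCoeff (R := ℂ)) = taylor c Qb := by
    rw [hT, taylor_apply, taylor_apply, Polynomial.map_comp]
    simp [hQb]
  have hTc : ∀ i, PowerSeries.constantCoeff (T.coeff i) = (taylor c Qb).coeff i := by
    intro i; rw [← hTb, coeff_map]
  -- If the reduction were `(z - c)^n`, its zero subleading coefficient would give `c = 0`,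
  -- contradicting the nonzero coefficient of index `i₀ < n`. So Hensel's lemma yields a proper
  -- factor.
  obtain ⟨i, hi, hne⟩ : ∃ i < T.natDegree, PowerSeries.constantCoeff (T.coeff i) ≠ 0 := by
    by_contra hcon
    push Not at hcon
    rw [hTd] at hcon
    have h1 := taylor_coeff_natDegree_sub_one hQbm (by omega) c
    rw [hQbd, ← hTc, hcon _ (by omega), hQb, coeff_map, hQn, zero_add] at h1
    have hc0 : c = 0 := by
      rcases mul_eq_zero.1 h1.symm with h | h
      · exact absurd h (by exact_mod_cast hn.ne')
      · exact h
    have h2 := hcon i₀ hi₀'.1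
    rw [hTc, hc0, taylor_zero, hQb, coeff_map] at h2
    exact hQi₀ h2
  obtain ⟨F, hFm, hFd, hF0, hFn⟩ := exists_monic_factor
    (by rw [hTc, taylor_coeff_zero]; exact hc) hi hne
  obtain ⟨β, hβ1, hβ2, hβ3⟩ := ih F.natDegree (by omega) hF0 m' F hFm rfl
  refine ⟨β + emb m' (PowerSeries.C c), add_mem hβ1 (emb_mem_pui _ _),
    le_trans (le_min hβ2 (orderTop_emb_nonneg _ _)) HahnSeries.min_orderTop_le_orderTop_add, ?_⟩
  have h4 : (T.map (emb m')).eval β = 0 :=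
    eval_eq_zero_of_dvd_of_eval_eq_zero (Polynomial.map_dvd _ hFd) hβ3
  rw [hT, taylor_apply, Polynomial.map_comp, eval_comp] at h4
  simpa using h4

/-- Multiplying the roots by a high power of `x` gives the coefficients nonnegative order, which
reduces to `exists_puiseux_root`. -/
instance : IsAlgClosed pui := by
  refine IsAlgClosed.of_exists_root _ fun p hp hirr => ?_
  set P : HQ[X] := p.map pui.subtype with hP
  have hPm : P.Monic := hp.map _
  have hPd : P.natDegree = p.natDegree := hp.natDegree_map _
  have hn : 0 < p.natDegree := hirr.natDegree_pos
  obtain ⟨M, hM0, hM⟩ : ∃ M : ℚ, 0 ≤ M ∧ ∀ i ∈ Finset.range (P.natDegree + 1),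
      -M ≤ (P.coeff i).order := by
    refine ⟨∑ i ∈ Finset.range (P.natDegree + 1), |(P.coeff i).order|,
      Finset.sum_nonneg fun i _ => abs_nonneg _, fun i hi => ?_⟩
    have h1 := Finset.single_le_sum (f := fun i => |(P.coeff i).order|)
      (fun i _ => abs_nonneg _) hi
    have h2 := neg_abs_le (P.coeff i).order
    linarith
  have hmem : ∀ i, P.coeff i ∈ pui := fun i => by rw [hP, coeff_map]; exact (p.coeff i).2
  obtain ⟨m, Q, hQ, hQd, hQm⟩ := exists_map_emb_eq (P := scaleRoots P (xpow M))
    ((monic_scaleRoots_iff _).2 hPm)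
    (fun i => by
      rw [coeff_scaleRoots]
      exact mul_mem (hmem i) (pow_mem (xpow_mem_pui _) _))
    (fun i => by
      rw [coeff_scaleRoots, xpow_pow]
      by_cases hi : P.coeff i = 0
      · simp [hi]
      rw [HahnSeries.orderTop_mul, orderTop_xpow, ← HahnSeries.order_eq_orderTop_of_ne_zero hi]
      norm_cast
      have hle : i ≤ P.natDegree := le_natDegree_of_ne_zero hi
      rcases hle.lt_or_eq with hlt | heq
      · have h1 := hM i (by simp; omega)
        have h2 : (1 : ℚ) ≤ ((P.natDegree - i : ℕ) : ℚ) := by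
          exact_mod_cast (by omega : 1 ≤ P.natDegree - i)
        nlinarith
      · rw [heq, hPm.coeff_natDegree]
        simp)
  rw [natDegree_scaleRoots, hPd] at hQd
  obtain ⟨α, h1, -, h3⟩ := exists_puiseux_root _ hn m Q hQm hQd
  refine ⟨⟨xpow (-M) * α, mul_mem (xpow_mem_pui _) h1⟩, ?_⟩
  rw [hQ] at h3
  have h4 := scaleRoots_eval₂_mul (p := P) (RingHom.id HQ) (xpow (-M) * α) (xpow M)
  rw [RingHom.id_apply, ← mul_assoc, ← xpow_add, add_neg_cancel, xpow_zero, one_mul] at h4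
  have h2 : eval₂ (RingHom.id HQ) α (scaleRoots P (xpow M)) = 0 := h3
  rw [h2] at h4
  have h5 := (mul_eq_zero.1 h4.symm).resolve_left (pow_ne_zero _ (xpow_ne_zero _))
  apply Subtype.val_injective
  change pui.subtype _ = pui.subtype 0
  rw [map_zero, ← eval₂_at_apply, ← eval_map]
  exact h5

/-- A polynomial whose coefficients are Puiseux series splits over the Puiseux series. -/
theorem splits_of_coeff_mem_pui {P : HQ[X]} (h : ∀ i, P.coeff i ∈ pui) :
    P.Splits ∧ ∀ α ∈ P.roots, α ∈ pui := by
  obtain ⟨p, rfl⟩ : ∃ p : pui[X], p.map pui.subtype = P := by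
    have : P ∈ lifts pui.subtype := by
      rw [lifts_iff_coeff_lifts]
      exact fun i => ⟨⟨_, h i⟩, rfl⟩
    rwa [lifts_iff_set_range] at this
  have hp : p.Splits := IsAlgClosed.splits p
  refine ⟨hp.map _, fun α hα => ?_⟩
  rw [hp.roots_map] at hα
  obtain ⟨β, -, rfl⟩ := Multiset.mem_map.1 hα
  exact β.2

end

end PlaneBranch

/-! ### From series in two variables to polynomials over the Hahn series. -/

namespace PlaneBranch

noncomputable section

open Polynomial

/-- The inclusion of `ℂ{x}` in the field of Hahn series. -/
def toH : Cx →+* HQ := (emb 1).comp Cx.incl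

theorem toH_apply (a : Cx) : toH a = emb 1 (Cx.incl a) := rfl

theorem toH_injective : Function.Injective toH :=
  (emb_injective 1).comp Cx.incl_injective

theorem toH_mem_pui (a : Cx) : toH a ∈ pui := emb_mem_pui _ _

theorem twist_toH (j : ℤ) (a : Cx) : twist j (toH a) = toH a := twist_emb_one j _

theorem twist_comp_toH (j : ℤ) : (twist j).comp toH = toH := RingHom.ext (twist_toH j)

theorem hasSubst_pair (m : ℕ+) {φ : PowerSeries ℂ} (h : PowerSeries.constantCoeff φ = 0) :
    MvPowerSeries.HasSubst ![(PowerSeries.X : PowerSeries ℂ) ^ (m : ℕ), φ] := by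
  refine MvPowerSeries.hasSubst_of_constantCoeff_zero fun i => ?_
  fin_cases i
  · change PowerSeries.constantCoeff ((PowerSeries.X : PowerSeries ℂ) ^ (m : ℕ)) = 0
    rw [map_pow, PowerSeries.constantCoeff_X, zero_pow m.ne_zero]
  · exact h

theorem subst_rename (m : ℕ+) {φ : PowerSeries ℂ} (h : PowerSeries.constantCoeff φ = 0)
    (a : PowerSeries ℂ) :
    MvPowerSeries.subst ![(PowerSeries.X : PowerSeries ℂ) ^ (m : ℕ), φ]
      (MvPowerSeries.rename (R := ℂ) (fun _ : Unit => (0 : Fin 2)) a) =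
      PowerSeries.expand m m.ne_zero a := by
  rw [MvPowerSeries.rename_eq_subst, MvPowerSeries.subst_comp_subst_apply
    (MvPowerSeries.HasSubst.X_comp _) (hasSubst_pair m h), PowerSeries.expand_apply,
    PowerSeries.subst]
  congr 1
  funext i
  rw [Function.comp_apply, MvPowerSeries.subst_X (hasSubst_pair m h)]
  rfl

/-- Both sides are ring homomorphisms in `P`, so it suffices to compare them on coefficients and on
`y`. -/
theorem emb_subst_toSeries (m : ℕ+) {φ : PowerSeries ℂ} (h : PowerSeries.constantCoeff φ = 0)
    (P : Cx[X]) :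
    emb m (MvPowerSeries.subst ![(PowerSeries.X : PowerSeries ℂ) ^ (m : ℕ), φ] (toSeries P)) =
      (P.map toH).eval (emb m φ) := by
  have key : ((emb m).comp (MvPowerSeries.substAlgHom (R := ℂ) (hasSubst_pair m h) :
      MvPowerSeries (Fin 2) ℂ →+* PowerSeries ℂ)).comp toSeries =
      (evalRingHom (emb m φ)).comp (mapRingHom toH) := by
    refine Polynomial.ringHom_ext (fun a => ?_) ?_
    · simp only [RingHom.comp_apply, toSeries, coe_eval₂RingHom, eval₂_C, coe_mapRingHom, map_C,
        coe_evalRingHom, eval_C, RingHom.coe_coe]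
      rw [MvPowerSeries.coe_substAlgHom]
      refine (congrArg (emb m) (subst_rename m h (Cx.incl a))).trans ?_
      exact emb_expand 1 m m (by simp) _
    · simp only [RingHom.comp_apply, toSeries, coe_eval₂RingHom, eval₂_X, coe_mapRingHom, map_X,
        coe_evalRingHom, eval_X, RingHom.coe_coe]
      rw [MvPowerSeries.coe_substAlgHom, MvPowerSeries.subst_X (hasSubst_pair m h)]
      rfl
  have := congrArg (fun F => F P) key
  simp only [RingHom.comp_apply, coe_mapRingHom, coe_evalRingHom, RingHom.coe_coe] at this
  rw [MvPowerSeries.coe_substAlgHom] at this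
  exact this

/-- The substitution `x ↦ x^k` on `ℂ{x}`. -/
def Cx.expand (k : ℕ+) : Cx →+* Cx where
  toFun a := Cx.mk (PowerSeries.expand k k.ne_zero (Cx.incl a))
    ((isConvergent_expand_iff k.ne_zero).2 (Cx.isConvergent_incl a))
  map_zero' := Cx.incl_injective (by simp)
  map_one' := Cx.incl_injective (by simp)
  map_add' a b := Cx.incl_injective (by simp)
  map_mul' a b := Cx.incl_injective (by simp)

theorem emb_incl_expand (m : ℕ+) (a : Cx) : emb m (Cx.incl (Cx.expand m a)) = toH a :=
  emb_expand 1 m m (by simp) _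

theorem emb_eval₂_expand (m : ℕ+) (P : Cx[X]) (φ : PowerSeries ℂ) :
    emb m ((P.map (Cx.expand m)).eval₂ Cx.incl φ) = (P.map toH).eval (emb m φ) := by
  rw [hom_eval₂, eval₂_map, eval_map]
  congr 1
  exact RingHom.ext (emb_incl_expand m)

theorem coeff_map_toH_mem_pui (P : Cx[X]) (i : ℕ) : (P.map toH).coeff i ∈ pui := by
  rw [coeff_map]; exact toH_mem_pui _

/-- A root of nonnegative order of a polynomial over `ℂ{x}` is a convergent fractional series. -/
theorem exists_convergent_of_root {P : Cx[X]} (hP : P ≠ 0) {α : HQ}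
    (h : (P.map toH).eval α = 0) (h0 : 0 ≤ α.orderTop) (m : ℕ+) (hm : twist (m : ℕ) α = α) :
    ∃ φ : PowerSeries ℂ, IsConvergent φ ∧ emb m φ = α := by
  obtain ⟨φ, rfl⟩ := exists_emb_eq m hm h0
  refine ⟨φ, isConvergent_of_root (P := P.map (Cx.expand m)) ?_ ?_, rfl⟩
  · rwa [Polynomial.map_ne_zero_iff]
    intro a b hab
    apply toH_injective
    rw [← emb_incl_expand m, hab, emb_incl_expand]
  · apply emb_injective m
    rw [emb_eval₂_expand, h, map_zero]

theorem map_toH_ne_zero {P : Cx[X]} (hP : P ≠ 0) : P.map toH ≠ 0 :=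
  (Polynomial.map_ne_zero_iff toH_injective).2 hP

/-- The convergence demanded by `Zer` is automatic, since a root is algebraic over `ℂ{x}`. From here
on Newton-Puiseux roots are ordinary roots in `HQ`. -/
theorem mem_zer_toSeries_iff {P : Cx[X]} (hP : P ≠ 0) {α : HQ} :
    α ∈ Zer (toSeries P) ↔ (P.map toH).eval α = 0 ∧ 0 < α.orderTop := by
  constructor
  · rintro ⟨m, φ, -, h0, rfl, h⟩
    rw [← emb_apply]
    refine ⟨?_, (orderTop_emb_pos_iff m φ).2 h0⟩
    rw [← emb_subst_toSeries m h0, h, map_zero]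
  · rintro ⟨h, h0⟩
    obtain ⟨m, hm⟩ := mem_pui.1 ((splits_of_coeff_mem_pui (coeff_map_toH_mem_pui P)).2 α
      ((mem_roots (map_toH_ne_zero hP)).2 h))
    obtain ⟨φ, hφ, rfl⟩ := exists_convergent_of_root hP h h0.le m hm
    rw [orderTop_emb_pos_iff] at h0
    refine ⟨m, φ, hφ, h0, rfl, emb_injective m ?_⟩
    rw [emb_subst_toSeries m h0, h, map_zero]

/-- The series `a(x)`, as a series in `x, y`. -/
def inX : PowerSeries ℂ →ₐ[ℂ] MvPowerSeries (Fin 2) ℂ :=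
  MvPowerSeries.rename (R := ℂ) (fun _ : Unit => (0 : Fin 2))

theorem coeff_inX (a : PowerSeries ℂ) (e : Fin 2 →₀ ℕ) :
    MvPowerSeries.coeff e (inX a) = if e 1 = 0 then PowerSeries.coeff (e 0) a else 0 := by
  split_ifs with h
  · have := MvPowerSeries.coeff_embDomain_rename (R := ℂ)
      (⟨fun _ => 0, fun _ _ _ => rfl⟩ : Unit ↪ Fin 2) a (Finsupp.single () (e 0))
    rw [Finsupp.embDomain_single] at this
    have he : Finsupp.single (0 : Fin 2) (e 0) = e := by
      ext i; fin_cases i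
      · simp
      · simp [h]
    have h2 : MvPowerSeries.coeff e (inX a) = PowerSeries.coeff (e 0) a := by
      conv_lhs => rw [← he]
      exact this
    exact h2
  · refine MvPowerSeries.coeff_rename_eq_zero _ _ ?_
    rintro ⟨d, rfl⟩
    apply h
    rw [Finsupp.mapDomain_of_notMem_range]
    simp

theorem toSeries_C (a : Cx) : toSeries (C a) = inX (Cx.incl a) := by
  simp only [toSeries, coe_eval₂RingHom, eval₂_C]; rfl

theorem toSeries_X : toSeries X = MvPowerSeries.X 1 := by
  simp only [toSeries, coe_eval₂RingHom, eval₂_X]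

theorem isConvergent_inX {a : PowerSeries ℂ} (h : IsConvergent a) : IsConvergent (inX a) := by
  rw [isConvergent_iff_summable] at h
  obtain ⟨r, hr, h⟩ := h
  refine ⟨r, hr, ?_⟩
  have hinj : Function.Injective fun n : ℕ => Finsupp.single (0 : Fin 2) n :=
    Finsupp.single_injective 0
  rw [← hinj.summable_iff]
  · refine h.congr fun n => ?_
    simp [coeff_inX, Finsupp.degree_single]
  · intro e he
    rw [coeff_inX, if_neg, norm_zero, zero_mul]
    intro h1
    refine he ⟨e 0, ?_⟩
    ext i; fin_cases i
    · simp
    · simp [h1]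

theorem isConvergent_toSeries (P : Cx[X]) : toSeries P ∈ convergentSeries (Fin 2) := by
  induction P using Polynomial.induction_on' with
  | add p q hp hq => rw [map_add]; exact add_mem hp hq
  | monomial n a =>
    rw [← C_mul_X_pow_eq_monomial, map_mul, map_pow, toSeries_C, toSeries_X]
    exact mul_mem (isConvergent_inX (Cx.isConvergent_incl a))
      (pow_mem (IsConvergent.monomial _ 1) n)

/-- The element of `ℂ{x,y}` defined by a polynomial in `ℂ{x}[y]`. -/
def toCxy : Cx[X] →+* Cxy :=
  (toSeries.codRestrict (convergentSeries (Fin 2)) isConvergent_toSeries :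
    Cx[X] →+* convergentSeries (Fin 2))

theorem incl_toCxy (P : Cx[X]) : Cxy.incl (toCxy P) = toSeries P := rfl

theorem Cxy.incl_injective : Function.Injective Cxy.incl := Subtype.val_injective

/-- An additive map, applied to the coefficients of a polynomial. -/
def mapCoeffs {A : Type*} [CommRing A] (D : A →+ A) : A[X] →+ A[X] where
  toFun P := P.sum fun n a => monomial n (D a)
  map_zero' := by simp
  map_add' P Q := sum_add_index _ _ _ (by simp) (by simp)

theorem mapCoeffs_monomial {A : Type*} [CommRing A] (D : A →+ A) (n : ℕ) (a : A) :
    mapCoeffs D (monomial n a) = monomial n (D a) :=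
  sum_monomial_index (n := n) a (fun n a => monomial n (D a)) (by simp)

theorem coeff_mapCoeffs {A : Type*} [CommRing A] (D : A →+ A) (P : A[X]) (n : ℕ) :
    (mapCoeffs D P).coeff n = D (P.coeff n) := by
  induction P using Polynomial.induction_on' with
  | add p q hp hq => rw [map_add, coeff_add, hp, hq, coeff_add, map_add]
  | monomial m a =>
    rw [mapCoeffs_monomial, coeff_monomial, coeff_monomial]
    split_ifs <;> simp

theorem mapCoeffs_mul {A : Type*} [CommRing A] {D : A →+ A}
    (hD : ∀ a b, D (a * b) = D a * b + a * D b) (P Q : A[X]) :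
    mapCoeffs D (P * Q) = mapCoeffs D P * Q + P * mapCoeffs D Q := by
  ext n
  rw [coeff_mapCoeffs, coeff_add, coeff_mul, coeff_mul, coeff_mul, map_sum,
    ← Finset.sum_add_distrib]
  exact Finset.sum_congr rfl fun p _ => by rw [hD, coeff_mapCoeffs, coeff_mapCoeffs]

/-- The derivation `d/dx` of `ℂ{x}`. -/
def Cx.deriv : Cx →+ Cx where
  toFun a := Cx.mk (PowerSeries.derivative ℂ (Cx.incl a)) (Cx.isConvergent_incl a).derivative
  map_zero' := Cx.incl_injective (by simp)
  map_add' a b := Cx.incl_injective (by simp)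

theorem Cx.incl_deriv (a : Cx) :
    Cx.incl (Cx.deriv a) = PowerSeries.derivative ℂ (Cx.incl a) := rfl

theorem xpow_one_mul_toH_deriv (a : Cx) : xpow 1 * toH (Cx.deriv a) = euler (toH a) := by
  ext q
  rw [coeff_xpow_mul, coeff_euler, toH_apply, toH_apply, Cx.incl_deriv]
  by_cases hq : ∃ n : ℕ, (n : ℚ) / ((1 : ℕ+) : ℕ) = q
  · obtain ⟨n, rfl⟩ := hq
    rw [coeff_emb_div]
    rcases n with _ | n
    · rw [coeff_emb_of_ne]
      · simp
      · intro k hk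
        have h1 : (0 : ℚ) ≤ k := by positivity
        simp only [PNat.one_coe, Nat.cast_one, div_one, Nat.cast_zero, zero_sub] at hk
        linarith
    · have : ((n + 1 : ℕ) : ℚ) / ((1 : ℕ+) : ℕ) - 1 = (n : ℚ) / ((1 : ℕ+) : ℕ) := by simp
      rw [this, coeff_emb_div, PowerSeries.coeff_derivative]
      push_cast
      simp
      ring
  · push Not at hq
    rw [coeff_emb_of_ne _ _ _ hq, mul_zero, coeff_emb_of_ne]
    intro k hk
    apply hq (k + 1)
    simp only [PNat.one_coe, Nat.cast_one, div_one] at hk ⊢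
    push_cast
    linarith

theorem pderiv_zero_inX (a : PowerSeries ℂ) :
    MvPowerSeries.pderiv ℂ 0 (inX a) = inX (PowerSeries.derivative ℂ a) := by
  ext e
  rw [MvPowerSeries.coeff_pderiv, coeff_inX, coeff_inX, PowerSeries.coeff_derivative]
  simp

theorem pderiv_one_inX (a : PowerSeries ℂ) : MvPowerSeries.pderiv ℂ 1 (inX a) = 0 := by
  ext e
  rw [MvPowerSeries.coeff_pderiv, coeff_inX]
  simp

theorem pderiv_one_toSeries (P : Cx[X]) :
    MvPowerSeries.pderiv ℂ 1 (toSeries P) = toSeries (derivative P) := by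
  induction P using Polynomial.induction_on' with
  | add p q hp hq => rw [map_add, map_add, hp, hq, derivative_add, map_add]
  | monomial n a =>
    rw [← C_mul_X_pow_eq_monomial, map_mul, map_pow, toSeries_C, toSeries_X, Derivation.leibniz,
      MvPowerSeries.pderiv_pow, pderiv_one_inX, MvPowerSeries.pderiv_X_self, derivative_C_mul_X_pow,
      map_mul, map_pow, toSeries_X, toSeries_C, map_mul, map_mul, map_natCast, map_natCast]
    simp only [smul_eq_mul]
    ring

theorem pderiv_zero_toSeries (P : Cx[X]) :
    MvPowerSeries.pderiv ℂ 0 (toSeries P) = toSeries (mapCoeffs Cx.deriv P) := by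
  induction P using Polynomial.induction_on' with
  | add p q hp hq => simp only [map_add, hp, hq]
  | monomial n a =>
    rw [mapCoeffs_monomial, ← C_mul_X_pow_eq_monomial, ← C_mul_X_pow_eq_monomial,
      map_mul toSeries, map_mul toSeries, map_pow, toSeries_C, toSeries_X, toSeries_C,
      Cx.incl_deriv, Derivation.leibniz,
      MvPowerSeries.pderiv_pow, pderiv_zero_inX, MvPowerSeries.pderiv_X_of_ne (by decide)]
    simp only [smul_eq_mul]
    ring

/-- The jacobian of two polynomials in `ℂ{x}[y]`. -/
def jacPoly (P Q : Cx[X]) : Cx[X] :=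
  mapCoeffs Cx.deriv P * derivative Q - derivative P * mapCoeffs Cx.deriv Q

theorem jac_toSeries (P Q : Cx[X]) : jac (toSeries P) (toSeries Q) = toSeries (jacPoly P Q) := by
  rw [jac, jacPoly, map_sub, map_mul, map_mul, pderiv_one_toSeries, pderiv_one_toSeries,
    pderiv_zero_toSeries, pderiv_zero_toSeries]

theorem C_xpow_mul_map_deriv (P : Cx[X]) :
    C (xpow 1) * (mapCoeffs Cx.deriv P).map toH = mapCoeffs euler (P.map toH) := by
  ext1 n
  rw [coeff_C_mul, coeff_map, coeff_mapCoeffs, coeff_mapCoeffs, coeff_map, xpow_one_mul_toH_deriv]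

/-- Multiplication by `x` trades `d/dx` for the Euler derivation, which preserves weights. -/
theorem C_xpow_mul_map_jacPoly (P Q : Cx[X]) :
    C (xpow 1) * (jacPoly P Q).map toH = mapCoeffs euler (P.map toH) * derivative (Q.map toH) -
      derivative (P.map toH) * mapCoeffs euler (Q.map toH) := by
  rw [← C_xpow_mul_map_deriv, ← C_xpow_mul_map_deriv, jacPoly]
  simp only [Polynomial.map_sub, Polynomial.map_mul, derivative_map]
  ring

end

end PlaneBranch

/-! ### Coprimality to `x` and intersection multiplicity with `x`. -/

namespace PlaneBranch

noncomputable section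

open Polynomial

theorem coeff_toSeries (P : Cx[X]) (e : Fin 2 →₀ ℕ) :
    MvPowerSeries.coeff e (toSeries P) = PowerSeries.coeff (e 0) (Cx.incl (P.coeff (e 1))) := by
  classical
  induction P using Polynomial.induction_on' with
  | add p q hp hq => simp only [map_add, hp, hq, coeff_add]
  | monomial n a =>
    rw [← C_mul_X_pow_eq_monomial, map_mul toSeries, map_pow, toSeries_C, toSeries_X,
      coeff_C_mul_X_pow, MvPowerSeries.X_pow_eq, MvPowerSeries.coeff_mul_monomial, coeff_inX]
    have hle : Finsupp.single (1 : Fin 2) n ≤ e ↔ n ≤ e 1 := Finsupp.single_le_iff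
    simp only [hle, Finsupp.tsub_apply, Finsupp.single_eq_same, mul_one]
    by_cases h : e 1 = n
    · simp [h]
    · by_cases h2 : n ≤ e 1
      · rw [if_pos h2, if_neg (by omega), if_neg h]
        simp
      · rw [if_neg h2, if_neg h]
        simp

/-- The series obtained by shifting the exponents by `s`. -/
def shift (s : Fin 2 →₀ ℕ) (g : MvPowerSeries (Fin 2) ℂ) : MvPowerSeries (Fin 2) ℂ :=
  fun e => MvPowerSeries.coeff (e + s) g

theorem coeff_shift (s : Fin 2 →₀ ℕ) (g : MvPowerSeries (Fin 2) ℂ) (e : Fin 2 →₀ ℕ) :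
    MvPowerSeries.coeff e (shift s g) = MvPowerSeries.coeff (e + s) g := rfl

theorem IsConvergent.shift (s : Fin 2 →₀ ℕ) {g : MvPowerSeries (Fin 2) ℂ} (h : IsConvergent g) :
    IsConvergent (shift s g) := by
  obtain ⟨r, hr, h⟩ := h
  refine ⟨r, hr, ?_⟩
  have h1 := (h.comp_injective (add_left_injective s)).mul_right (r ^ s.degree)⁻¹
  refine h1.congr fun e => ?_
  rw [coeff_shift, Function.comp_apply, map_add, pow_add]
  field_simp

theorem IsConvergent.of_coeff_eq_zero_or_eq {g g' : MvPowerSeries (Fin 2) ℂ} (h : IsConvergent g)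
    (h' : ∀ e, MvPowerSeries.coeff e g' = 0 ∨
      MvPowerSeries.coeff e g' = MvPowerSeries.coeff e g) : IsConvergent g' := by
  obtain ⟨r, hr, h⟩ := h
  refine ⟨r, hr, h.of_nonneg_of_le (fun e => by positivity) fun e => ?_⟩
  rcases h' e with h0 | h0
  · rw [h0, norm_zero, zero_mul]; positivity
  · rw [h0]

/-- A convergent series, as an element of `ℂ{x,y}`. -/
def Cxy.mk (g : MvPowerSeries (Fin 2) ℂ) (h : IsConvergent g) : Cxy :=
  (⟨g, h⟩ : convergentSeries (Fin 2))

theorem Cxy.incl_mk (g : MvPowerSeries (Fin 2) ℂ) (h : IsConvergent g) :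
    Cxy.incl (Cxy.mk g h) = g := rfl

theorem Cxy.isConvergent_incl (g : Cxy) : IsConvergent (Cxy.incl g) := g.2

theorem incl_xVar : Cxy.incl xVar = MvPowerSeries.X 0 := rfl

theorem coeff_single_one_X_mul (h : MvPowerSeries (Fin 2) ℂ) (j : ℕ) :
    MvPowerSeries.coeff (Finsupp.single (1 : Fin 2) j) (MvPowerSeries.X 0 * h) = 0 := by
  classical
  rw [MvPowerSeries.X, MvPowerSeries.coeff_monomial_mul, if_neg]
  rw [Finsupp.single_le_iff]
  simp

theorem coeff_add_X_mul (h : MvPowerSeries (Fin 2) ℂ) (e : Fin 2 →₀ ℕ) :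
    MvPowerSeries.coeff (e + Finsupp.single (0 : Fin 2) 1) (MvPowerSeries.X 0 * h) =
      MvPowerSeries.coeff e h := by
  rw [MvPowerSeries.X, add_comm, MvPowerSeries.coeff_add_monomial_mul, one_mul]

/-- A monic polynomial in `ℂ{x}[y]` is coprime to `x` in `ℂ{x,y}`. -/
theorem isRelPrime_xVar_toCxy {Q : Cx[X]} (hQ : Q.Monic) : IsRelPrime xVar (toCxy Q) := by
  intro d hx hQd
  obtain ⟨e, he⟩ := hx
  obtain ⟨q, hq⟩ := hQd
  have he' : (MvPowerSeries.X 0 : MvPowerSeries (Fin 2) ℂ) = Cxy.incl d * Cxy.incl e := by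
    rw [← incl_xVar, he, map_mul]
  have hq' : toSeries Q = Cxy.incl d * Cxy.incl q := by
    rw [← incl_toCxy, hq, map_mul]
  by_cases hd : MvPowerSeries.constantCoeff (Cxy.incl d) = 0
  · exfalso
    -- The `x`-derivative of `x = d e` at the origin is 1, so `d` and `e` cannot both vanish there;
    -- then `x` divides `Q` up to a formal unit, against the monomial `y^deg Q`.
    have he0 : MvPowerSeries.constantCoeff (Cxy.incl e) ≠ 0 := by
      intro he0
      have h1 := congrArg (MvPowerSeries.pderiv ℂ 0) he'
      rw [MvPowerSeries.pderiv_X_self, Derivation.leibniz] at h1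
      have h2 := congrArg MvPowerSeries.constantCoeff h1
      simp [hd, he0] at h2
    have h1 : toSeries Q = MvPowerSeries.X 0 * ((Cxy.incl e)⁻¹ * Cxy.incl q) := by
      rw [hq', he']
      linear_combination (-(Cxy.incl d * Cxy.incl q)) * MvPowerSeries.mul_inv_cancel _ he0
    have h2 := congrArg (MvPowerSeries.coeff (Finsupp.single (1 : Fin 2) Q.natDegree)) h1
    rw [coeff_single_one_X_mul, coeff_toSeries, Finsupp.single_eq_same, hQ.coeff_natDegree] at h2
    simp at h2
  · have hc : IsConvergent (Cxy.incl d)⁻¹ := by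
      -- From `x = d e` the inverse of `d` is `e / x`, which gives its convergence.
      have h1 : (Cxy.incl d)⁻¹ = shift (Finsupp.single 0 1) (Cxy.incl e) := by
        ext a
        rw [coeff_shift, ← coeff_add_X_mul, he']
        congr 1
        linear_combination (Cxy.incl e) * MvPowerSeries.mul_inv_cancel _ hd
      rw [h1]
      exact (Cxy.isConvergent_incl e).shift _
    refine IsUnit.of_mul_eq_one (Cxy.mk _ hc) (Cxy.incl_injective ?_)
    rw [map_mul, Cxy.incl_mk, MvPowerSeries.mul_inv_cancel _ hd, map_one]

/-- The element `x` of `ℂ{x}`. -/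
def Cx.x : Cx := Cx.mk PowerSeries.X (by simpa using isConvergent_X_pow 1)

theorem Cx.incl_x : Cx.incl Cx.x = PowerSeries.X := rfl

theorem toCxy_C_x : toCxy (C Cx.x) = xVar := by
  apply Cxy.incl_injective
  rw [incl_toCxy, toSeries_C, incl_xVar, Cx.incl_x]
  exact MvPowerSeries.rename_X (R := ℂ) (fun _ : Unit => (0 : Fin 2)) ()

theorem exists_x_mul_eq {a : Cx} (h : PowerSeries.constantCoeff (Cx.incl a) = 0) :
    ∃ c : Cx, a = Cx.x * c := by
  obtain ⟨c, hc⟩ := PowerSeries.X_dvd_iff.2 h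
  refine ⟨Cx.mk c (IsConvergent.of_X_pow_mul (k := 1) ?_), Cx.incl_injective ?_⟩
  · rw [pow_one, ← hc]; exact Cx.isConvergent_incl a
  · rw [map_mul, Cx.incl_x, Cx.incl_mk]; exact hc

/-- A Weierstrass polynomial of degree `d` is congruent to `y^d` modulo `x`. -/
theorem IsWeierstrass.exists_eq {Q : Cx[X]} (hQ : IsWeierstrass Q) :
    ∃ R : Cx[X], toCxy Q = toCxy X ^ Q.natDegree + xVar * toCxy R := by
  have hex : ∀ i, ∃ c : Cx, i < Q.natDegree → Q.coeff i = Cx.x * c := fun i => by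
    by_cases hi : i < Q.natDegree
    · obtain ⟨c, hc⟩ := exists_x_mul_eq (hQ.2 i hi)
      exact ⟨c, fun _ => hc⟩
    · exact ⟨0, fun h => absurd h hi⟩
  choose c hc using hex
  refine ⟨∑ i ∈ Finset.range Q.natDegree, C (c i) * X ^ i, ?_⟩
  rw [← toCxy_C_x, ← map_pow, ← map_mul, ← map_add]
  refine congrArg toCxy (hQ.1.as_sum.trans ?_)
  rw [Finset.mul_sum, add_right_inj]
  refine Finset.sum_congr rfl fun i hi => ?_
  rw [← mul_assoc, ← C_mul, ← hc i (Finset.mem_range.1 hi)]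

/-- The first `d` coefficients of `g(0, y)`. -/
def lowCoeffs (d : ℕ) : Cxy →ₗ[ℂ] (Fin d → ℂ) :=
  LinearMap.pi fun j => (MvPowerSeries.coeff (Finsupp.single (1 : Fin 2) (j : ℕ))).comp
    Cxy.incl.toLinearMap

theorem lowCoeffs_apply (d : ℕ) (g : Cxy) (j : Fin d) :
    lowCoeffs d g j = MvPowerSeries.coeff (Finsupp.single (1 : Fin 2) (j : ℕ)) (Cxy.incl g) := rfl

theorem lowCoeffs_surjective (d : ℕ) : Function.Surjective (lowCoeffs d) := by
  intro v
  refine ⟨toCxy (∑ i : Fin d, C (algebraMap ℂ Cx (v i)) * X ^ (i : ℕ)), ?_⟩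
  ext j
  rw [lowCoeffs_apply, incl_toCxy, coeff_toSeries, Finsupp.single_eq_same, finsetSum_coeff,
    Finset.sum_eq_single j]
  · simp [Cx.incl_algebraMap]
  · intro i _ hi
    rw [coeff_C_mul_X_pow, if_neg]
    intro h
    exact hi (Fin.ext h.symm)
  · simp

/-- Modulo `x` the polynomial `Q` is `y^d`. Membership in the ideal is explicit: `g = x g₁ + y^d
g₂`, where `g₁` collects the terms divisible by `x` and `g₂ = g(0,y) / y^d`. -/
theorem ker_lowCoeffs {Q : Cx[X]} (hQ : IsWeierstrass Q) :
    LinearMap.ker (lowCoeffs Q.natDegree) =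
      (Ideal.span {toCxy Q, xVar}).restrictScalars ℂ := by
  classical
  ext g
  rw [LinearMap.mem_ker, Submodule.restrictScalars_mem, Ideal.mem_span_pair]
  constructor
  · intro h
    obtain ⟨R, hR⟩ := hQ.exists_eq
    have h0 : ∀ j < Q.natDegree,
        MvPowerSeries.coeff (Finsupp.single (1 : Fin 2) j) (Cxy.incl g) = 0 := fun j hj => by
      have := congrFun h ⟨j, hj⟩
      exact this
    set g₁ := shift (Finsupp.single 0 1) (Cxy.incl g) with hg₁
    set g₂ : MvPowerSeries (Fin 2) ℂ := fun e =>
      if e 0 = 0 then MvPowerSeries.coeff e (shift (Finsupp.single 1 Q.natDegree) (Cxy.incl g))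
      else 0 with hg₂
    have hc₁ : IsConvergent g₁ := (Cxy.isConvergent_incl g).shift _
    have hc₂ : IsConvergent g₂ := by
      refine ((Cxy.isConvergent_incl g).shift (Finsupp.single 1 Q.natDegree)).of_coeff_eq_zero_or_eq
        fun e => ?_
      have : MvPowerSeries.coeff e g₂ = if e 0 = 0 then
        MvPowerSeries.coeff e (shift (Finsupp.single 1 Q.natDegree) (Cxy.incl g)) else 0 := rfl
      rw [this]
      split_ifs
      · exact Or.inr rfl
      · exact Or.inl rfl
    refine ⟨Cxy.mk g₂ hc₂, Cxy.mk g₁ hc₁ - Cxy.mk g₂ hc₂ * toCxy R, ?_⟩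
    rw [hR]
    have : g = Cxy.mk g₂ hc₂ * toCxy X ^ Q.natDegree + Cxy.mk g₁ hc₁ * xVar := by
      apply Cxy.incl_injective
      rw [map_add, map_mul, map_mul, map_pow, incl_toCxy, toSeries_X, incl_xVar, Cxy.incl_mk,
        Cxy.incl_mk]
      ext e
      rw [map_add, MvPowerSeries.X_pow_eq, MvPowerSeries.X, MvPowerSeries.coeff_mul_monomial,
        MvPowerSeries.coeff_mul_monomial]
      have hle1 : Finsupp.single (1 : Fin 2) Q.natDegree ≤ e ↔ Q.natDegree ≤ e 1 :=
        Finsupp.single_le_iff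
      have hle0 : Finsupp.single (0 : Fin 2) 1 ≤ e ↔ 1 ≤ e 0 := Finsupp.single_le_iff
      have hc : ∀ e, MvPowerSeries.coeff e g₂ = if e 0 = 0 then
        MvPowerSeries.coeff e (shift (Finsupp.single 1 Q.natDegree) (Cxy.incl g)) else 0 :=
        fun _ => rfl
      simp only [mul_one, hc, hg₁, coeff_shift]
      by_cases he : e 0 = 0
      · rw [if_neg (c := Finsupp.single (0 : Fin 2) 1 ≤ e) (by rw [hle0]; omega), add_zero]
        by_cases he1 : Q.natDegree ≤ e 1
        · rw [if_pos (hle1.2 he1), if_pos (by simp [he]), tsub_add_cancel_of_le (hle1.2 he1)]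
        · rw [if_neg (by rwa [hle1])]
          have : e = Finsupp.single 1 (e 1) := by
            ext i; fin_cases i
            · simp [he]
            · simp
          rw [this]
          exact h0 _ (by omega)
      · have h1 : Finsupp.single (0 : Fin 2) 1 ≤ e := hle0.2 (by omega)
        rw [if_pos h1, tsub_add_cancel_of_le h1]
        simp [he]
    rw [this]
    ring
  · rintro ⟨a, b, rfl⟩
    ext j
    rw [lowCoeffs_apply, map_add, map_mul, map_mul, map_add, incl_xVar, mul_comm (Cxy.incl b),
      coeff_single_one_X_mul, add_zero, incl_toCxy, MvPowerSeries.coeff_mul, Pi.zero_apply]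
    refine Finset.sum_eq_zero fun p hp => ?_
    rw [Finset.HasAntidiagonal.mem_antidiagonal] at hp
    have h1 := DFunLike.congr_fun hp 1
    have h0 := DFunLike.congr_fun hp 0
    simp only [Finsupp.add_apply, Finsupp.single_eq_same] at h1
    simp at h0
    rw [coeff_toSeries, h0.2, PowerSeries.coeff_zero_eq_constantCoeff,
      hQ.2 _ (by have := j.2; omega), mul_zero]

/-- The intersection multiplicity with `x` of a Weierstrass polynomial is its degree. -/
theorem interMult_toCxy_xVar {Q : Cx[X]} (hQ : IsWeierstrass Q) :
    interMult (toCxy Q) xVar = (Q.natDegree : ℕ∞) := by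
  have e : (Cxy ⧸ Ideal.span {toCxy Q, xVar}) ≃ₗ[ℂ] (Fin Q.natDegree → ℂ) :=
    (Submodule.Quotient.restrictScalarsEquiv ℂ _).symm.trans
      ((Submodule.quotEquivOfEq _ _ (ker_lowCoeffs hQ).symm).trans
        ((lowCoeffs Q.natDegree).quotKerEquivOfSurjective (lowCoeffs_surjective _)))
  rw [interMult, e.rank_eq]
  simp

end

end PlaneBranch

/-! ### Initial forms on balls and the initial form of the jacobian. -/

namespace PlaneBranch

noncomputable section

open Polynomial

/-- All coefficients of `P` have order at least `A`, and their coefficients at `x^A` are those of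
`F`: if `F ≠ 0` then `x^A F` is the initial form of `P`. -/
def HasInit (P : HQ[X]) (A : ℚ) (F : ℂ[X]) : Prop :=
  ∀ i, (∀ q < A, (P.coeff i).coeff q = 0) ∧ (P.coeff i).coeff A = F.coeff i

namespace HasInit

variable {P Q : HQ[X]} {A B : ℚ} {F G : ℂ[X]}

theorem zero (A : ℚ) : HasInit 0 A 0 := fun i => by simp

theorem add (hP : HasInit P A F) (hQ : HasInit Q A G) : HasInit (P + Q) A (F + G) := fun i => by
  refine ⟨fun q hq => ?_, ?_⟩
  · rw [coeff_add, HahnSeries.coeff_add, (hP i).1 q hq, (hQ i).1 q hq, add_zero]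
  · rw [coeff_add, HahnSeries.coeff_add, (hP i).2, (hQ i).2, coeff_add]

theorem neg (hP : HasInit P A F) : HasInit (-P) A (-F) := fun i => by
  refine ⟨fun q hq => ?_, ?_⟩
  · rw [coeff_neg, HahnSeries.coeff_neg, (hP i).1 q hq, neg_zero]
  · rw [coeff_neg, HahnSeries.coeff_neg, (hP i).2, coeff_neg]

theorem sub (hP : HasInit P A F) (hQ : HasInit Q A G) : HasInit (P - Q) A (F - G) := by
  rw [sub_eq_add_neg P, sub_eq_add_neg F]
  exact hP.add hQ.neg

theorem sum {ι : Type*} (s : Finset ι) {P : ι → HQ[X]} {F : ι → ℂ[X]}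
    (h : ∀ i ∈ s, HasInit (P i) A (F i)) : HasInit (∑ i ∈ s, P i) A (∑ i ∈ s, F i) := by
  classical
  induction s using Finset.induction_on with
  | empty => simpa using zero A
  | insert a s ha ih =>
    rw [Finset.sum_insert ha, Finset.sum_insert ha]
    exact (h a (Finset.mem_insert_self _ _)).add (ih fun i hi => h i (Finset.mem_insert_of_mem hi))

theorem mul (hP : HasInit P A F) (hQ : HasInit Q B G) : HasInit (P * Q) (A + B) (F * G) :=
  fun i => by
  refine ⟨fun q hq => ?_, ?_⟩
  · rw [coeff_mul, HahnSeries.coeff_sum]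
    exact Finset.sum_eq_zero fun p _ => coeff_mul_eq_zero (hP p.1).1 (hQ p.2).1 q hq
  · rw [coeff_mul, HahnSeries.coeff_sum, coeff_mul]
    refine Finset.sum_congr rfl fun p _ => ?_
    rw [coeff_mul_add (hP p.1).1 (hQ p.2).1, (hP p.1).2, (hQ p.2).2]

theorem const {a : HQ} (h : ∀ q < A, a.coeff q = 0) : HasInit (C a) A (C (a.coeff A)) := fun i => by
  rw [coeff_C, coeff_C]
  split_ifs
  · exact ⟨h, rfl⟩
  · simp

theorem one : HasInit 1 0 1 := by
  have := const (A := 0) (a := 1) fun q hq => by rw [HahnSeries.coeff_one, if_neg hq.ne]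
  simpa using this

theorem xpow (q : ℚ) : HasInit (C (xpow q)) q 1 := by
  have := const (A := q) (a := PlaneBranch.xpow q) fun p hp => HahnSeries.coeff_single_of_ne hp.ne
  simpa [PlaneBranch.xpow] using this

theorem var : HasInit X 0 X := fun i => by
  rw [coeff_X, coeff_X]
  split_ifs
  · exact ⟨fun q hq => by rw [HahnSeries.coeff_one, if_neg hq.ne], by simp⟩
  · simp

theorem pow (hP : HasInit P A F) (n : ℕ) : HasInit (P ^ n) (n * A) (F ^ n) := by
  induction n with
  | zero => simpa using one
  | succ n ih =>
    rw [pow_succ, pow_succ]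
    have : ((n + 1 : ℕ) : ℚ) * A = n * A + A := by push_cast; ring
    rw [this]
    exact ih.mul hP

theorem prod {ι : Type*} (s : Finset ι) {P : ι → HQ[X]} {A : ι → ℚ} {F : ι → ℂ[X]}
    (h : ∀ i ∈ s, HasInit (P i) (A i) (F i)) :
    HasInit (∏ i ∈ s, P i) (∑ i ∈ s, A i) (∏ i ∈ s, F i) := by
  classical
  induction s using Finset.induction_on with
  | empty => simpa using one
  | insert a s ha ih =>
    rw [Finset.prod_insert ha, Finset.prod_insert ha, Finset.sum_insert ha]
    exact (h a (Finset.mem_insert_self _ _)).mul (ih fun i hi => h i (Finset.mem_insert_of_mem hi))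

theorem derivative (hP : HasInit P A F) : HasInit (derivative P) A (derivative F) := fun i => by
  have hc : ((i : HQ) + 1) = HahnSeries.C ((i : ℂ) + 1) := by rw [map_add, map_natCast, map_one]
  rw [coeff_derivative, coeff_derivative, hc, mul_comm, HahnSeries.C_mul_eq_smul]
  refine ⟨fun q hq => ?_, ?_⟩
  · rw [HahnSeries.coeff_smul, (hP _).1 q hq, smul_zero]
  · rw [HahnSeries.coeff_smul, (hP _).2, smul_eq_mul, mul_comm]

/-- The derivation `x d/dx` multiplies `x^A` by `A` and keeps the weight; this is how the weights
enter the initial form of the jacobian. -/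
theorem euler (hP : HasInit P A F) : HasInit (mapCoeffs euler P) A (C (A : ℂ) * F) := fun i => by
  rw [coeff_mapCoeffs, coeff_C_mul]
  refine ⟨fun q hq => ?_, ?_⟩
  · rw [coeff_euler, (hP i).1 q hq, mul_zero]
  · rw [coeff_euler, (hP i).2]

theorem of_lt (hP : HasInit P A F) (h : B < A) : HasInit P B 0 := fun i =>
  ⟨fun q hq => (hP i).1 q (hq.trans h), by rw [(hP i).1 B h, coeff_zero]⟩

theorem unique (hP : HasInit P A F) (hP' : HasInit P A G) : F = G := by
  ext i
  rw [← (hP i).2, (hP' i).2]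

theorem le_of_ne_zero (hP : HasInit P A F) (hP' : HasInit P B G) (hF : F ≠ 0) : B ≤ A := by
  by_contra h
  push Not at h
  exact hF (hP.unique (hP'.of_lt h))

theorem eq_of_ne_zero (hP : HasInit P A F) (hP' : HasInit P B G) (hF : F ≠ 0) (hG : G ≠ 0) :
    A = B ∧ F = G := by
  obtain rfl : A = B := le_antisymm (hP'.le_of_ne_zero hP hG) (hP.le_of_ne_zero hP' hF)
  exact ⟨rfl, hP.unique hP'⟩

/-- An inner polynomial of weight 0 does not change the outer weight, so this passes from the
coordinate of a ball to that of a smaller one. -/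
theorem comp (hP : HasInit P A F) (hQ : HasInit Q 0 G) : HasInit (P.comp Q) A (F.comp G) := by
  have hd : F.natDegree < P.natDegree + 1 := by
    refine Nat.lt_succ_of_le (natDegree_le_iff_coeff_eq_zero.2 fun i hi => ?_)
    rw [← (hP i).2, coeff_eq_zero_of_natDegree_lt hi, HahnSeries.coeff_zero]
  have h1 : P.comp Q = ∑ i ∈ Finset.range (P.natDegree + 1), C (P.coeff i) * Q ^ i := by
    rw [Polynomial.comp, eval₂_eq_sum_range]
  have h2 : F.comp G = ∑ i ∈ Finset.range (P.natDegree + 1), C (F.coeff i) * G ^ i := by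
    rw [Polynomial.comp, eval₂_eq_sum_range' _ hd]
  rw [h1, h2]
  refine sum _ fun i _ => ?_
  have h3 := (const (hP i).1).mul (hQ.pow i)
  rwa [mul_zero, add_zero, (hP i).2] at h3

theorem of_C_xpow_mul {h : ℚ} (hP : HasInit (C (PlaneBranch.xpow h) * P) (h + A) F) :
    HasInit P A F := by
  have := (xpow (-h)).mul hP
  rwa [← mul_assoc, ← C_mul, ← xpow_add, neg_add_cancel, xpow_zero, C_1, one_mul, one_mul,
    neg_add_cancel_left] at this

end HasInit

/-- The coordinate `lam + x^h z` on the closed ball of radius `h` about `lam`. -/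
def ballVar (lam : HQ) (h : ℚ) : HQ[X] := C lam + C (xpow h) * X

theorem derivative_ballVar (lam : HQ) (h : ℚ) : derivative (ballVar lam h) = C (xpow h) := by
  simp [ballVar]

theorem mapCoeffs_euler_pow (P : HQ[X]) (n : ℕ) :
    mapCoeffs euler (P ^ (n + 1)) = C ((n : HQ) + 1) * P ^ n * mapCoeffs euler P := by
  induction n with
  | zero => simp
  | succ n ih =>
    rw [pow_succ, mapCoeffs_mul euler_mul, ih]
    simp only [map_add, map_natCast, map_one, Nat.cast_add, Nat.cast_one]
    ring

theorem mapCoeffs_C {A : Type*} [CommRing A] (D : A →+ A) (a : A) :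
    mapCoeffs D (C a) = C (D a) := by
  rw [← monomial_zero_left, mapCoeffs_monomial, monomial_zero_left]

/-- The chain rule; the second term appears because the center and the scale of the ball coordinate
depend on `x`. -/
theorem mapCoeffs_euler_comp (P q : HQ[X]) :
    mapCoeffs euler (P.comp q) =
      (mapCoeffs euler P).comp q + (derivative P).comp q * mapCoeffs euler q := by
  induction P using Polynomial.induction_on' with
  | add p q hp hq => simp only [add_comp, map_add, hp, hq]; ring
  | monomial n a =>
    rw [mapCoeffs_monomial, derivative_monomial, monomial_comp, monomial_comp, monomial_comp,
      mapCoeffs_mul euler_mul, mapCoeffs_C]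
    rcases n with _ | n
    · have : mapCoeffs euler (1 : HQ[X]) = 0 := by
        have h1 : euler 1 = 0 := by
          have := euler_mul 1 1
          simpa using this
        rw [← C_1, mapCoeffs_C, h1, C_0]
      simp [this]
    · rw [mapCoeffs_euler_pow, Nat.add_sub_cancel]
      simp only [map_mul, map_add, map_natCast, map_one, Nat.cast_add, Nat.cast_one]
      ring

/-- The initial form of the jacobian, in terms of the initial forms of the two polynomials. -/
theorem HasInit.jac {P Q J : HQ[X]} {lam : HQ} {h A B : ℚ} {F G : ℂ[X]}
    (hJ : C (PlaneBranch.xpow 1) * J =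
      mapCoeffs PlaneBranch.euler P * Polynomial.derivative Q -
        Polynomial.derivative P * mapCoeffs PlaneBranch.euler Q)
    (hP : HasInit (P.comp (ballVar lam h)) B G) (hQ : HasInit (Q.comp (ballVar lam h)) A F) :
    HasInit (J.comp (ballVar lam h)) (A + B - h - 1)
      (C (B : ℂ) * (G * Polynomial.derivative F) - C (A : ℂ) * (F * Polynomial.derivative G)) := by
  -- The extra terms of the chain rule are proportional to `P_y Q_y` and cancel in the determinant;
  -- the inner `z`-derivative contributes the factor `x^h`.
  have h1 : mapCoeffs PlaneBranch.euler (P.comp (ballVar lam h)) *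
        Polynomial.derivative (Q.comp (ballVar lam h)) -
      Polynomial.derivative (P.comp (ballVar lam h)) *
        mapCoeffs PlaneBranch.euler (Q.comp (ballVar lam h)) =
      C (PlaneBranch.xpow (h + 1)) * J.comp (ballVar lam h) := by
    have h2 := congrArg (fun R : HQ[X] => R.comp (ballVar lam h)) hJ
    simp only [mul_comp, C_comp, sub_comp] at h2
    rw [xpow_add, C_mul, mul_assoc, h2, mapCoeffs_euler_comp, mapCoeffs_euler_comp,
      derivative_comp, derivative_comp, derivative_ballVar]
    ring
  have h3 := (hP.euler.mul hQ.derivative).sub ((hP.derivative.mul hQ.euler))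
  rw [h1] at h3
  refine HasInit.of_C_xpow_mul (h := h + 1) ?_
  have h4 : h + 1 + (A + B - h - 1) = B + A := by ring
  rw [h4]
  convert h3 using 1
  ring

theorem X_sub_C_comp_ballVar (lam a : HQ) (h : ℚ) :
    (X - C a : HQ[X]).comp (ballVar lam h) = C (lam - a) + C (xpow h) * X := by
  simp only [sub_comp, X_comp, C_comp, ballVar, C_sub]; ring

theorem hasInit_X_sub_C_of_le {lam a : HQ} {h : ℚ} (ha : (h : WithTop ℚ) ≤ (a - lam).orderTop) :
    HasInit ((X - C a : HQ[X]).comp (ballVar lam h)) h (X - C ((a - lam).coeff h)) := by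
  rw [le_orderTop_iff] at ha
  have h1 := (HasInit.xpow h).mul HasInit.var
  have h2 := h1.sub (HasInit.const ha |>.add (HasInit.zero h) |> fun x => by
    simpa using x : HasInit (C (a - lam)) (h + 0) (C ((a - lam).coeff h)))
  rw [add_zero, one_mul] at h2
  rw [X_sub_C_comp_ballVar]
  have h3 : C (lam - a) + C (xpow h) * X = C (xpow h) * X - C (a - lam) := by
    simp only [C_sub]; ring
  rw [h3]
  exact h2

theorem hasInit_X_sub_C_of_lt {lam a : HQ} {h o : ℚ} (ha : (a - lam).orderTop = o) (ho : o < h) :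
    HasInit ((X - C a : HQ[X]).comp (ballVar lam h)) o (C ((lam - a).coeff o)) := by
  have h0 : ∀ q < o, (lam - a).coeff q = 0 := by
    rw [← le_orderTop_iff, ← HahnSeries.orderTop_neg, neg_sub, ha]
  have h1 := ((HasInit.xpow h).mul HasInit.var).of_lt (B := o) (by linarith)
  have h2 := (HasInit.const h0).add h1
  rw [X_sub_C_comp_ballVar]
  simpa using h2

theorem coeff_sub_ne_zero_of_orderTop_eq {lam a : HQ} {o : ℚ} (ha : (a - lam).orderTop = o) :
    (lam - a).coeff o ≠ 0 := by
  apply HahnSeries.coeff_orderTop_ne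
  rw [← HahnSeries.orderTop_neg, neg_sub, ha]

/-- The initial form of a product of linear factors on a ball: the factors with root in the ball
contribute the linear factors. -/
theorem exists_hasInit_multiset (lam : HQ) (h : ℚ) (s : Multiset HQ) :
    ∃ (A : ℚ) (c : ℂ), c ≠ 0 ∧
      HasInit ((s.map fun a => X - C a).prod.comp (ballVar lam h)) A
        (C c * ((s.filter fun a => (h : WithTop ℚ) ≤ (a - lam).orderTop).map
          fun a => X - C ((a - lam).coeff h)).prod) := by
  classical
  induction s using Multiset.induction_on with
  | empty => exact ⟨0, 1, one_ne_zero, by simpa using HasInit.one⟩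
  | cons a s ih =>
    obtain ⟨A, c, hc, hI⟩ := ih
    rw [Multiset.map_cons, Multiset.prod_cons, mul_comp]
    by_cases ha : (h : WithTop ℚ) ≤ (a - lam).orderTop
    · refine ⟨h + A, c, hc, ?_⟩
      rw [Multiset.filter_cons_of_pos (p := fun a => (h : WithTop ℚ) ≤ (a - lam).orderTop) _ ha,
        Multiset.map_cons, Multiset.prod_cons,
        mul_left_comm]
      exact (hasInit_X_sub_C_of_le ha).mul hI
    · push Not at ha
      obtain ⟨o, ho⟩ := WithTop.ne_top_iff_exists.1 ha.ne_top
      rw [← ho, WithTop.coe_lt_coe] at ha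
      refine ⟨o + A, (lam - a).coeff o * c,
        mul_ne_zero (coeff_sub_ne_zero_of_orderTop_eq ho.symm) hc, ?_⟩
      rw [Multiset.filter_cons_of_neg (p := fun a => (h : WithTop ℚ) ≤ (a - lam).orderTop) _
        (by rw [← ho, WithTop.coe_le_coe]; exact not_le.2 ha),
        C_mul, mul_assoc]
      exact (hasInit_X_sub_C_of_lt ho.symm ha).mul hI

/-- The number of elements of a multiset in the closed ball of radius `h` about `lam`. -/
def ballCount (s : Multiset HQ) (lam : HQ) (h : ℚ) : ℕ :=
  (s.filter fun a => (h : WithTop ℚ) ≤ (a - lam).orderTop).card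

theorem exists_hasInit_of_splits {P : HQ[X]} (hP : P.Splits) (h0 : P ≠ 0) (lam : HQ) (h : ℚ) :
    ∃ (A : ℚ) (F : ℂ[X]), F ≠ 0 ∧ F.natDegree = ballCount P.roots lam h ∧
      HasInit (P.comp (ballVar lam h)) A F := by
  obtain ⟨A, c, hc, hI⟩ := exists_hasInit_multiset lam h P.roots
  obtain ⟨o, ho⟩ := WithTop.ne_top_iff_exists.1
    (HahnSeries.orderTop_ne_top.2 (leadingCoeff_ne_zero.2 h0))
  have hlc := HasInit.const (le_orderTop_iff.1 ho.le)
  have hne : (P.leadingCoeff).coeff o ≠ 0 := HahnSeries.coeff_orderTop_ne ho.symm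
  set S := (P.roots.filter fun a => (h : WithTop ℚ) ≤ (a - lam).orderTop).map
    fun a => X - C ((a - lam).coeff h) with hS
  have hm : S.prod.Monic := monic_multiset_prod_of_monic _ _ fun a _ => monic_X_sub_C _
  have hI2 := hlc.mul hI
  rw [← mul_assoc, ← C_mul] at hI2
  refine ⟨o + A, C (P.leadingCoeff.coeff o * c) * S.prod,
    mul_ne_zero (C_ne_zero.2 (mul_ne_zero hne hc)) hm.ne_zero, ?_, ?_⟩
  swap
  · have hcomp : P.comp (ballVar lam h) = C P.leadingCoeff *
        (P.roots.map fun a => X - C a).prod.comp (ballVar lam h) := by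
      conv_lhs => rw [hP.eq_prod_roots]
      rw [mul_comp, C_comp]
    rw [hcomp]
    exact hI2
  · rw [natDegree_C_mul (mul_ne_zero hne hc), hS, natDegree_multiset_prod_of_monic]
    · rw [Multiset.map_map]
      simp only [Function.comp_apply, natDegree_X_sub_C]
      simp [ballCount]
    · intro q hq
      obtain ⟨a, -, rfl⟩ := Multiset.mem_map.1 hq
      exact monic_X_sub_C _

/-- A nonzero initial form determines both its weight and itself, so the form read off from the
roots agrees with any form computed otherwise. Computed initial forms thus become root counts. -/
theorem natDegree_eq_ballCount {P : HQ[X]} (hP : P.Splits) {lam : HQ} {h A : ℚ} {F : ℂ[X]}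
    (hF : F ≠ 0) (hI : HasInit (P.comp (ballVar lam h)) A F) :
    F.natDegree = ballCount P.roots lam h := by
  have h0 : P ≠ 0 := by
    rintro rfl
    rw [zero_comp] at hI
    exact hF (hI.unique (HasInit.zero A))
  obtain ⟨A', F', hF', hd, hI'⟩ := exists_hasInit_of_splits hP h0 lam h
  rw [(hI.eq_of_ne_zero hI' hF hF').2, hd]

end

end PlaneBranch

/-! ### Monodromy invariant root families and the conjugates of a branch. -/

namespace PlaneBranch

noncomputable section

open Polynomial

/-- Coefficients of a product over conjugates are known as convergent series in `x^(1/m)` and as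
formal series in `x`; this combines the two descriptions. -/
theorem isConvergent_of_emb_eq {ψ : PowerSeries ℂ} {m : ℕ+} {c : Cx}
    (h : emb 1 ψ = emb m (Cx.incl c)) : IsConvergent ψ := by
  rw [← emb_expand 1 m m (by simp)] at h
  rw [← isConvergent_expand_iff m.ne_zero, emb_injective m h]
  exact Cx.isConvergent_incl c

/-- A weight-zero form equal to a pure power says that the non-leading coefficients have positive
order, which is the Weierstrass condition. -/
theorem hasInit_prod_X_sub_C {s : Multiset HQ} (h : ∀ α ∈ s, 0 < α.orderTop) :
    HasInit (s.map fun α => X - C α).prod 0 (X ^ s.card) := by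
  induction s using Multiset.induction_on with
  | empty => simpa using HasInit.one
  | cons a s ih =>
    rw [Multiset.map_cons, Multiset.prod_cons, Multiset.card_cons, pow_succ']
    have ha := h a (Multiset.mem_cons_self a s)
    have h1 := HasInit.const (A := 0) (a := a) (by
      rw [← le_orderTop_iff]; exact ha.le)
    rw [HahnSeries.coeff_eq_zero_of_lt_orderTop ha] at h1
    have h2 := (HasInit.var.sub h1).mul (ih fun α hα => h α (Multiset.mem_cons_of_mem hα))
    simpa using h2

/-- A monodromy invariant family of roots of a polynomial over `ℂ{x}` is the family of roots of a
Weierstrass polynomial. -/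
theorem exists_isWeierstrass_of_roots {P : Cx[X]} (hP : P ≠ 0) {s : Multiset HQ}
    (hs : ∀ α ∈ s, (P.map toH).eval α = 0 ∧ 0 < α.orderTop) (hinv : s.map (twist 1) = s) :
    ∃ Q : Cx[X], IsWeierstrass Q ∧ Q.map toH = (s.map fun α => X - C α).prod ∧
      Q.natDegree = s.card := by
  classical
  set R := (s.map fun α => X - C α).prod with hR
  have hRm : R.Monic := monic_multiset_prod_of_monic _ _ fun α _ => monic_X_sub_C α
  have hRd : R.natDegree = s.card := by
    rw [hR, natDegree_multiset_prod_of_monic]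
    · simp
    · intro q hq
      obtain ⟨a, -, rfl⟩ := Multiset.mem_map.1 hq
      exact monic_X_sub_C _
  have hI := hasInit_prod_X_sub_C fun α hα => (hs α hα).2
  have hpui : ∀ α ∈ s, α ∈ pui := fun α hα =>
    (splits_of_coeff_mem_pui (coeff_map_toH_mem_pui P)).2 α
      ((mem_roots (map_toH_ne_zero hP)).2 (hs α hα).1)
  obtain ⟨m, hm⟩ := exists_common_twist s.toFinset id fun α hα =>
    hpui α (Multiset.mem_toFinset.1 hα)
  have hlift : R ∈ lifts ((emb m).comp Cx.incl) := by
    rw [hR]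
    refine multiset_prod_mem _ fun q hq => ?_
    obtain ⟨α, hα, rfl⟩ := Multiset.mem_map.1 hq
    obtain ⟨φ, hφ, hφα⟩ := exists_convergent_of_root hP (hs α hα).1 (hs α hα).2.le m
      (hm α (Multiset.mem_toFinset.2 hα))
    rw [lifts_iff_set_range]
    refine ⟨X - C (Cx.mk φ hφ), ?_⟩
    rw [Polynomial.map_sub, map_X, map_C, RingHom.comp_apply, Cx.incl_mk, hφα]
  have htw : R.map (twist 1) = R := by
    rw [hR, Polynomial.map_multiset_prod, Multiset.map_map]
    conv_rhs => rw [← hinv, Multiset.map_map]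
    simp
  rw [lifts_iff_coeff_lifts] at hlift
  have hlift' : R ∈ lifts toH := by
    rw [lifts_iff_coeff_lifts]
    intro i
    obtain ⟨c, hc⟩ := hlift i
    obtain ⟨ψ, hψ⟩ := exists_emb_eq 1 (a := R.coeff i) (by
      have := congrArg (fun q => q.coeff i) htw
      simpa using this) (by
        rw [← WithTop.coe_zero, le_orderTop_iff]; exact (hI i).1)
    refine ⟨Cx.mk ψ (isConvergent_of_emb_eq (hψ.trans hc.symm)), ?_⟩
    rw [toH_apply, Cx.incl_mk, hψ]
  obtain ⟨Q, hQ, hQd, hQm⟩ := lifts_and_natDegree_eq_and_monic hlift' hRm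
  refine ⟨Q, ⟨hQm, fun i hi => ?_⟩, hQ, hQd.trans hRd⟩
  rw [← coeff_zero_emb 1, ← toH_apply, ← coeff_map, hQ, (hI i).2, coeff_X_pow, if_neg]
  rw [hQd, hRd] at hi
  exact hi.ne

/-- The roots of a Weierstrass polynomial have positive order. -/
theorem IsWeierstrass.orderTop_pos {f : Cx[X]} (hf : IsWeierstrass f) {α : HQ}
    (h : (f.map toH).eval α = 0) : 0 < α.orderTop := by
  by_contra hneg
  push Not at hneg
  obtain ⟨o, ho⟩ := WithTop.ne_top_iff_exists.1 (ne_top_of_le_ne_top (by simp) hneg)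
  have ho0 : o ≤ 0 := by rw [← ho] at hneg; exact_mod_cast hneg
  -- If a root had order `o ≤ 0`, then under `y = x^o z` the leading term alone would have the
  -- minimal weight, and the initial coefficient of the root would have `n`-th power zero.
  have hI : HasInit ((f.map toH).comp (C (xpow o) * X)) (f.natDegree * o) (X ^ f.natDegree) := by
    intro i
    rw [comp_C_mul_X_coeff, coeff_map, xpow_pow, mul_comm (toH _), coeff_X_pow]
    rcases lt_trichotomy i f.natDegree with hi | hi | hi
    · have h1 : 0 < (toH (f.coeff i)).orderTop := by
        rw [toH_apply, orderTop_emb_pos_iff]; exact hf.2 i hi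
      have h2 : (i : ℚ) < f.natDegree := by exact_mod_cast hi
      have h3 : ∀ q ≤ (f.natDegree : ℚ) * o, (xpow (i * o) * toH (f.coeff i)).coeff q = 0 := by
        intro q hq
        rw [coeff_xpow_mul]
        apply HahnSeries.coeff_eq_zero_of_lt_orderTop
        refine lt_of_le_of_lt ?_ h1
        have : q - i * o ≤ 0 := by nlinarith
        exact_mod_cast this
      refine ⟨fun q hq => h3 q hq.le, ?_⟩
      rw [h3 _ le_rfl, if_neg hi.ne]
    · rw [hi, hf.1.coeff_natDegree, map_one, mul_one, if_pos rfl]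
      refine ⟨fun q hq => HahnSeries.coeff_single_of_ne hq.ne, ?_⟩
      rw [xpow, HahnSeries.coeff_single_same]
    · rw [coeff_eq_zero_of_natDegree_lt hi, map_zero, mul_zero, if_neg hi.ne']
      simp
  have hz : HasInit (C (xpow (-o) * α)) 0 (C (α.coeff o)) := by
    have h1 := HasInit.const (A := 0) (a := xpow (-o) * α) (fun q hq => by
      rw [coeff_xpow_mul]
      apply HahnSeries.coeff_eq_zero_of_lt_orderTop
      rw [← ho, WithTop.coe_lt_coe]; linarith)
    rw [coeff_xpow_mul] at h1
    simpa using h1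
  have hc := hI.comp hz
  rw [comp_assoc, mul_comp, C_comp, X_comp, ← C_mul, ← mul_assoc, ← xpow_add, add_neg_cancel,
    xpow_zero, one_mul, comp_C, h, C_0, X_pow_comp, ← C_pow] at hc
  have := hc.unique (HasInit.zero _)
  rw [C_eq_zero] at this
  exact pow_ne_zero _ (HahnSeries.coeff_orderTop_ne ho.symm) this

/-- The stabilizer of `γ` is a nonzero subgroup of `ℤ`, and `N` is its positive generator. -/
theorem twist_eq_self_iff_dvd {γ : HQ} (h : ∃ m : ℕ, 0 < m ∧ twist m γ = γ) :
    ∃ N : ℕ, 0 < N ∧ ∀ j : ℤ, twist j γ = γ ↔ (N : ℤ) ∣ j := by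
  classical
  refine ⟨Nat.find h, (Nat.find_spec h).1, fun j => ⟨fun hj => ?_, ?_⟩⟩
  · have hN := Nat.find_spec h
    set N := Nat.find h with hNdef
    have hN0 : (0 : ℤ) < N := by exact_mod_cast hN.1
    by_contra hnd
    have hr0 : 0 < j % N := lt_of_le_of_ne (Int.emod_nonneg j hN0.ne')
      fun h0 => hnd (Int.dvd_of_emod_eq_zero h0.symm)
    have hrN : j % N < N := Int.emod_lt_of_pos j hN0
    obtain ⟨r, hr⟩ := Int.eq_ofNat_of_zero_le hr0.le
    have hr' : twist (r : ℤ) γ = γ := by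
      have h1 : j = (r : ℤ) + N * (j / N) := by rw [← hr, Int.emod_add_mul_ediv]
      rw [h1, twist_add, twist_mul_eq_self hN.2] at hj
      exact hj
    rw [hr] at hr0 hrN
    exact Nat.find_min h (m := r) (by exact_mod_cast hrN) ⟨by exact_mod_cast hr0, hr'⟩
  · rintro ⟨k, rfl⟩
    exact twist_mul_eq_self (Nat.find_spec h).2 k

theorem twist_eq_twist_iff (i j : ℤ) (γ : HQ) : twist i γ = twist j γ ↔ twist (i - j) γ = γ := by
  constructor
  · intro h
    have := congrArg (twist (-j)) h
    rwa [← twist_add, ← twist_add, neg_add_cancel, twist_zero, neg_add_eq_sub] at this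
  · intro h
    conv_rhs => rw [← h]
    rw [← twist_add, add_sub_cancel]

/-- The roots of an irreducible Weierstrass polynomial are the conjugates of one of them. -/
theorem exists_branch {f : Cx[X]} (hW : IsWeierstrass f) (hf : Irreducible f) :
    ∃ γ : HQ, 0 < γ.orderTop ∧ (∀ j : ℤ, twist j γ = γ ↔ (f.natDegree : ℤ) ∣ j) ∧
      0 < f.natDegree ∧
      f.map toH = ∏ j ∈ Finset.range f.natDegree, (X - C (twist (j : ℤ) γ)) := by
  classical
  have hf0 : f ≠ 0 := hf.ne_zero
  have hfd : 0 < f.natDegree := by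
    rw [Nat.pos_iff_ne_zero]
    intro h
    exact hf.not_isUnit (by rw [hW.1.natDegree_eq_zero.1 h]; exact isUnit_one)
  have hsp := splits_of_coeff_mem_pui (coeff_map_toH_mem_pui f)
  have hfm : (f.map toH).Monic := hW.1.map _
  obtain ⟨γ, hγ⟩ := hsp.1.exists_eval_eq_zero (by
    rw [degree_eq_natDegree hfm.ne_zero, hW.1.natDegree_map]
    exact_mod_cast hfd.ne')
  obtain ⟨m, hm⟩ := mem_pui.1 (hsp.2 γ ((mem_roots hfm.ne_zero).2 hγ))
  obtain ⟨N, hN, hper⟩ := twist_eq_self_iff_dvd ⟨m, m.pos, hm⟩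
  have hroot : ∀ j : ℤ, (f.map toH).eval (twist j γ) = 0 := by
    intro j
    have h1 : (f.map toH).map (twist j) = f.map toH := by
      rw [Polynomial.map_map, twist_comp_toH]
    rw [← h1, eval_map, eval₂_at_apply, hγ, map_zero]
  have hinj : Set.InjOn (fun j : ℕ => twist (j : ℤ) γ) (Finset.range N) := by
    intro i hi j hj hij
    simp only [Finset.coe_range, Set.mem_Iio] at hi hj
    have h1 := (hper _).1 ((twist_eq_twist_iff _ _ _).1 hij)
    have h2 : ((i : ℤ) - j) = 0 := by
      refine Int.eq_zero_of_abs_lt_dvd h1 ?_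
      rw [abs_lt]; omega
    omega
  set s : Multiset HQ := (Multiset.range N).map fun j : ℕ => twist (j : ℤ) γ with hs
  have hnd : s.Nodup := by
    rw [hs, Multiset.nodup_map_iff_inj_on (Multiset.nodup_range N)]
    intro i hi j hj hij
    exact hinj (by simpa using hi) (by simpa using hj) hij
  have hmem : ∀ α ∈ s, ∃ j : ℤ, twist j γ = α := fun α hα => by
    obtain ⟨j, -, rfl⟩ := Multiset.mem_map.1 hα
    exact ⟨j, rfl⟩
  have hinv : s.map (twist 1) = s := by
    refine Multiset.eq_of_le_of_card_le ?_ (by simp)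
    rw [Multiset.le_iff_subset (hnd.map (twist_injective 1))]
    intro α hα
    rw [hs, Multiset.map_map] at hα
    obtain ⟨j, hj, rfl⟩ := Multiset.mem_map.1 hα
    rw [Multiset.mem_range] at hj
    rw [Function.comp_apply, ← twist_add]
    by_cases hjN : j + 1 = N
    · have : (1 : ℤ) + j = N := by omega
      rw [this, (hper N).2 dvd_rfl]
      exact Multiset.mem_map.2 ⟨0, by simpa using hN, by simp [twist_zero]⟩
    · refine Multiset.mem_map.2 ⟨j + 1, by rw [Multiset.mem_range]; omega, ?_⟩
      rw [Nat.cast_add, Nat.cast_one, add_comm]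
  -- The product over the orbit of `γ` descends to `ℂ{x}[y]` and divides `f`, so irreducibility
  -- makes it equal to `f`.
  obtain ⟨Q, hQW, hQ, hQd⟩ := exists_isWeierstrass_of_roots hf0 (s := s) (fun α hα => by
    obtain ⟨j, rfl⟩ := hmem α hα
    exact ⟨hroot j, hW.orderTop_pos (hroot j)⟩) hinv
  have hdvd : Q ∣ f := by
    rw [← modByMonic_eq_zero_iff_dvd hQW.1]
    apply Polynomial.map_injective toH toH_injective
    rw [map_modByMonic _ hQW.1, Polynomial.map_zero,
      modByMonic_eq_zero_iff_dvd (hQW.1.map _), hQ,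
      Multiset.prod_X_sub_C_dvd_iff_le_roots hfm.ne_zero, Multiset.le_iff_subset hnd]
    intro α hα
    obtain ⟨j, rfl⟩ := hmem α hα
    exact (mem_roots hfm.ne_zero).2 (hroot j)
  have hQN : Q.natDegree = N := by rw [hQd, hs]; simp
  have hQf : Q = f := by
    obtain ⟨R, hR⟩ := hdvd
    rcases hf.isUnit_or_isUnit hR with hu | hu
    · exfalso
      have := natDegree_eq_zero_of_isUnit hu
      omega
    · refine eq_of_monic_of_associated hQW.1 hW.1 ?_
      rw [hR]
      exact associated_mul_unit_right _ _ hu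
  subst hQf
  rw [hQN]
  refine ⟨γ, hW.orderTop_pos hγ, hper, hN, ?_⟩
  rw [hQ, hs, Multiset.map_map]
  rfl

end

end PlaneBranch

/-! ### Puiseux characteristic, contacts and the numbers `l_i`. -/

namespace PlaneBranch

noncomputable section

open Polynomial

theorem coeff_twist_sub_self (j : ℤ) (γ : HQ) (q : ℚ) :
    (twist j γ - γ).coeff q = (chr j q - 1) * γ.coeff q := by
  rw [HahnSeries.coeff_sub, coeff_twist]; ring

theorem chr_div_eq_one_iff {N : ℕ} (hN : 0 < N) (j : ℤ) (B : ℕ) :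
    chr j ((B : ℚ) / N) = 1 ↔ (N : ℤ) ∣ j * B := by
  have hN' : (N : ℚ) ≠ 0 := by positivity
  rw [chr_eq_one_iff]
  refine exists_congr fun n => ?_
  rw [← mul_div_assoc, div_eq_iff hN', mul_comm (n : ℚ)]
  exact_mod_cast Iff.rfl

theorem charGcd_dvd (b : ℕ → ℕ) {t i : ℕ} (h : t ≤ i) : charGcd b i ∣ b t :=
  Finset.gcd_dvd (by simp; omega)

theorem charGcd_succ (b : ℕ → ℕ) (i : ℕ) :
    charGcd b (i + 1) = Nat.gcd (charGcd b i) (b (i + 1)) := by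
  rw [charGcd, Finset.range_add_one, Finset.gcd_insert, charGcd, gcd_comm]
  rfl

theorem charGcd_zero (b : ℕ → ℕ) : charGcd b 0 = b 0 := by
  simp [charGcd]

/-- With `N = b 0`, the right side says that the `j`-th monodromy acts trivially at all
characteristic exponents up to the `i`-th. -/
theorem dvd_mul_charGcd_iff (b : ℕ → ℕ) (N : ℕ) (j : ℤ) (i : ℕ) :
    (N : ℤ) ∣ j * charGcd b i ↔ ∀ t ≤ i, (N : ℤ) ∣ j * b t := by
  induction i with
  | zero => simp [charGcd_zero]
  | succ i ih =>
    have h1 : (N : ℤ) ∣ j * charGcd b (i + 1) ↔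
        (N : ℤ) ∣ j * charGcd b i ∧ (N : ℤ) ∣ j * b (i + 1) := by
      rw [charGcd_succ, ← Int.natAbs_dvd_natAbs, ← Int.natAbs_dvd_natAbs, ← Int.natAbs_dvd_natAbs]
      simp only [Int.natAbs_mul, Int.natAbs_natCast]
      rw [← Nat.gcd_mul_left, Nat.dvd_gcd_iff]
    rw [h1, ih]
    constructor
    · rintro ⟨h2, h3⟩ t ht
      rcases Nat.lt_or_ge t (i + 1) with h | h
      · exact h2 t (by omega)
      · obtain rfl : t = i + 1 := by omega
        exact h3
    · exact fun h => ⟨fun t ht => h t (by omega), h _ le_rfl⟩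

/-- The conjugates `twist j γ` of `γ` are `N` in number, and `(N, b 1, …, b g)` is their
characteristic. -/
structure IsBranch (N : ℕ) (γ : HQ) (g : ℕ) (b : ℕ → ℕ) : Prop where
  pos : 0 < N
  orderTop_pos : 0 < γ.orderTop
  twist_iff : ∀ j : ℤ, twist j γ = γ ↔ (N : ℤ) ∣ j
  zero : b 0 = N
  strictMono : StrictMonoOn b (Set.Icc 1 g)
  contact : ∀ j : ℤ, twist j γ ≠ γ → ∃ i ∈ Set.Icc 1 g,
    (twist j γ - γ).orderTop = (((b i : ℚ) / N : ℚ) : WithTop ℚ)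
  exists_contact : ∀ i ∈ Set.Icc 1 g, ∃ j : ℤ,
    (twist j γ - γ).orderTop = (((b i : ℚ) / N : ℚ) : WithTop ℚ)

theorem orderTop_twist_sub_twist (i j : ℤ) (γ : HQ) :
    (twist i γ - twist j γ).orderTop = (twist (i - j) γ - γ).orderTop := by
  rw [← orderTop_twist j (twist (i - j) γ - γ), map_sub, ← twist_add, add_sub_cancel]

theorem mem_zer_iff_exists_twist {f : Cx[X]} (hW : IsWeierstrass f) {γ : HQ}
    (hN : 0 < f.natDegree) (hper : ∀ j : ℤ, twist j γ = γ ↔ (f.natDegree : ℤ) ∣ j)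
    (hprod : f.map toH = ∏ j ∈ Finset.range f.natDegree, (X - C (twist (j : ℤ) γ))) {α : HQ} :
    α ∈ Zer (toSeries f) ↔ ∃ j : ℤ, α = twist j γ := by
  rw [mem_zer_toSeries_iff hW.1.ne_zero]
  have hev : (f.map toH).eval α = 0 ↔ ∃ j ∈ Finset.range f.natDegree, α = twist (j : ℤ) γ := by
    rw [hprod, eval_prod, Finset.prod_eq_zero_iff]
    simp [sub_eq_zero]
  constructor
  · rintro ⟨h, -⟩
    obtain ⟨j, -, hj⟩ := hev.1 h
    exact ⟨j, hj⟩
  · rintro ⟨j, rfl⟩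
    have h0 : (f.map toH).eval (twist j γ) = 0 := by
      have hN' : (0 : ℤ) < f.natDegree := by exact_mod_cast hN
      obtain ⟨r, hr⟩ := Int.eq_ofNat_of_zero_le (Int.emod_nonneg j hN'.ne')
      have hlt := Int.emod_lt_of_pos j hN'
      rw [hr] at hlt
      refine hev.2 ⟨r, by rw [Finset.mem_range]; exact_mod_cast hlt, ?_⟩
      rw [twist_eq_twist_iff, hper]
      rw [← hr]
      exact Int.dvd_self_sub_emod
    exact ⟨h0, hW.orderTop_pos h0⟩

theorem exists_isBranch {f : Cx[X]} (hW : IsWeierstrass f) (hf : Irreducible f) {g : ℕ}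
    {b : ℕ → ℕ} (hb : IsPuiseuxCharacteristic f g b) :
    ∃ γ : HQ, IsBranch f.natDegree γ g b ∧
      f.map toH = ∏ j ∈ Finset.range f.natDegree, (X - C (twist (j : ℤ) γ)) := by
  obtain ⟨γ, hpos, hper, hN, hprod⟩ := exists_branch hW hf
  have hzer := fun α => mem_zer_iff_exists_twist (α := α) hW hN hper hprod
  have hcont := hb.contacts
  refine ⟨γ, ⟨hN, hpos, hper, hb.zero, hb.strictMono, fun j hj => ?_, fun i hi => ?_⟩, hprod⟩
  · have : (twist j γ - γ).orderTop ∈ {c : WithTop ℚ | ∃ γ ∈ Zer (toSeries f),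
        ∃ γ' ∈ Zer (toSeries f), γ ≠ γ' ∧ c = contactOrder γ γ'} :=
      ⟨twist j γ, (hzer _).2 ⟨j, rfl⟩, γ, (hzer _).2 ⟨0, (twist_zero γ).symm⟩, hj, rfl⟩
    rw [hcont, hb.zero] at this
    obtain ⟨i, hi, h⟩ := this
    exact ⟨i, hi, h.symm⟩
  · have : (((b i : ℚ) / (b 0 : ℚ) : ℚ) : WithTop ℚ) ∈ {c : WithTop ℚ | ∃ γ ∈ Zer (toSeries f),
        ∃ γ' ∈ Zer (toSeries f), γ ≠ γ' ∧ c = contactOrder γ γ'} := by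
      rw [hcont]; exact ⟨i, hi, rfl⟩
    obtain ⟨γ₁, h1, γ₂, h2, -, h⟩ := this
    obtain ⟨i₁, rfl⟩ := (hzer _).1 h1
    obtain ⟨i₂, rfl⟩ := (hzer _).1 h2
    refine ⟨i₁ - i₂, ?_⟩
    rw [← orderTop_twist_sub_twist, ← hb.zero, h]
    rfl

namespace IsBranch

variable {N : ℕ} {γ : HQ} {g : ℕ} {b : ℕ → ℕ}

theorem coeff_ne_zero (hB : IsBranch N γ g b)
    {i : ℕ} (hi : i ∈ Set.Icc 1 g) : γ.coeff ((b i : ℚ) / N) ≠ 0 := by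
  obtain ⟨j, hj⟩ := hB.exists_contact i hi
  have := HahnSeries.coeff_orderTop_ne hj
  rw [coeff_twist_sub_self] at this
  exact right_ne_zero_of_mul this

theorem height_pos (hB : IsBranch N γ g b) {i : ℕ} (hi : i ∈ Set.Icc 1 g) : 0 < (b i : ℚ) / N := by
  by_contra h
  apply hB.coeff_ne_zero hi
  apply HahnSeries.coeff_eq_zero_of_lt_orderTop
  refine lt_of_le_of_lt ?_ hB.orderTop_pos
  exact_mod_cast not_lt.1 h

theorem charGcd_dvd_pos (hB : IsBranch N γ g b) (i : ℕ) : charGcd b i ∣ N ∧ 0 < charGcd b i := by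
  have h := charGcd_dvd b (Nat.zero_le i)
  rw [hB.zero] at h
  exact ⟨h, Nat.pos_of_dvd_of_pos h hB.pos⟩

/-- The conjugates in a ball about `γ` whose radius is between two characteristic exponents. -/
theorem le_orderTop_twist_sub_iff (hB : IsBranch N γ g b)
    {i : ℕ} (hi : i ≤ g) {h : ℚ} (h1 : 1 ≤ i → (b i : ℚ) / N < h)
    (h2 : i < g → h ≤ (b (i + 1) : ℚ) / N) (j : ℤ) :
    (h : WithTop ℚ) ≤ (twist j γ - γ).orderTop ↔ (N : ℤ) ∣ j * charGcd b i := by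
  have hN : (0 : ℚ) < N := by exact_mod_cast hB.pos
  rw [dvd_mul_charGcd_iff]
  constructor
  -- The coefficient of `γ` at a characteristic exponent is nonzero, so agreement below `h` forces
  -- the character to be trivial there. Conversely, a contact is a characteristic exponent with
  -- nontrivial character, hence of index greater than `i`.
  · intro hle t ht
    rcases Nat.eq_zero_or_pos t with rfl | ht0
    · rw [hB.zero]; exact dvd_mul_left _ _
    have hti : t ∈ Set.Icc 1 g := ⟨ht0, by omega⟩
    have hlt : (b t : ℚ) / N < h := by
      refine lt_of_le_of_lt ?_ (h1 (by omega))
      have : b t ≤ b i := hB.strictMono.monotoneOn hti ⟨by omega, hi⟩ ht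
      have : (b t : ℚ) ≤ b i := by exact_mod_cast this
      gcongr
    have h3 := le_orderTop_iff.1 hle _ hlt
    rw [coeff_twist_sub_self] at h3
    have h4 := (mul_eq_zero.1 h3).resolve_right (hB.coeff_ne_zero hti)
    rw [sub_eq_zero, chr_div_eq_one_iff hB.pos] at h4
    exact h4
  · intro h
    by_cases hj : twist j γ = γ
    · rw [hj, sub_self]; simp
    obtain ⟨t, ht, hto⟩ := hB.contact j hj
    have hne := HahnSeries.coeff_orderTop_ne hto
    rw [coeff_twist_sub_self] at hne
    have hti : i < t := by
      by_contra hle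
      apply left_ne_zero_of_mul hne
      rw [sub_eq_zero, chr_div_eq_one_iff hB.pos]
      exact h t (by omega)
    rw [hto, WithTop.coe_le_coe]
    have hig : i < g := lt_of_lt_of_le hti ht.2
    refine (h2 hig).trans ?_
    have : b (i + 1) ≤ b t := hB.strictMono.monotoneOn ⟨by omega, by omega⟩ ht hti
    have : (b (i + 1) : ℚ) ≤ b t := by exact_mod_cast this
    gcongr

theorem card_filter_dvd (hB : IsBranch N γ g b) (i : ℕ) :
    ((Finset.range N).filter fun j : ℕ => (N : ℤ) ∣ (j : ℤ) * charGcd b i).card = charGcd b i := by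
  obtain ⟨⟨d, hd⟩, hl⟩ := hB.charGcd_dvd_pos i
  set l := charGcd b i
  have hd0 : 0 < d := Nat.pos_of_ne_zero fun h => by
    have := hB.pos
    rw [hd, h] at this
    simp at this
  have hiff : ∀ j : ℕ, (N : ℤ) ∣ (j : ℤ) * l ↔ d ∣ j := by
    intro j
    rw [hd, mul_comm l d]
    have : ((d * l : ℕ) : ℤ) ∣ (j : ℤ) * l ↔ d * l ∣ j * l := by exact_mod_cast Iff.rfl
    rw [this, Nat.mul_dvd_mul_iff_right hl]
  have : (Finset.range N).filter (fun j : ℕ => (N : ℤ) ∣ (j : ℤ) * l) =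
      (Finset.range l).image fun t => d * t := by
    ext j
    simp only [Finset.mem_filter, Finset.mem_range, hiff, Finset.mem_image]
    constructor
    · rintro ⟨h1, t, rfl⟩
      refine ⟨t, ?_, rfl⟩
      rw [hd, mul_comm l] at h1
      exact lt_of_mul_lt_mul_left h1 (Nat.zero_le d)
    · rintro ⟨t, ht, rfl⟩
      refine ⟨?_, dvd_mul_right _ _⟩
      rw [hd, mul_comm l]
      exact Nat.mul_lt_mul_of_pos_left ht hd0
  rw [this, Finset.card_image_of_injective _ (fun x y h => Nat.eq_of_mul_eq_mul_left hd0 h),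
    Finset.card_range]

/-- The monodromy of index `N / l_g` fixes `γ` to every order, hence exactly, so `N` divides `N /
l_g`. -/
theorem charGcd_last (hB : IsBranch N γ g b) : charGcd b g = 1 := by
  obtain ⟨⟨d, hd⟩, hl⟩ := hB.charGcd_dvd_pos g
  have h0 : twist (d : ℤ) γ = γ := by
    have hall : ∀ h : ℚ, (1 ≤ g → (b g : ℚ) / N < h) →
        (h : WithTop ℚ) ≤ (twist (d : ℤ) γ - γ).orderTop := fun h hh => by
      rw [hB.le_orderTop_twist_sub_iff le_rfl hh (fun h => absurd h (lt_irrefl _))]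
      refine ⟨1, ?_⟩
      rw [hd]; push_cast; ring
    by_contra hne
    obtain ⟨o, ho⟩ := WithTop.ne_top_iff_exists.1
      (HahnSeries.orderTop_ne_top.2 (sub_ne_zero.2 hne))
    have := hall (max o ((b g : ℚ) / N) + 1) fun _ =>
      lt_of_le_of_lt (le_max_right _ _) (lt_add_one _)
    rw [← ho, WithTop.coe_le_coe] at this
    have := le_max_left o ((b g : ℚ) / N)
    linarith
  rw [hB.twist_iff] at h0
  have h1 : N ∣ d := by exact_mod_cast h0
  have h2 : d ∣ N := ⟨charGcd b g, by rw [hd]; ring⟩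
  have h3 : N = d := Nat.dvd_antisymm h1 h2
  have h4 : 0 < d := h3 ▸ hB.pos
  rw [h3] at hd
  exact Nat.eq_of_mul_eq_mul_right h4 (by rw [one_mul, ← hd])

/-- Some conjugate has contact exactly `b_{i+1}/N` with `γ`; if `l_{i+1} = l_i`, the character at
this exponent would be trivial for it. -/
theorem charGcd_succ_ne (hB : IsBranch N γ g b)
    {i : ℕ} (hi : i < g) : charGcd b (i + 1) ≠ charGcd b i := by
  intro heq
  obtain ⟨j, hj⟩ := hB.exists_contact (i + 1) ⟨by omega, by omega⟩
  have hN : (0 : ℚ) < N := by exact_mod_cast hB.pos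
  have h1 := (hB.le_orderTop_twist_sub_iff hi.le (h := (b (i + 1) : ℚ) / N) (fun hi1 => by
    have : b i < b (i + 1) := hB.strictMono ⟨hi1, hi.le⟩ ⟨by omega, by omega⟩ (by omega)
    have : (b i : ℚ) < b (i + 1) := by exact_mod_cast this
    gcongr) (fun _ => le_rfl) j).1 hj.ge
  rw [← heq, dvd_mul_charGcd_iff] at h1
  have h2 := h1 (i + 1) le_rfl
  have hne := HahnSeries.coeff_orderTop_ne hj
  rw [coeff_twist_sub_self] at hne
  apply left_ne_zero_of_mul hne
  rw [sub_eq_zero, chr_div_eq_one_iff hB.pos]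
  exact h2

end IsBranch

end

end PlaneBranch

/-! ### Counting conjugation invariant families ball by ball. -/

namespace PlaneBranch

noncomputable section

open Polynomial

theorem le_orderTop_sub {a b : HQ} {h : ℚ} (ha : (h : WithTop ℚ) ≤ a.orderTop)
    (hb : (h : WithTop ℚ) ≤ b.orderTop) : (h : WithTop ℚ) ≤ (a - b).orderTop := by
  rw [le_orderTop_iff] at *
  intro q hq
  rw [HahnSeries.coeff_sub, ha q hq, hb q hq, sub_zero]

/-- Ultrametric inequality: every point of a ball is a center of it. -/
theorem le_orderTop_sub_congr {a b c : HQ} {h : ℚ} (hab : (h : WithTop ℚ) ≤ (a - b).orderTop) :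
    (h : WithTop ℚ) ≤ (a - c).orderTop ↔ (h : WithTop ℚ) ≤ (b - c).orderTop := by
  constructor
  · intro hac
    simpa using le_orderTop_sub hac hab
  · intro hbc
    rw [← HahnSeries.orderTop_neg] at hbc
    simpa using le_orderTop_sub hab hbc

theorem ballCount_congr (s : Multiset HQ) {a b : HQ} {h : ℚ}
    (hab : (h : WithTop ℚ) ≤ (a - b).orderTop) : ballCount s a h = ballCount s b h := by
  unfold ballCount
  congr 1
  refine Multiset.filter_congr fun x _ => ?_
  rw [← HahnSeries.orderTop_neg, neg_sub, le_orderTop_sub_congr hab, ← HahnSeries.orderTop_neg,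
    neg_sub]

theorem sum_card_filter {ι α : Type*} (S : Finset ι) (s : Multiset α) (p : ι → α → Prop)
    [∀ i, DecidablePred (p i)] [∀ a, DecidablePred (p · a)] :
    ∑ i ∈ S, (s.filter (p i)).card = (s.map fun a => (S.filter (p · a)).card).sum := by
  classical
  induction s using Multiset.induction_on with
  | empty => simp
  | cons a s ih =>
    rw [Multiset.map_cons, Multiset.sum_cons, ← ih, Finset.card_filter, ← Finset.sum_add_distrib]
    refine Finset.sum_congr rfl fun i _ => ?_
    rw [Multiset.filter_cons, Multiset.card_add]
    split_ifs <;> simp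

theorem map_twist_nat {s : Multiset HQ} (hs : s.map (twist 1) = s) (j : ℕ) :
    s.map (twist (j : ℤ)) = s := by
  induction j with
  | zero => simp [twist_zero]
  | succ j ih =>
    have : (twist ((j + 1 : ℕ) : ℤ) : HQ → HQ) = twist (j : ℤ) ∘ twist 1 := by
      ext1 a
      rw [Function.comp_apply, ← twist_add]
      push_cast
      rfl
    rw [this, ← Multiset.map_map, hs, ih]

theorem ballCount_twist {s : Multiset HQ} (hs : s.map (twist 1) = s) (j : ℕ) (γ : HQ) (h : ℚ) :
    ballCount s (twist (j : ℤ) γ) h = ballCount s γ h := by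
  conv_lhs => rw [← map_twist_nat hs j]
  unfold ballCount
  rw [Multiset.filter_map, Multiset.card_map]
  congr 1
  refine Multiset.filter_congr fun x _ => ?_
  rw [Function.comp_apply, ← map_sub, orderTop_twist]

/-- The contact of `α` with some conjugate of `γ` is at least `h`. -/
def IsNear (γ : HQ) (h : ℚ) (α : HQ) : Prop :=
  ∃ j : ℤ, (h : WithTop ℚ) ≤ (α - twist j γ).orderTop

theorem IsNear.mono {γ : HQ} {h h' : ℚ} {α : HQ} (hh : h' ≤ h) (hα : IsNear γ h α) :
    IsNear γ h' α := by
  obtain ⟨j, hj⟩ := hα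
  exact ⟨j, le_trans (by exact_mod_cast hh) hj⟩

theorem isNear_twist_iff {γ : HQ} {h : ℚ} {α : HQ} (i : ℤ) :
    IsNear γ h (twist i α) ↔ IsNear γ h α := by
  constructor
  · rintro ⟨j, hj⟩
    refine ⟨j - i, ?_⟩
    rwa [← orderTop_twist i, map_sub, ← twist_add, add_sub_cancel]
  · rintro ⟨j, hj⟩
    refine ⟨i + j, ?_⟩
    rwa [twist_add, ← map_sub, orderTop_twist]

/-- If `α` is near one conjugate, the conjugates near `α` are those in the ball of that conjugate,
and `le_orderTop_twist_sub_iff` identifies them by a congruence with `l_i` solutions. -/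
theorem IsBranch.card_filter_near {N : ℕ} {γ : HQ} {g : ℕ} {b : ℕ → ℕ} (hB : IsBranch N γ g b)
    {i : ℕ} (hi : i ≤ g) {h : ℚ} (h1 : 1 ≤ i → (b i : ℚ) / N < h)
    (h2 : i < g → h ≤ (b (i + 1) : ℚ) / N) (α : HQ) [Decidable (IsNear γ h α)] :
    ((Finset.range N).filter fun j : ℕ =>
      (h : WithTop ℚ) ≤ (α - twist (j : ℤ) γ).orderTop).card =
        if IsNear γ h α then charGcd b i else 0 := by
  classical
  have hNZ : (0 : ℤ) < N := by exact_mod_cast hB.pos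
  split_ifs with hα
  · obtain ⟨j₀, hj₀⟩ := hα
    obtain ⟨r, hr⟩ := Int.eq_ofNat_of_zero_le (Int.emod_nonneg j₀ hNZ.ne')
    have hr' : twist j₀ γ = twist (r : ℤ) γ := by
      rw [twist_eq_twist_iff, hB.twist_iff, ← hr]
      exact Int.dvd_self_sub_emod
    rw [hr'] at hj₀
    have key : ∀ j : ℕ, (h : WithTop ℚ) ≤ (α - twist (j : ℤ) γ).orderTop ↔
        (N : ℤ) ∣ ((j : ℤ) - r) * charGcd b i := by
      intro j
      rw [le_orderTop_sub_congr hj₀, orderTop_twist_sub_twist,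
        hB.le_orderTop_twist_sub_iff hi h1 h2, ← dvd_neg, ← neg_mul, neg_sub]
    simp only [key]
    -- The condition is periodic in `j`, so the window `0, ..., N-1` may be moved to start at `r`.
    set p : ℕ → Prop := fun j => (N : ℤ) ∣ ((j : ℤ) - r) * charGcd b i with hp
    have hper : Function.Periodic p N := by
      intro j
      simp only [hp, eq_iff_iff]
      have : (((j + N : ℕ) : ℤ) - r) * charGcd b i =
        ((j : ℤ) - r) * charGcd b i + N * charGcd b i := by push_cast; ring
      rw [this, dvd_add_left (dvd_mul_right _ _)]
    have h3 := Nat.filter_Ico_card_eq_of_periodic r N p hper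
    rw [← Nat.count_eq_card_filter_range p N, ← h3]
    refine Eq.trans ?_ (hB.card_filter_dvd i)
    refine Finset.card_bij' (fun j _ => j - r) (fun j _ => r + j) ?_ ?_ ?_ ?_
    · intro j hj
      simp only [Finset.mem_filter, Finset.mem_Ico, Finset.mem_range, hp] at hj ⊢
      refine ⟨by omega, ?_⟩
      rw [Nat.cast_sub hj.1.1]
      exact hj.2
    · intro j hj
      simp only [Finset.mem_filter, Finset.mem_Ico, Finset.mem_range, hp] at hj ⊢
      refine ⟨by omega, ?_⟩
      push_cast
      rw [add_sub_cancel_left]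
      exact hj.2
    · intro j hj
      simp only [Finset.mem_filter, Finset.mem_Ico] at hj
      show r + (j - r) = j
      omega
    · intro j hj
      show r + j - r = j
      omega
  · rw [Finset.card_eq_zero, Finset.filter_eq_empty_iff]
    intro j _ hj
    exact hα ⟨j, hj⟩

open Classical in
/-- Counting the members of a conjugation invariant multiset near the branch ball by ball. -/
theorem IsBranch.mul_ballCount {N : ℕ} {γ : HQ} {g : ℕ} {b : ℕ → ℕ} (hB : IsBranch N γ g b)
    {i : ℕ} (hi : i ≤ g) {h : ℚ} (h1 : 1 ≤ i → (b i : ℚ) / N < h)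
    (h2 : i < g → h ≤ (b (i + 1) : ℚ) / N) {s : Multiset HQ} (hs : s.map (twist 1) = s) :
    N * ballCount s γ h = charGcd b i * (s.filter (IsNear γ h)).card := by
  -- Double counting of the pairs of a conjugate of `γ` and a member of `s` in its ball.
  have h3 := sum_card_filter (Finset.range N) s
    fun (j : ℕ) a => (h : WithTop ℚ) ≤ (a - twist (j : ℤ) γ).orderTop
  simp only [hB.card_filter_near hi h1 h2] at h3
  have h4 : ∀ j ∈ Finset.range N, (s.filter fun a =>
      (h : WithTop ℚ) ≤ (a - twist (j : ℤ) γ).orderTop).card = ballCount s γ h := by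
    intro j _
    rw [← ballCount_twist hs j]
    unfold ballCount
    congr
  rw [Finset.sum_congr rfl h4, Finset.sum_const, Finset.card_range, smul_eq_mul] at h3
  rw [h3]
  clear h3 h4 hs
  induction s using Multiset.induction_on with
  | empty => simp
  | cons a s ih =>
    rw [Multiset.map_cons, Multiset.sum_cons, ih, Multiset.filter_cons, Multiset.card_add]
    split_ifs <;> simp [mul_add]

theorem splits_of_map_twist {Q : HQ[X]} (hQ : Q.map (twist 1) = Q) : Q.Splits :=
  (splits_of_coeff_mem_pui fun i => mem_pui.2 ⟨1, by
    conv_rhs => rw [← hQ]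
    rw [coeff_map]
    rfl⟩).1

theorem roots_map_twist {Q : HQ[X]} (hQ : Q.map (twist 1) = Q) :
    Q.roots.map (twist 1) = Q.roots := by
  conv_rhs => rw [← hQ]
  exact ((splits_of_map_twist hQ).roots_map (twist 1)).symm

end

end PlaneBranch

/-! ### Newton iteration towards the approximate root. -/

namespace PlaneBranch

noncomputable section

open Polynomial

instance : CharZero HQ :=
  charZero_of_injective_ringHom (f := (HahnSeries.C : ℂ →+* HQ)) HahnSeries.C_injective

/-- `q` is a monic conjugation invariant polynomial of degree `d` whose initial form on the ball
is `c * X`, of weight `B`. -/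
structure IsAdapted (lam : HQ) (H : ℚ) (d : ℕ) (B : ℚ) (c : ℂ) (q : HQ[X]) : Prop where
  monic : q.Monic
  natDegree : q.natDegree = d
  map_twist : q.map (twist 1) = q
  init : HasInit (q.comp (ballVar lam H)) B (C c * X)

section Pow

variable {K : Type*} [Field K]

theorem natDegree_pow_sub_pow_le {q u : K[X]} {d e : ℕ} (hq : q.natDegree ≤ d)
    (hu : u.natDegree ≤ e) (hed : e ≤ d) {i : ℕ} (hi : 1 ≤ i) :
    (q ^ i - (q + u) ^ i).natDegree ≤ e + (i - 1) * d := by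
  rw [← geom_sum₂_mul q (q + u) i, sub_add_cancel_left, mul_comm, neg_mul, natDegree_neg]
  refine natDegree_mul_le_of_le hu (natDegree_sum_le_of_forall_le _ _ fun j hj => ?_)
  rw [Finset.mem_range] at hj
  have hqu : (q + u).natDegree ≤ d := natDegree_add_le_of_degree_le hq (hu.trans hed)
  refine (natDegree_mul_le_of_le (natDegree_pow_le_of_le j hq)
    (natDegree_pow_le_of_le (i - 1 - j) hqu)).trans (le_of_eq ?_)
  rw [← add_mul]
  congr 1
  omega

/-- The error beyond first order is divisible by `u²`, whence the two summands `e`. -/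
theorem natDegree_newton_error_le {q u : K[X]} {d e p : ℕ} (hq : q.natDegree ≤ d)
    (hu : u.natDegree ≤ e) (hed : e ≤ d) :
    ((q + u) ^ p - q ^ p - (p : K[X]) * q ^ (p - 1) * u).natDegree ≤ e + (e + (p - 2) * d) := by
  have h1 : (q + u) ^ p - q ^ p - (p : K[X]) * q ^ (p - 1) * u =
      -(u * ∑ i ∈ Finset.range p, (q ^ i - (q + u) ^ i) * q ^ (p - 1 - i)) := by
    have h2 := geom_sum₂_mul (q + u) q p
    rw [add_sub_cancel_left] at h2
    have h3 : ∑ i ∈ Finset.range p, q ^ i * q ^ (p - 1 - i) = (p : K[X]) * q ^ (p - 1) := by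
      rw [Finset.sum_congr rfl (g := fun _ => q ^ (p - 1)) fun i hi => by
        rw [Finset.mem_range] at hi
        rw [← pow_add]
        congr 1
        omega]
      simp
    simp only [sub_mul, Finset.sum_sub_distrib]
    rw [← h2, h3]
    ring
  rw [h1, natDegree_neg]
  refine natDegree_mul_le_of_le hu (natDegree_sum_le_of_forall_le _ _ fun i hi => ?_)
  rw [Finset.mem_range] at hi
  rcases Nat.eq_zero_or_pos i with rfl | hi0
  · simp
  refine (natDegree_mul_le_of_le (natDegree_pow_sub_pow_le hq hu hed hi0)
    (natDegree_pow_le_of_le (p - 1 - i) hq)).trans (le_of_eq ?_)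
  rw [add_assoc, ← add_mul]
  congr 2
  omega

/-- In `q^p - q'^p = (q - q') * Σ`, the sum has coefficient `p ≠ 0` in degree `(p-1) d`. So if `q ≠
q'`, the product has too large a degree. -/
theorem approximateRoot_unique [CharZero K] {f q q' : K[X]} {d p : ℕ} (hp : p ≠ 0)
    (hq : q.Monic) (hqd : q.natDegree = d) (hq' : q'.Monic) (hqd' : q'.natDegree = d)
    (h : (f - q ^ p).degree < ((p - 1) * d : ℕ)) (h' : (f - q' ^ p).degree < ((p - 1) * d : ℕ)) :
    q = q' := by
  by_contra hne
  have h1 : (q ^ p - q' ^ p).degree < ((p - 1) * d : ℕ) := by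
    have : q ^ p - q' ^ p = (f - q' ^ p) - (f - q ^ p) := by ring
    rw [this]
    exact (degree_sub_le _ _).trans_lt (max_lt h' h)
  have h2 : (((p - 1) * d : ℕ) : WithBot ℕ) ≤
      (∑ i ∈ Finset.range p, q ^ i * q' ^ (p - 1 - i)).degree := by
    apply le_degree_of_ne_zero
    rw [finsetSum_coeff, Finset.sum_congr rfl (g := fun _ => (1 : K)) fun i hi => by
      rw [Finset.mem_range] at hi
      have hm := (hq.pow i).mul (hq'.pow (p - 1 - i))
      have hd : (q ^ i * q' ^ (p - 1 - i)).natDegree = (p - 1) * d := by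
        rw [(hq.pow i).natDegree_mul (hq'.pow _), hq.natDegree_pow, hq'.natDegree_pow, hqd, hqd',
          ← add_mul]
        congr 1
        omega
      rw [← hd]
      exact hm]
    simpa using hp
  rw [← geom_sum₂_mul, degree_mul] at h1
  have h3 : (0 : WithBot ℕ) ≤ (q - q').degree := zero_le_degree_iff.2 (sub_ne_zero.2 hne)
  exact absurd h1 (not_lt.2 (h2.trans (le_add_of_nonneg_right h3)))

end Pow

section Step

variable {lam : HQ} {H : ℚ} {d p : ℕ} {B : ℚ} {c : ℂ} {f q : HQ[X]} {Ff : ℂ[X]}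

/-- By `hdeg` a small degree forces an initial form of small degree. The quotient has degree below
`d`, so its form is a constant. If its weight were at most `B`, the remainder would have `z^(p-1)`
in its form, hence degree at least `(p-1) d`, which a remainder has not. -/
theorem IsAdapted.hasInit_quotient (hq : IsAdapted lam H d B c q) (hd : 0 < d) (hp : 2 ≤ p)
    (hc : c ≠ 0)
    (hdeg : ∀ (Q : HQ[X]) (A : ℚ) (F : ℂ[X]), Q.map (twist 1) = Q →
      HasInit (Q.comp (ballVar lam H)) A F → F ≠ 0 → d * F.natDegree ≤ Q.natDegree)
    (hft : f.map (twist 1) = f)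
    (hfI : HasInit (f.comp (ballVar lam H)) (p * B) Ff)
    (hFf : (Ff - (C c * X) ^ p).degree < ((p - 1 : ℕ) : WithBot ℕ))
    (hr : ((f - q ^ p) /ₘ q ^ (p - 1)).natDegree < d) :
    HasInit (((f - q ^ p) /ₘ q ^ (p - 1)).comp (ballVar lam H)) B 0 := by
  have hDm : (q ^ (p - 1)).Monic := hq.monic.pow _
  have hDd : (q ^ (p - 1)).natDegree = (p - 1) * d := by
    rw [hq.monic.natDegree_pow, hq.natDegree]
  have hEt : (f - q ^ p).map (twist 1) = f - q ^ p := by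
    rw [Polynomial.map_sub, Polynomial.map_pow, hft, hq.map_twist]
  have hDt : (q ^ (p - 1)).map (twist 1) = q ^ (p - 1) := by
    rw [Polynomial.map_pow, hq.map_twist]
  have hrt : ((f - q ^ p) /ₘ q ^ (p - 1)).map (twist 1) = (f - q ^ p) /ₘ q ^ (p - 1) := by
    rw [map_divByMonic _ hDm, hEt, hDt]
  have hst : ((f - q ^ p) %ₘ q ^ (p - 1)).map (twist 1) = (f - q ^ p) %ₘ q ^ (p - 1) := by
    rw [map_modByMonic _ hDm, hEt, hDt]
  have hsd : ((f - q ^ p) %ₘ q ^ (p - 1)).natDegree < (p - 1) * d := by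
    rw [← hDd]
    refine natDegree_modByMonic_lt _ hDm fun h => ?_
    rw [h, natDegree_one] at hDd
    have : 0 < (p - 1) * d := Nat.mul_pos (by omega) hd
    omega
  have hdiv := modByMonic_add_div (f - q ^ p) (q ^ (p - 1))
  set E := f - q ^ p with hE
  set r := E /ₘ q ^ (p - 1) with hrdef
  set s := E %ₘ q ^ (p - 1) with hsdef
  by_cases hr0 : r = 0
  · rw [hr0, zero_comp]
    exact HasInit.zero B
  obtain ⟨ρ, R, hR0, -, hRI⟩ := exists_hasInit_of_splits (splits_of_map_twist hrt) hr0 lam H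
  have hRd : R.natDegree = 0 := by
    have := hdeg r ρ R hrt hRI hR0
    by_contra h
    have : d * 1 ≤ d * R.natDegree := Nat.mul_le_mul_left d (Nat.pos_of_ne_zero h)
    omega
  rcases lt_or_ge B ρ with hlt | hle
  · exact hRI.of_lt hlt
  exfalso
  have hEI : HasInit (E.comp (ballVar lam H)) (p * B) (Ff - (C c * X) ^ p) := by
    rw [hE, sub_comp, pow_comp]
    exact hfI.sub (hq.init.pow p)
  have hpB : (p : ℚ) * B = B + (p - 1 : ℕ) * B := by
    rw [Nat.cast_sub (by omega)]
    push_cast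
    ring
  -- The weight of the quotient is below or equal to `B`. In the first case `f - q^p` contributes
  -- nothing in the relevant weight, in the second a form of degree below `p - 1`.
  obtain ⟨D, hDI, hDdeg⟩ : ∃ D : ℂ[X],
      HasInit (E.comp (ballVar lam H)) (ρ + (p - 1 : ℕ) * B) D ∧
        D.degree < ((p - 1 : ℕ) : WithBot ℕ) := by
    rcases hle.lt_or_eq with h | h
    · refine ⟨0, hEI.of_lt ?_, ?_⟩
      · rw [hpB]
        exact add_lt_add_left h _
      · rw [degree_zero]
        exact WithBot.bot_lt_coe _
    · refine ⟨_, ?_, hFf⟩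
      rwa [h, ← hpB]
  have hsI : HasInit (s.comp (ballVar lam H)) (ρ + (p - 1 : ℕ) * B)
      (D - R * (C c * X) ^ (p - 1)) := by
    have : s = E - r * q ^ (p - 1) := by rw [← hdiv]; ring
    rw [this, sub_comp, mul_comp, pow_comp]
    exact hDI.sub (hRI.mul (hq.init.pow _))
  have hcoef : (D - R * (C c * X) ^ (p - 1)).coeff (p - 1) ≠ 0 := by
    rw [coeff_sub, coeff_eq_zero_of_degree_lt hDdeg, zero_sub, neg_ne_zero,
      eq_C_of_natDegree_eq_zero hRd, coeff_C_mul, mul_pow, ← C_pow, coeff_C_mul, coeff_X_pow,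
      if_pos rfl, mul_one]
    refine mul_ne_zero ?_ (pow_ne_zero _ hc)
    intro h
    apply hR0
    rw [eq_C_of_natDegree_eq_zero hRd, h, C_0]
  have h1 := hdeg s _ _ hst hsI fun h => hcoef (by rw [h, coeff_zero])
  have h2 : d * (p - 1) ≤ d * (D - R * (C c * X) ^ (p - 1)).natDegree :=
    Nat.mul_le_mul_left d (le_natDegree_of_ne_zero hcoef)
  rw [mul_comm] at hsd
  omega

/-- One Newton step `q + r/p`, with `r` the quotient of `f - q^p` by `q^(p-1)`. The new difference
is the remainder minus an error of second order in `r`, both of degree below that of `f - q^p`; the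
initial form survives by `hasInit_quotient`. -/
theorem IsAdapted.exists_degree_lt (hq : IsAdapted lam H d B c q) (hd : 0 < d) (hp : 2 ≤ p)
    (hc : c ≠ 0)
    (hdeg : ∀ (Q : HQ[X]) (A : ℚ) (F : ℂ[X]), Q.map (twist 1) = Q →
      HasInit (Q.comp (ballVar lam H)) A F → F ≠ 0 → d * F.natDegree ≤ Q.natDegree)
    (hfm : f.Monic) (hfd : f.natDegree = d * p) (hft : f.map (twist 1) = f)
    (hfI : HasInit (f.comp (ballVar lam H)) (p * B) Ff)
    (hFf : (Ff - (C c * X) ^ p).degree < ((p - 1 : ℕ) : WithBot ℕ))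
    (hE : (((p - 1) * d : ℕ) : WithBot ℕ) ≤ (f - q ^ p).degree) :
    ∃ q', IsAdapted lam H d B c q' ∧ (f - q' ^ p).degree < (f - q ^ p).degree := by
  have hDm : (q ^ (p - 1)).Monic := hq.monic.pow _
  have hDd : (q ^ (p - 1)).natDegree = (p - 1) * d := by
    rw [hq.monic.natDegree_pow, hq.natDegree]
  have hDdeg : (q ^ (p - 1)).degree = ((p - 1) * d : ℕ) := by
    rw [degree_eq_natDegree hDm.ne_zero, hDd]
  have hsum := degree_add_divByMonic (p := f - q ^ p) hDm (by rw [hDdeg]; exact hE)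
  have hsdeg := degree_modByMonic_lt (f - q ^ p) hDm
  have hdiv := modByMonic_add_div (f - q ^ p) (q ^ (p - 1))
  have hpd : d * p = (p - 1) * d + d := by
    obtain ⟨p, rfl⟩ := Nat.exists_eq_add_of_le hp
    rw [show 2 + p - 1 = p + 1 by omega]
    ring
  have hElt : (f - q ^ p).degree < ((d * p : ℕ) : WithBot ℕ) := by
    have hqp : (q ^ p).degree = ((d * p : ℕ) : WithBot ℕ) := by
      rw [degree_eq_natDegree (hq.monic.pow p).ne_zero, hq.monic.natDegree_pow, hq.natDegree,
        mul_comm]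
    have hfp : f.degree = ((d * p : ℕ) : WithBot ℕ) := by
      rw [degree_eq_natDegree hfm.ne_zero, hfd]
    rw [← hfp]
    exact degree_sub_lt_left (hfp.trans hqp.symm) hfm.ne_zero
      (hfm.leadingCoeff.trans (hq.monic.pow p).leadingCoeff.symm)
  have hE0 : f - q ^ p ≠ 0 := by
    intro h
    rw [h, degree_zero] at hE
    exact absurd hE (not_le.2 (WithBot.bot_lt_coe _))
  have hr0 : (f - q ^ p) /ₘ q ^ (p - 1) ≠ 0 := by
    intro h
    rw [h, degree_zero, WithBot.add_bot] at hsum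
    exact hE0 (degree_eq_bot.1 hsum.symm)
  have hrd : ((f - q ^ p) /ₘ q ^ (p - 1)).natDegree < d := by
    rw [← hsum, hDdeg, degree_eq_natDegree hr0] at hElt
    have : (p - 1) * d + ((f - q ^ p) /ₘ q ^ (p - 1)).natDegree < d * p := by exact_mod_cast hElt
    omega
  have hrI := hq.hasInit_quotient hd hp hc hdeg hft hfI hFf hrd
  have hrt : ((f - q ^ p) /ₘ q ^ (p - 1)).map (twist 1) = (f - q ^ p) /ₘ q ^ (p - 1) := by
    rw [map_divByMonic _ hDm, Polynomial.map_sub, Polynomial.map_pow, Polynomial.map_pow, hft,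
      hq.map_twist]
  set r := (f - q ^ p) /ₘ q ^ (p - 1) with hrdef
  set s := (f - q ^ p) %ₘ q ^ (p - 1) with hsdef
  have hp0 : (p : HQ) ≠ 0 := by
    have : p ≠ 0 := by omega
    exact_mod_cast this
  have hrI' : HasInit ((C ((p : HQ)⁻¹) * r).comp (ballVar lam H)) B 0 := by
    have h1 : (p : HQ)⁻¹ = HahnSeries.C ((p : ℂ)⁻¹) := by
      rw [map_inv₀, map_natCast]
    have h2 : HasInit (C ((p : HQ)⁻¹)) 0 (C (((p : HQ)⁻¹).coeff 0)) :=
      HasInit.const fun q hq => by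
        rw [h1]
        exact HahnSeries.coeff_single_of_ne hq.ne
    rw [mul_comp, C_comp]
    simpa using h2.mul hrI
  have hud : (C ((p : HQ)⁻¹) * r).natDegree = r.natDegree :=
    natDegree_C_mul (inv_ne_zero hp0)
  have hut : (C ((p : HQ)⁻¹) * r).map (twist 1) = C ((p : HQ)⁻¹) * r := by
    rw [Polynomial.map_mul, hrt, map_C, map_inv₀, map_natCast]
  have hpu : (p : HQ[X]) * (C ((p : HQ)⁻¹) * r) = r := by
    rw [← mul_assoc, ← C_eq_natCast, ← C_mul, mul_inv_cancel₀ hp0, C_1, one_mul]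
  set u := C ((p : HQ)⁻¹) * r with hu
  have huq : u.degree < q.degree := degree_lt_degree (by rw [hud, hq.natDegree]; exact hrd)
  refine ⟨q + u, ⟨hq.monic.add_of_left huq, ?_, ?_, ?_⟩, ?_⟩
  · rw [natDegree_add_eq_left_of_degree_lt huq, hq.natDegree]
  · rw [Polynomial.map_add, hq.map_twist, hut]
  · rw [add_comp]
    simpa using hq.init.add hrI'
  · have hid : f - (q + u) ^ p = s - ((q + u) ^ p - q ^ p - (p : HQ[X]) * q ^ (p - 1) * u) := by
      have h1 : (p : HQ[X]) * q ^ (p - 1) * u = q ^ (p - 1) * r := by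
        rw [← hpu]; ring
      have h2 : s = (f - q ^ p) - q ^ (p - 1) * r := by rw [← hdiv]; ring
      rw [h1, h2]
      ring
    rw [hid]
    refine (degree_sub_le _ _).trans_lt (max_lt ?_ ?_)
    · exact hsdeg.trans_le (by rw [hDdeg]; exact hE)
    · have h1 := natDegree_newton_error_le (p := p) hq.natDegree.le hud.le hrd.le
      refine (degree_le_natDegree).trans_lt ?_
      rw [← hsum, hDdeg, degree_eq_natDegree hr0]
      have h2 : (p - 1) * d = (p - 2) * d + d := by
        obtain ⟨p, rfl⟩ := Nat.exists_eq_add_of_le hp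
        rw [show 2 + p - 1 = p + 1 by omega, show 2 + p - 2 = p by omega]
        ring
      exact_mod_cast (by omega : ((q + u) ^ p - q ^ p - (p : HQ[X]) * q ^ (p - 1) * u).natDegree <
        (p - 1) * d + r.natDegree)

theorem IsAdapted.exists_approximateRoot (hq : IsAdapted lam H d B c q) (hd : 0 < d) (hp : 2 ≤ p)
    (hc : c ≠ 0)
    (hdeg : ∀ (Q : HQ[X]) (A : ℚ) (F : ℂ[X]), Q.map (twist 1) = Q →
      HasInit (Q.comp (ballVar lam H)) A F → F ≠ 0 → d * F.natDegree ≤ Q.natDegree)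
    (hfm : f.Monic) (hfd : f.natDegree = d * p) (hft : f.map (twist 1) = f)
    (hfI : HasInit (f.comp (ballVar lam H)) (p * B) Ff)
    (hFf : (Ff - (C c * X) ^ p).degree < ((p - 1 : ℕ) : WithBot ℕ)) :
    ∃ q', IsAdapted lam H d B c q' ∧ (f - q' ^ p).degree < (((p - 1) * d : ℕ) : WithBot ℕ) := by
  induction hn : (f - q ^ p).degree using WellFoundedLT.induction generalizing q with
  | ind n ih =>
    by_cases hE : (f - q ^ p).degree < (((p - 1) * d : ℕ) : WithBot ℕ)
    · exact ⟨q, hq, hE⟩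
    obtain ⟨q', hq', hlt⟩ :=
      hq.exists_degree_lt hd hp hc hdeg hfm hfd hft hfI hFf (not_lt.1 hE)
    exact ih _ (hn ▸ hlt) hq' rfl

end Step

end

end PlaneBranch

/-! ### The truncated branch and the initial forms on its ball. -/

namespace PlaneBranch

noncomputable section

open Polynomial

theorem prod_range_mul_comm {M : Type*} [CommMonoid M] (F : ℕ → M) (d p : ℕ) :
    ∏ m ∈ Finset.range (d * p), F m =
      ∏ t ∈ Finset.range p, ∏ j ∈ Finset.range d, F (d * t + j) := by
  induction p with
  | zero => simp
  | succ p ih => rw [mul_add, mul_one, Finset.prod_range_add, ih, Finset.prod_range_succ]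

/-- A factor of weight below the radius is insensitive to moving its root by a series of order at
least the radius. -/
theorem hasInit_X_sub_C_congr {lam u v : HQ} {H o : ℚ} {F : ℂ[X]}
    (hv : HasInit ((X - C v : HQ[X]).comp (ballVar lam H)) o F) (ho : o < H)
    (huv : (H : WithTop ℚ) ≤ (v - u).orderTop) :
    HasInit ((X - C u : HQ[X]).comp (ballVar lam H)) o F := by
  have h1 := hv.add ((HasInit.const (le_orderTop_iff.1 huv)).of_lt ho)
  rw [add_zero] at h1
  convert h1 using 1
  simp only [sub_comp, X_comp, C_comp, C_sub]
  ring

theorem map_twist_prod_conjugates {lam : HQ} {d : ℕ} (h : twist (d : ℤ) lam = lam) :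
    (∏ j ∈ Finset.range d, (X - C (twist (j : ℤ) lam))).map (twist 1) =
      ∏ j ∈ Finset.range d, (X - C (twist (j : ℤ) lam)) := by
  rw [Polynomial.map_prod]
  have h1 : ∀ j ∈ Finset.range d, (X - C (twist (j : ℤ) lam)).map (twist 1) =
      X - C (twist ((j + 1 : ℕ) : ℤ) lam) := fun j _ => by
    rw [Polynomial.map_sub, map_X, map_C, ← twist_add]
    push_cast
    rw [add_comm]
  rw [Finset.prod_congr rfl h1]
  rcases d with - | d
  · simp
  rw [Finset.prod_range_succ, h, Finset.prod_range_succ', Nat.cast_zero, twist_zero]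

theorem charQuot_mul (b : ℕ → ℕ) (i : ℕ) :
    charQuot b (i + 1) * charGcd b (i + 1) = charGcd b i := by
  rw [charQuot, Nat.add_sub_cancel]
  exact Nat.div_mul_cancel (by rw [charGcd_succ]; exact Nat.gcd_dvd_left _ _)

namespace IsBranch

variable {N : ℕ} {γ : HQ} {g : ℕ} {b : ℕ → ℕ}

theorem two_le_charQuot (hB : IsBranch N γ g b) {i : ℕ} (hi : i < g) : 2 ≤ charQuot b (i + 1) := by
  have h1 := charQuot_mul b i
  have h2 := hB.charGcd_succ_ne hi
  have h3 := (hB.charGcd_dvd_pos i).2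
  rcases h : charQuot b (i + 1) with - | - | n
  · rw [h] at h1; omega
  · rw [h] at h1; omega
  · omega

theorem div_lt_div (hB : IsBranch N γ g b) {i : ℕ} (hi : i < g) (hi1 : 1 ≤ i) :
    (b i : ℚ) / N < (b (i + 1) : ℚ) / N := by
  have hN : (0 : ℚ) < N := by exact_mod_cast hB.pos
  have : b i < b (i + 1) := hB.strictMono ⟨hi1, hi.le⟩ ⟨by omega, by omega⟩ (by omega)
  have : (b i : ℚ) < b (i + 1) := by exact_mod_cast this
  gcongr

/-- With `d = N / l_i`, the number `N` divides `d j b_{i+1}` iff `l_i` divides `j l_{i+1}`, that is,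
iff `n_{i+1}` divides `j`. -/
theorem isPrimitiveRoot_chr (hB : IsBranch N γ g b) {i : ℕ} :
    IsPrimitiveRoot (chr ((N / charGcd b i : ℕ) : ℤ) ((b (i + 1) : ℚ) / N))
      (charQuot b (i + 1)) := by
  obtain ⟨⟨d, hd⟩, hl⟩ := hB.charGcd_dvd_pos i
  have hl' := (hB.charGcd_dvd_pos (i + 1)).2
  have hd' : N / charGcd b i = d := by rw [hd]; exact Nat.mul_div_cancel_left d hl
  have hd0 : 0 < d := Nat.pos_of_ne_zero fun h => by
    have := hB.pos
    rw [hd, h] at this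
    simp at this
  have key : ∀ j : ℕ, chr ((N / charGcd b i : ℕ) : ℤ) ((b (i + 1) : ℚ) / N) ^ j = 1 ↔
      charQuot b (i + 1) ∣ j := by
    intro j
    rw [← chr_natCast_mul, chr_div_eq_one_iff hB.pos, hd']
    have h1 : (N : ℤ) ∣ ((d * j : ℕ) : ℤ) * b (i + 1) ↔ N ∣ d * j * b (i + 1) := by
      exact_mod_cast Iff.rfl
    have h2 : d * j * b (i + 1) = d * (j * b (i + 1)) := by ring
    have h3 : charGcd b i ∣ j * b (i + 1) ↔ charGcd b i ∣ j * charGcd b (i + 1) := by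
      rw [charGcd_succ, ← Nat.gcd_mul_left, Nat.dvd_gcd_iff]
      exact ⟨fun h => ⟨dvd_mul_left _ _, h⟩, fun h => h.2⟩
    rw [h1, h2, hd, mul_comm (charGcd b i) d, Nat.mul_dvd_mul_iff_left hd0, h3]
    rw [← charQuot_mul b i, Nat.mul_dvd_mul_iff_right hl']
  rw [IsPrimitiveRoot.iff_def]
  exact ⟨(key _).2 dvd_rfl, fun l hl => (key l).1 hl⟩

/-- Since `l_i = n_{i+1} l_{i+1}`, the exponents run through `l_{i+1}` full periods of the root of
unity. -/
theorem prod_X_sub_C_pow (hB : IsBranch N γ g b) (i : ℕ) (a : ℂ) :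
    ∏ t ∈ Finset.range (charGcd b i), (X - C (chr ((N / charGcd b i : ℕ) : ℤ)
      ((b (i + 1) : ℚ) / N) ^ t * a)) =
      (X ^ charQuot b (i + 1) - C (a ^ charQuot b (i + 1))) ^ charGcd b (i + 1) := by
  have hω := hB.isPrimitiveRoot_chr (i := i)
  have hn : 0 < charQuot b (i + 1) := Nat.pos_of_ne_zero fun h => by
    have := charQuot_mul b i
    rw [h, zero_mul] at this
    exact absurd this (hB.charGcd_dvd_pos i).2.ne
  set ω := chr ((N / charGcd b i : ℕ) : ℤ) ((b (i + 1) : ℚ) / N)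
  conv_lhs => rw [← charQuot_mul b i, prod_range_mul_comm]
  rw [X_pow_sub_C_eq_prod hω hn rfl, ← Finset.card_range (charGcd b (i + 1)),
    ← Finset.prod_const, Finset.card_range]
  refine Finset.prod_congr rfl fun t _ => Finset.prod_congr rfl fun j _ => ?_
  rw [pow_add, pow_mul, hω.pow_eq_one, one_pow, one_mul]

/-- The truncation of the branch before a characteristic exponent, and the initial forms of its
minimal polynomial and of that of the branch on the ball of that radius. -/
theorem exists_isAdapted (hB : IsBranch N γ g b) {k : ℕ} (hk : k < g) :
    ∃ (lam : HQ) (B : ℚ) (c : ℂ) (q : HQ[X]), 0 < B ∧ c ≠ 0 ∧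
      (((b (k + 1) : ℚ) / N : ℚ) : WithTop ℚ) ≤ (γ - lam).orderTop ∧
      (γ - lam).coeff ((b (k + 1) : ℚ) / N) = γ.coeff ((b (k + 1) : ℚ) / N) ∧
      IsAdapted lam ((b (k + 1) : ℚ) / N) (N / charGcd b k) B c q ∧
      HasInit ((∏ j ∈ Finset.range N, (X - C (twist (j : ℤ) γ))).comp
          (ballVar lam ((b (k + 1) : ℚ) / N))) (charGcd b k * B)
        (C (c ^ charGcd b k) * (X ^ charQuot b (k + 1) -
          C (γ.coeff ((b (k + 1) : ℚ) / N) ^ charQuot b (k + 1))) ^ charGcd b (k + 1)) := by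
  have hprod := hB.prod_X_sub_C_pow k (γ.coeff ((b (k + 1) : ℚ) / N))
  have hHpos := hB.height_pos (i := k + 1) ⟨by omega, by omega⟩
  have hiff := hB.le_orderTop_twist_sub_iff hk.le (h := (b (k + 1) : ℚ) / N)
    (hB.div_lt_div hk) (fun _ => le_rfl)
  obtain ⟨⟨d, hd⟩, hp⟩ := hB.charGcd_dvd_pos k
  have hd' : N / charGcd b k = d := by rw [hd]; exact Nat.mul_div_cancel_left d hp
  rw [hd'] at hprod ⊢
  have hd0 : 0 < d := Nat.pos_of_ne_zero fun h => by
    have := hB.pos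
    rw [hd, h] at this
    simp at this
  set H : ℚ := (b (k + 1) : ℚ) / N
  set p := charGcd b k
  have hiff' : ∀ j : ℤ, (H : WithTop ℚ) ≤ (twist j γ - γ).orderTop ↔ (d : ℤ) ∣ j := by
    intro j
    rw [hiff, hd, Nat.cast_mul, mul_comm (p : ℤ)]
    exact mul_dvd_mul_iff_right (by exact_mod_cast hp.ne')
  -- The term at `H` itself is cut off, so `lam` sits at `z = 0` of its ball while `γ` sits at its
  -- own coefficient.
  set lam : HQ := HahnSeries.truncLT H γ with hlam
  have hlamc : ∀ q < H, lam.coeff q = γ.coeff q := fun q hq =>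
    HahnSeries.coeff_truncLT_of_lt hq γ
  have hlamc' : ∀ q, H ≤ q → lam.coeff q = 0 := fun q hq =>
    HahnSeries.coeff_truncLT_of_le hq γ
  have hγlam : (H : WithTop ℚ) ≤ (γ - lam).orderTop := le_orderTop_iff.2 fun q hq => by
    rw [HahnSeries.coeff_sub, hlamc q hq, sub_self]
  have htw : ∀ j : ℤ, (H : WithTop ℚ) ≤ (twist j lam - lam).orderTop ↔ (d : ℤ) ∣ j := by
    intro j
    rw [← hiff', le_orderTop_iff, le_orderTop_iff]
    refine forall₂_congr fun q hq => ?_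
    rw [coeff_twist_sub_self, coeff_twist_sub_self, hlamc q hq]
  have hdlam : twist (d : ℤ) lam = lam := by
    rw [← sub_eq_zero]
    ext q
    rcases lt_or_ge q H with hq | hq
    · exact le_orderTop_iff.1 ((htw d).2 dvd_rfl) q hq
    · rw [coeff_twist_sub_self, hlamc' q hq, mul_zero, HahnSeries.coeff_zero]
  have hdt : ∀ (t : ℕ) (q : ℚ), q < H → chr ((d * t : ℕ) : ℤ) q * γ.coeff q = γ.coeff q := by
    intro t q hq
    have h1 := (hiff' ((d * t : ℕ) : ℤ)).2 ⟨t, by push_cast; ring⟩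
    have h2 := le_orderTop_iff.1 h1 q hq
    rw [coeff_twist_sub_self] at h2
    linear_combination h2
  have hagree : ∀ t j : ℕ, (H : WithTop ℚ) ≤
      (twist (j : ℤ) lam - twist ((d * t + j : ℕ) : ℤ) γ).orderTop := by
    intro t j
    rw [le_orderTop_iff]
    intro q hq
    rw [HahnSeries.coeff_sub, coeff_twist, coeff_twist, hlamc q hq, Nat.cast_add, chr_add_left]
    linear_combination (-chr (j : ℤ) q) * hdt t q hq
  -- The other conjugates of `lam` lie outside the ball and contribute constants `c j` of weight `o
  -- j`. These make up `c`, and together with `H` they make up `B`. Values with `j + 1 ≥ d` are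
  -- dummies.
  have hfar : ∀ j : ℕ, ∃ (o : ℚ) (c : ℂ), j + 1 < d → 0 < o ∧ o < H ∧ c ≠ 0 ∧
      HasInit ((X - C (twist ((j + 1 : ℕ) : ℤ) lam) : HQ[X]).comp (ballVar lam H)) o (C c) := by
    intro j
    by_cases hj : j + 1 < d
    swap
    · exact ⟨0, 0, fun h => absurd h hj⟩
    have hlt : ¬ (H : WithTop ℚ) ≤ (twist ((j + 1 : ℕ) : ℤ) lam - lam).orderTop := by
      rw [htw, Int.natCast_dvd_natCast]
      exact fun h => absurd (Nat.le_of_dvd (by omega) h) (by omega)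
    rw [not_le] at hlt
    obtain ⟨o, ho⟩ := WithTop.ne_top_iff_exists.1 (ne_top_of_lt hlt)
    rw [← ho, WithTop.coe_lt_coe] at hlt
    refine ⟨o, _, fun _ => ⟨?_, hlt, coeff_sub_ne_zero_of_orderTop_eq ho.symm,
      hasInit_X_sub_C_of_lt ho.symm hlt⟩⟩
    have h1 := HahnSeries.coeff_orderTop_ne ho.symm
    rw [coeff_twist_sub_self, hlamc o hlt] at h1
    have h2 : γ.orderTop ≤ o := HahnSeries.orderTop_le_of_coeff_ne_zero (right_ne_zero_of_mul h1)
    exact_mod_cast hB.orderTop_pos.trans_le h2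
  choose o c hoc using hfar
  obtain ⟨e, rfl⟩ : ∃ e, d = e + 1 := ⟨d - 1, by omega⟩
  have hoc' : ∀ j ∈ Finset.range e, 0 < o j ∧ o j < H ∧ c j ≠ 0 ∧
      HasInit ((X - C (twist ((j + 1 : ℕ) : ℤ) lam) : HQ[X]).comp (ballVar lam H)) (o j)
        (C (c j)) := fun j hj => hoc j (by rw [Finset.mem_range] at hj; omega)
  refine ⟨lam, ∑ j ∈ Finset.range e, o j + H, ∏ j ∈ Finset.range e, c j,
    ∏ j ∈ Finset.range (e + 1), (X - C (twist (j : ℤ) lam)), ?_, ?_, hγlam, ?_, ?_, ?_⟩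
  · exact add_pos_of_nonneg_of_pos (Finset.sum_nonneg fun j hj => (hoc' j hj).1.le) hHpos
  · exact Finset.prod_ne_zero_iff.2 fun j hj => (hoc' j hj).2.2.1
  · rw [HahnSeries.coeff_sub, hlamc' H le_rfl, sub_zero]
  · refine ⟨monic_prod_X_sub_C _ _, ?_, map_twist_prod_conjugates hdlam, ?_⟩
    · rw [natDegree_finsetProd_X_sub_C_eq_card, Finset.card_range]
    · rw [Finset.prod_range_succ', mul_comp, prod_comp, map_prod]
      refine (HasInit.prod _ fun j hj => (hoc' j hj).2.2.2).mul ?_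
      have := hasInit_X_sub_C_of_le (lam := lam) (a := twist ((0 : ℕ) : ℤ) lam) (h := H)
        (by simp [twist_zero])
      simpa [twist_zero] using this
  · rw [hd, mul_comm p, prod_range_mul_comm, prod_comp]
    -- The conjugates of `γ` are grouped into `p` blocks, each following the conjugates of `lam` up
    -- to order `H`. One member per block lies in the ball, at `z = ω^t a`; the others contribute
    -- the same constants as for `lam`.
    have hblock : ∀ t ∈ Finset.range p,
        HasInit ((∏ j ∈ Finset.range (e + 1),
          (X - C (twist (((e + 1) * t + j : ℕ) : ℤ) γ))).comp (ballVar lam H))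
          (∑ j ∈ Finset.range e, o j + H)
          (C (∏ j ∈ Finset.range e, c j) *
            (X - C (chr ((e + 1 : ℕ) : ℤ) H ^ t * γ.coeff H))) := by
      intro t _
      rw [Finset.prod_range_succ', mul_comp, prod_comp, map_prod]
      refine (HasInit.prod _ fun j hj => hasInit_X_sub_C_congr (hoc' j hj).2.2.2 (hoc' j hj).2.1
        (hagree t (j + 1))).mul ?_
      have h1 := hagree t 0
      rw [Nat.cast_zero, twist_zero, ← HahnSeries.orderTop_neg, neg_sub] at h1
      have h2 := hasInit_X_sub_C_of_le h1
      rw [HahnSeries.coeff_sub, hlamc' H le_rfl, sub_zero, coeff_twist, add_zero,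
        chr_natCast_mul] at h2
      exact h2
    have h3 := HasInit.prod _ hblock
    rw [Finset.sum_const, Finset.card_range, nsmul_eq_mul, Finset.prod_mul_distrib, hprod,
      Finset.prod_const, Finset.card_range, ← C_pow] at h3
    exact h3

end IsBranch

end

end PlaneBranch

/-! ### The approximate root and the roots of the jacobian in a ball. -/

namespace PlaneBranch

noncomputable section

open Polynomial

theorem map_toH_map_twist (P : Cx[X]) : (P.map toH).map (twist 1) = P.map toH := by
  rw [Polynomial.map_map, twist_comp_toH]

namespace IsBranch

variable {N : ℕ} {γ : HQ} {g : ℕ} {b : ℕ → ℕ}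

/-- The `N / l_k` conjugate balls contain equally many roots of an invariant polynomial. This
supplies the hypothesis `hdeg` of the Newton iteration. -/
theorem mul_natDegree_init_le (hB : IsBranch N γ g b) {k : ℕ} (hk : k < g) {lam : HQ}
    (hlam : (((b (k + 1) : ℚ) / N : ℚ) : WithTop ℚ) ≤ (γ - lam).orderTop)
    (Q : HQ[X]) (A : ℚ) (F : ℂ[X]) (hQ : Q.map (twist 1) = Q)
    (hI : HasInit (Q.comp (ballVar lam ((b (k + 1) : ℚ) / N))) A F) (hF : F ≠ 0) :
    N / charGcd b k * F.natDegree ≤ Q.natDegree := by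
  classical
  have hs := splits_of_map_twist hQ
  have h1 := hB.mul_ballCount hk.le (hB.div_lt_div hk) (fun _ => le_rfl) (roots_map_twist hQ)
  rw [ballCount_congr _ hlam, ← natDegree_eq_ballCount hs hF hI] at h1
  obtain ⟨⟨d, hd⟩, hp⟩ := hB.charGcd_dvd_pos k
  have hd' : N / charGcd b k = d := by rw [hd]; exact Nat.mul_div_cancel_left d hp
  have h2 : (Q.roots.filter (IsNear γ ((b (k + 1) : ℚ) / N))).card ≤ Q.natDegree :=
    (Multiset.card_le_card (Multiset.filter_le _ _)).trans (card_roots' Q)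
  rw [hd']
  refine Nat.le_of_mul_le_mul_left ?_ hp
  rw [← mul_assoc, ← hd, h1]
  exact Nat.mul_le_mul_left _ h2

/-- The Newton iteration from the minimal polynomial of the truncation keeps the form `c z`, and its
result is `fk` by uniqueness of approximate roots. -/
theorem hasInit_approximateRoot (hB : IsBranch N γ g b)
    {k : ℕ} (hk : k < g) {f fk : Cx[X]} (hfm : f.Monic)
    (hfN : f.natDegree = N) (hf : f.map toH = ∏ j ∈ Finset.range N, (X - C (twist (j : ℤ) γ)))
    (hfk : IsApproximateRoot (charGcd b k) f fk) :
    ∃ (lam : HQ) (B : ℚ) (c : ℂ), 0 < B ∧ c ≠ 0 ∧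
      (((b (k + 1) : ℚ) / N : ℚ) : WithTop ℚ) ≤ (γ - lam).orderTop ∧
      (γ - lam).coeff ((b (k + 1) : ℚ) / N) = γ.coeff ((b (k + 1) : ℚ) / N) ∧
      HasInit ((fk.map toH).comp (ballVar lam ((b (k + 1) : ℚ) / N))) B (C c * X) ∧
      HasInit ((f.map toH).comp (ballVar lam ((b (k + 1) : ℚ) / N))) (charGcd b k * B)
        (C (c ^ charGcd b k) * (X ^ charQuot b (k + 1) -
          C (γ.coeff ((b (k + 1) : ℚ) / N) ^ charQuot b (k + 1))) ^ charGcd b (k + 1)) := by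
  obtain ⟨lam, B, c, q, hB0, hc, hlam, hcoef, hq, hfI⟩ := hB.exists_isAdapted hk
  rw [← hf] at hfI
  refine ⟨lam, B, c, hB0, hc, hlam, hcoef, ?_, hfI⟩
  have hn := hB.two_le_charQuot hk
  have hpn := charQuot_mul b k
  have hl' := (hB.charGcd_dvd_pos (k + 1)).2
  obtain ⟨⟨d, hd⟩, hp⟩ := hB.charGcd_dvd_pos k
  have hdeg := hB.mul_natDegree_init_le hk hlam
  have hd' : N / charGcd b k = d := by rw [hd]; exact Nat.mul_div_cancel_left d hp
  have hp2 : 2 ≤ charGcd b k := by rw [← hpn]; exact hn.trans (Nat.le_mul_of_pos_right _ hl')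
  have hd0 : 0 < d := Nat.pos_of_ne_zero fun h => by
    have := hB.pos
    rw [hd, h] at this
    simp at this
  rw [hd'] at hq hdeg
  -- The leading terms cancel and the next power of `z` occurring has exponent `l_k - n_{k+1}`, at
  -- most `l_k - 2`.
  have hFf : (C (c ^ charGcd b k) * (X ^ charQuot b (k + 1) -
      C (γ.coeff ((b (k + 1) : ℚ) / N) ^ charQuot b (k + 1))) ^ charGcd b (k + 1) -
        (C c * X) ^ charGcd b k).degree < ((charGcd b k - 1 : ℕ) : WithBot ℕ) := by
    set e := γ.coeff ((b (k + 1) : ℚ) / N) ^ charQuot b (k + 1)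
    have h1 : C (c ^ charGcd b k) * (X ^ charQuot b (k + 1) - C e) ^ charGcd b (k + 1) -
        (C c * X) ^ charGcd b k = -(C (c ^ charGcd b k) *
        ((X ^ charQuot b (k + 1)) ^ charGcd b (k + 1) -
          (X ^ charQuot b (k + 1) + -C e) ^ charGcd b (k + 1))) := by
      rw [mul_pow, ← C_pow, ← pow_mul, hpn]
      ring
    have h2 := natDegree_pow_sub_pow_le (q := (X : ℂ[X]) ^ charQuot b (k + 1)) (u := -C e)
      (d := charQuot b (k + 1)) (e := 0) (by simp) (by simp) (Nat.zero_le _)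
      (i := charGcd b (k + 1)) hl'
    rw [h1, degree_neg]
    refine (degree_C_mul (pow_ne_zero _ hc)).le.trans_lt (degree_le_natDegree.trans_lt ?_)
    have h3 : 0 + (charGcd b (k + 1) - 1) * charQuot b (k + 1) < charGcd b k - 1 := by
      rw [← hpn]
      obtain ⟨m, hm⟩ : ∃ m, charGcd b (k + 1) = m + 1 := ⟨_, (Nat.succ_pred_eq_of_pos hl').symm⟩
      rw [hm, Nat.add_sub_cancel, mul_add, mul_comm m, mul_one]
      omega
    exact_mod_cast h2.trans_lt h3
  have hfm' : (f.map toH).Monic := hfm.map toH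
  have hfd : (f.map toH).natDegree = d * charGcd b k := by
    rw [hfm.natDegree_map, hfN, mul_comm, ← hd]
  obtain ⟨q', hq', hq'deg⟩ := hq.exists_approximateRoot hd0 hp2 hc hdeg hfm' hfd
    (map_toH_map_twist f) hfI hFf
  have hfkd : fk.natDegree = d := by
    have h1 : (f - fk ^ charGcd b k).degree < f.degree := by
      rw [degree_eq_natDegree hfm.ne_zero]
      refine hfk.2.trans_le ?_
      exact_mod_cast Nat.sub_le _ _
    have h2 : (fk ^ charGcd b k).degree = f.degree := by
      have : fk ^ charGcd b k = f - (f - fk ^ charGcd b k) := by ring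
      rw [this]
      exact degree_sub_eq_left_of_degree_lt h1
    have h3 := natDegree_eq_of_degree_eq h2
    rw [hfk.1.natDegree_pow, hfN, hd] at h3
    exact Nat.eq_of_mul_eq_mul_left hp h3
  have hfkdeg : (f.map toH - fk.map toH ^ charGcd b k).degree <
      (((charGcd b k - 1) * d : ℕ) : WithBot ℕ) := by
    rw [← Polynomial.map_pow, ← Polynomial.map_sub]
    refine degree_map_le.trans_lt (hfk.2.trans_le (le_of_eq ?_))
    rw [hfN, hd', hd, Nat.sub_mul, one_mul]
  rw [approximateRoot_unique (by omega) (hfk.1.map toH)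
    (by rw [hfk.1.natDegree_map, hfkd]) hq'.monic hq'.natDegree hfkdeg hq'deg]
  exact hq'.init

theorem ballCount_roots (hB : IsBranch N γ g b)
    {i : ℕ} (hi : i ≤ g) {h : ℚ} (h1 : 1 ≤ i → (b i : ℚ) / N < h)
    (h2 : i < g → h ≤ (b (i + 1) : ℚ) / N) :
    ballCount (∏ j ∈ Finset.range N, (X - C (twist (j : ℤ) γ))).roots γ h = charGcd b i := by
  classical
  rw [← hB.card_filter_dvd i]
  have h3 : (∏ j ∈ Finset.range N, (X - C (twist (j : ℤ) γ))).roots =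
      (Finset.range N).val.map fun j : ℕ => twist (j : ℤ) γ := by
    rw [← roots_multiset_prod_X_sub_C ((Finset.range N).val.map fun j : ℕ => twist (j : ℤ) γ),
      Multiset.map_map]
    rfl
  rw [h3, ballCount, Multiset.filter_map, Multiset.card_map, Finset.card_def, Finset.filter_val]
  congr 1
  refine Multiset.filter_congr fun j _ => ?_
  exact hB.le_orderTop_twist_sub_iff hi h1 h2 j

/-- The number of roots of the jacobian in a ball about the branch. -/
theorem ballCount_jacPoly (hB : IsBranch N γ g b)
    {k : ℕ} (hk : k < g) {f fk : Cx[X]} (hfm : f.Monic)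
    (hfN : f.natDegree = N) (hf : f.map toH = ∏ j ∈ Finset.range N, (X - C (twist (j : ℤ) γ)))
    (hfk : IsApproximateRoot (charGcd b k) f fk) :
    jacPoly fk f ≠ 0 ∧
    ballCount ((jacPoly fk f).map toH).roots γ ((b (k + 1) : ℚ) / N) =
      charQuot b (k + 1) * (charGcd b (k + 1) - 1) ∧
    ∀ i ≤ g, k < i → ∀ h : ℚ, (b i : ℚ) / N < h → (i < g → h ≤ (b (i + 1) : ℚ) / N) →
      ballCount ((jacPoly fk f).map toH).roots γ h = charGcd b i - 1 := by
  obtain ⟨lam, B, c, hB0, hc, hlam, hcoef, hkI, hfI⟩ :=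
    hB.hasInit_approximateRoot hk hfm hfN hf hfk
  have ha : γ.coeff ((b (k + 1) : ℚ) / N) ≠ 0 := hB.coeff_ne_zero ⟨by omega, by omega⟩
  have hJ := C_xpow_mul_map_jacPoly fk f
  have hJs := splits_of_map_twist (map_toH_map_twist (jacPoly fk f))
  have hBC : (B : ℂ) ≠ 0 := by exact_mod_cast hB0.ne'
  have hp : (charGcd b k : ℂ) ≠ 0 := by exact_mod_cast (hB.charGcd_dvd_pos k).2.ne'
  have hn := hB.two_le_charQuot hk
  have hpn := charQuot_mul b k
  obtain ⟨m, hm⟩ : ∃ m, charGcd b (k + 1) = m + 1 :=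
    ⟨_, (Nat.succ_pred_eq_of_pos (hB.charGcd_dvd_pos (k + 1)).2).symm⟩
  have hJI := HasInit.jac hJ hkI hfI
  set a := γ.coeff ((b (k + 1) : ℚ) / N)
  set n := charQuot b (k + 1)
  set p := charGcd b k
  -- Since `l_k = n_{k+1} l_{k+1}`, the factor left beside `(z^n - a^n)^m` is `z^n - (z^n - a^n) =
  -- a^n`: the jacobian form loses `n` in degree.
  have hmain : C (B : ℂ) * (C c * X * derivative (C (c ^ p) * (X ^ n - C (a ^ n)) ^
      charGcd b (k + 1))) - C ((p * B : ℚ) : ℂ) * (C (c ^ p) * (X ^ n - C (a ^ n)) ^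
        charGcd b (k + 1) * derivative (C c * X)) =
      C (B * c * c ^ p * p * a ^ n) * (X ^ n - C (a ^ n)) ^ m := by
    have hX : (X : ℂ[X]) * X ^ (n - 1) = X ^ n := by
      rw [← pow_succ']
      congr 1
      omega
    have hp' : (p : ℂ[X]) = (n : ℂ[X]) * ((m : ℂ[X]) + 1) := by
      rw [← hpn, hm]
      push_cast
      ring
    rw [hm]
    simp only [derivative_mul, derivative_C, zero_mul, zero_add, derivative_pow, derivative_sub,
      derivative_X, mul_one, sub_zero, Rat.cast_mul, Rat.cast_natCast, C_mul, C_eq_natCast,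
      Nat.add_sub_cancel, Nat.cast_add, Nat.cast_one, hp', C_add, C_1]
    rw [pow_succ (X ^ n - C (a ^ n)) m]
    linear_combination (C (B : ℂ) * C c * C (c ^ p) * ((m : ℂ[X]) + 1) * (X ^ n - C (a ^ n)) ^ m *
      (n : ℂ[X])) * hX
  rw [hmain] at hJI
  have hlead : (B * c * c ^ p * p * a ^ n : ℂ) ≠ 0 := by
    refine mul_ne_zero (mul_ne_zero (mul_ne_zero (mul_ne_zero hBC hc) ?_) hp) ?_
    · exact pow_ne_zero _ hc
    · exact pow_ne_zero _ ha
  have hmon : (X ^ n - C (a ^ n) : ℂ[X]).Monic := monic_X_pow_sub_C _ (by omega)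
  have hne : C (B * c * c ^ p * p * a ^ n : ℂ) * (X ^ n - C (a ^ n)) ^ m ≠ 0 :=
    mul_ne_zero (C_ne_zero.2 hlead) (hmon.pow m).ne_zero
  refine ⟨?_, ?_, ?_⟩
  · intro h0
    rw [h0, Polynomial.map_zero, zero_comp] at hJI
    exact hne (hJI.unique (HasInit.zero _))
  · rw [ballCount_congr _ hlam, ← natDegree_eq_ballCount hJs hne hJI, natDegree_C_mul hlead,
      hmon.natDegree_pow, natDegree_X_pow_sub_C, hm, Nat.add_sub_cancel, mul_comm]
  · intro i hig hki h hh1 hh2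
    set H : ℚ := (b (k + 1) : ℚ) / N with hH
    have hHh : H < h := by
      refine lt_of_le_of_lt ?_ hh1
      have hN : (0 : ℚ) < N := by exact_mod_cast hB.pos
      have : b (k + 1) ≤ b i :=
        hB.strictMono.monotoneOn ⟨by omega, by omega⟩ ⟨by omega, hig⟩ (by omega)
      have : (b (k + 1) : ℚ) ≤ b i := by exact_mod_cast this
      rw [hH]
      gcongr
    -- In the coordinate of the larger ball the smaller ball is `a` plus terms of positive weight,
    -- so `c z` becomes the nonzero constant `c a`.
    have hkI' : HasInit ((fk.map toH).comp (ballVar γ h)) B (C (c * a)) := by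
      have hY : HasInit (C (xpow (-H) * (γ - lam)) + C (xpow (h - H)) * X) 0 (C a) := by
        have h3 : HasInit (C (xpow (-H) * (γ - lam))) 0 (C a) := by
          have := HasInit.const (A := 0) (a := xpow (-H) * (γ - lam)) fun q hq => by
            rw [coeff_xpow_mul]
            exact le_orderTop_iff.1 hlam _ (by linarith)
          rwa [coeff_xpow_mul, zero_sub, neg_neg, hcoef] at this
        have h4 := ((HasInit.xpow (h - H)).mul HasInit.var).of_lt (B := 0) (by linarith)
        simpa using h3.add h4
      have h5 := hkI.comp hY
      rw [comp_assoc] at h5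
      have h6 : (ballVar lam H).comp (C (xpow (-H) * (γ - lam)) + C (xpow (h - H)) * X) =
          ballVar γ h := by
        simp only [ballVar, add_comp, mul_comp, C_comp, X_comp]
        rw [mul_add, ← C_mul, ← mul_assoc, ← mul_assoc, ← C_mul, ← xpow_add, ← xpow_add,
          add_neg_cancel, xpow_zero, one_mul, add_sub_cancel, C_sub]
        ring
      rw [h6] at h5
      simpa using h5
    have hfs := splits_of_map_twist (map_toH_map_twist f)
    obtain ⟨A, F, hF0, hFd, hFI⟩ :=
      exists_hasInit_of_splits hfs (hfm.map toH).ne_zero γ h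
    rw [hf, hB.ballCount_roots hig (fun _ => hh1) hh2] at hFd
    -- The form of `fk` being constant, only the term with `F'` survives, and its degree is one less
    -- than the number of roots of `f` in the ball.
    have hJI' := HasInit.jac hJ hkI' hFI
    rw [derivative_C, mul_zero, mul_zero, sub_zero, ← mul_assoc, ← C_mul] at hJI'
    have hlead' : (B * (c * a) : ℂ) ≠ 0 := mul_ne_zero hBC (mul_ne_zero hc ha)
    have hl := (hB.charGcd_dvd_pos i).2
    have hF' : derivative F ≠ 0 := by
      intro h0
      have := derivative_eq_zero.1 h0
      omega
    rw [← natDegree_eq_ballCount hJs (mul_ne_zero (C_ne_zero.2 hlead') hF') hJI',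
      natDegree_C_mul hlead', natDegree_derivative, hFd]

end IsBranch

end

end PlaneBranch

/-! ### Distribution of the jacobian roots among the contacts. -/

namespace PlaneBranch

noncomputable section

open Polynomial

theorem prod_charQuot_mul_charGcd (b : ℕ → ℕ) (i : ℕ) :
    (∏ j ∈ Finset.Icc 1 i, charQuot b j) * charGcd b i = b 0 := by
  induction i with
  | zero => simp [charGcd_zero]
  | succ i ih => rw [Finset.prod_Icc_succ_top (by omega), mul_assoc, charQuot_mul, ih]

/-- The maximal contact of `α` with the conjugates of `γ` is `h`. -/
def HasContact (γ : HQ) (h : ℚ) (α : HQ) : Prop :=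
  IsNear γ h α ∧ ∀ h' > h, ¬ IsNear γ h' α

theorem HasContact.unique {γ : HQ} {h h' : ℚ} {α : HQ} (h1 : HasContact γ h α)
    (h2 : HasContact γ h' α) : h = h' := by
  rcases lt_trichotomy h h' with hlt | heq | hlt
  · exact absurd h2.1 (h1.2 _ hlt)
  · exact heq
  · exact absurd h1.1 (h2.2 _ hlt)

theorem hasContact_twist_iff {γ : HQ} {h : ℚ} {α : HQ} (i : ℤ) :
    HasContact γ h (twist i α) ↔ HasContact γ h α := by
  simp only [HasContact, isNear_twist_iff]

-- Nested submultisets of equal size coincide, so equality of two counts excludes contacts in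
-- between.
open Classical in
theorem isNear_congr_of_card_le {γ : HQ} {h h' : ℚ} (hh : h ≤ h') {s : Multiset HQ}
    (hc : (s.filter (IsNear γ h)).card ≤ (s.filter (IsNear γ h')).card) {α : HQ} (hα : α ∈ s) :
    IsNear γ h α ↔ IsNear γ h' α := by
  have h1 : s.filter (IsNear γ h') = s.filter (IsNear γ h) :=
    Multiset.eq_of_le_of_card_le
      (Multiset.monotone_filter_right s fun a ha => IsNear.mono hh ha) hc
  refine ⟨fun hn => ?_, IsNear.mono hh⟩
  have h2 : α ∈ s.filter (IsNear γ h') := by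
    rw [h1]
    exact Multiset.mem_filter.2 ⟨hα, hn⟩
  exact (Multiset.mem_filter.1 h2).2

namespace IsBranch

variable {N : ℕ} {γ : HQ} {g : ℕ} {b : ℕ → ℕ}

/-- A radius such that the half-open interval from the `i`-th exponent to it contains no further
characteristic exponent in its interior. -/
def nextHeight (N g : ℕ) (b : ℕ → ℕ) (i : ℕ) : ℚ :=
  -- Beyond the last exponent the count no longer depends on the radius; adding 1 is an arbitrary
  -- choice.
  if i < g then (b (i + 1) : ℚ) / N else (b i : ℚ) / N + 1

theorem lt_nextHeight (hB : IsBranch N γ g b)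
    {i : ℕ} (hi1 : 1 ≤ i) : (b i : ℚ) / N < nextHeight N g b i := by
  unfold nextHeight
  split_ifs with h
  · exact hB.div_lt_div h hi1
  · exact lt_add_one _

theorem nextHeight_le {i : ℕ} (hi : i < g) : nextHeight N g b i ≤ (b (i + 1) : ℚ) / N := by
  rw [nextHeight, if_pos hi]

open Classical in
/-- The members of `s` that are near the branch, for a multiset with as many members near it as
the jacobian of the branch and its approximate root has roots. -/
structure JacobianCount (N : ℕ) (γ : HQ) (g : ℕ) (b : ℕ → ℕ) (k : ℕ) (s : Multiset HQ) :
    Prop where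
  first : charGcd b (k + 1) * (s.filter (IsNear γ ((b (k + 1) : ℚ) / N))).card =
    N * (charGcd b (k + 1) - 1)
  rest : ∀ i ≤ g, k < i → ∀ h : ℚ, (b i : ℚ) / N < h → (i < g → h ≤ (b (i + 1) : ℚ) / N) →
    charGcd b i * (s.filter (IsNear γ h)).card = N * (charGcd b i - 1)

theorem jacobianCount (hB : IsBranch N γ g b) {k : ℕ} (hk : k < g) {f fk : Cx[X]} (hfm : f.Monic)
    (hfN : f.natDegree = N) (hf : f.map toH = ∏ j ∈ Finset.range N, (X - C (twist (j : ℤ) γ)))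
    (hfk : IsApproximateRoot (charGcd b k) f fk) :
    JacobianCount N γ g b k ((jacPoly fk f).map toH).roots := by
  obtain ⟨-, h1, h2⟩ := hB.ballCount_jacPoly hk hfm hfN hf hfk
  have hinv := roots_map_twist (map_toH_map_twist (jacPoly fk f))
  refine ⟨?_, fun i hig hki h hh1 hh2 => ?_⟩
  · have h3 := hB.mul_ballCount hk.le (hB.div_lt_div hk) (fun _ => le_rfl) hinv
    have hn := hB.two_le_charQuot hk
    rw [h1, ← charQuot_mul b k] at h3
    -- Cancelling `n_{k+1}` in `l_k = n_{k+1} l_{k+1}` puts the count at `b_{k+1}/N` into the same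
    -- shape as the count just above it.
    refine Nat.eq_of_mul_eq_mul_left (by omega : 0 < charQuot b (k + 1)) ?_
    rw [← mul_assoc, ← h3]
    ring
  · rw [← h2 i hig hki h hh1 hh2]
    exact (hB.mul_ballCount hig (fun _ => hh1) hh2 hinv).symm

section

variable {k : ℕ} {s : Multiset HQ}

open Classical in
theorem card_isNear_nextHeight (hB : IsBranch N γ g b) (hJ : JacobianCount N γ g b k s)
    {i : ℕ} (hig : i ≤ g) (hki : k < i) :
    charGcd b i * (s.filter (IsNear γ (nextHeight N g b i))).card = N * (charGcd b i - 1) :=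
  hJ.rest i hig hki _ (hB.lt_nextHeight (by omega)) nextHeight_le

theorem isNear_iff_nextHeight (hB : IsBranch N γ g b) (hJ : JacobianCount N γ g b k s)
    {i : ℕ} (hig : i ≤ g) (hki : k < i) {h : ℚ}
    (h1 : (b i : ℚ) / N < h) (h2 : h ≤ nextHeight N g b i) {α : HQ} (hα : α ∈ s) :
    IsNear γ h α ↔ IsNear γ (nextHeight N g b i) α := by
  classical
  refine isNear_congr_of_card_le h2 (le_of_eq ?_) hα
  refine Nat.eq_of_mul_eq_mul_left (hB.charGcd_dvd_pos i).2 ?_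
  rw [hB.card_isNear_nextHeight hJ hig hki,
    hJ.rest i hig hki h h1 fun hi => h2.trans (nextHeight_le hi)]

/-- The counts at `b_{k+1}/N` and just above it agree, so no root has contact exactly `b_{k+1}/N`.
This is why the near factors start at index `k + 2`. -/
theorem isNear_first_iff (hB : IsBranch N γ g b) (hJ : JacobianCount N γ g b k s)
    {α : HQ} (hk : k < g) (hα : α ∈ s) :
    IsNear γ ((b (k + 1) : ℚ) / N) α ↔ IsNear γ (nextHeight N g b (k + 1)) α := by
  classical
  refine isNear_congr_of_card_le (hB.lt_nextHeight (by omega)).le (le_of_eq ?_) hα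
  refine Nat.eq_of_mul_eq_mul_left (hB.charGcd_dvd_pos (k + 1)).2 ?_
  rw [hB.card_isNear_nextHeight hJ hk (by omega), hJ.first]

/-- As `l_g = 1`, the count `N / l_g * (l_g - 1)` beyond the last exponent is zero. -/
theorem not_isNear_last (hB : IsBranch N γ g b) (hJ : JacobianCount N γ g b k s)
    {α : HQ} (hk : k < g) (hα : α ∈ s) :
    ¬ IsNear γ (nextHeight N g b g) α := by
  classical
  intro h
  have h1 := hB.card_isNear_nextHeight hJ le_rfl hk
  rw [hB.charGcd_last, Nat.sub_self, mul_zero, one_mul, Multiset.card_eq_zero] at h1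
  have h2 : α ∈ s.filter (IsNear γ (nextHeight N g b g)) := Multiset.mem_filter.2 ⟨hα, h⟩
  rw [h1] at h2
  exact Multiset.notMem_zero _ h2

theorem hasContact_iff (hB : IsBranch N γ g b) (hJ : JacobianCount N γ g b k s)
    {i : ℕ} (hig : i ≤ g) (hki : k < i) {α : HQ} (hα : α ∈ s) :
    HasContact γ ((b i : ℚ) / N) α ↔
      IsNear γ ((b i : ℚ) / N) α ∧ ¬ IsNear γ (nextHeight N g b i) α := by
  refine and_congr_right fun _ => ⟨fun h => h _ (hB.lt_nextHeight (by omega)),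
    fun h h' hh' hn => ?_⟩
  have h1 : IsNear γ (min h' (nextHeight N g b i)) α := hn.mono (min_le_left _ _)
  rw [hB.isNear_iff_nextHeight hJ hig hki (lt_min hh' (hB.lt_nextHeight (by omega)))
    (min_le_right _ _) hα] at h1
  exact h h1

/-- A root climbs from one exponent to the next until it stops; it cannot pass the last one. -/
theorem exists_hasContact (hB : IsBranch N γ g b) (hJ : JacobianCount N γ g b k s)
    (hk : k < g) {α : HQ} (hα : α ∈ s)
    (hn : IsNear γ ((b (k + 1) : ℚ) / N) α) :
    ∃ i ∈ Finset.Icc (k + 2) g, HasContact γ ((b i : ℚ) / N) α := by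
  have key : ∀ m i : ℕ, i + m = g → k + 2 ≤ i → IsNear γ ((b i : ℚ) / N) α →
      ∃ i ∈ Finset.Icc (k + 2) g, HasContact γ ((b i : ℚ) / N) α := by
    intro m
    induction m with
    | zero =>
      intro i hi hki hn
      obtain rfl : i = g := by omega
      exact ⟨i, Finset.mem_Icc.2 ⟨hki, le_rfl⟩, (hB.hasContact_iff hJ le_rfl (by omega) hα).2
        ⟨hn, hB.not_isNear_last hJ hk hα⟩⟩
    | succ m ih =>
      intro i hi hki hn
      by_cases h : IsNear γ (nextHeight N g b i) α
      · refine ih (i + 1) (by omega) (by omega) ?_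
        rwa [nextHeight, if_pos (by omega)] at h
      · exact ⟨i, Finset.mem_Icc.2 ⟨hki, by omega⟩,
          (hB.hasContact_iff hJ (by omega) (by omega) hα).2 ⟨hn, h⟩⟩
  rw [hB.isNear_first_iff hJ hk hα] at hn
  rcases Nat.lt_or_ge (k + 1) g with h | h
  · rw [nextHeight, if_pos h] at hn
    exact key (g - (k + 2)) (k + 2) (by omega) le_rfl hn
  · obtain rfl : g = k + 1 := by omega
    exact absurd hn (hB.not_isNear_last hJ hk hα)

-- The difference of the counts above `b_{i-1}/N` and above `b_i/N` is `N/l_i - N/l_{i-1}`, and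
-- `N/l_{i-1} = n_1 ... n_{i-1}`.
open Classical in
theorem card_hasContact (hB : IsBranch N γ g b) (hJ : JacobianCount N γ g b k s)
    {i : ℕ} (hi : i ∈ Finset.Icc (k + 2) g) :
    (s.filter (HasContact γ ((b i : ℚ) / N))).card =
      (∏ j ∈ Finset.Icc 1 (i - 1), charQuot b j) * (charQuot b i - 1) := by
  rw [Finset.mem_Icc] at hi
  obtain ⟨t, rfl⟩ : ∃ t, i = t + 1 := ⟨i - 1, by omega⟩
  rw [Nat.add_sub_cancel]
  have hcongr : s.filter (HasContact γ ((b (t + 1) : ℚ) / N)) =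
      (s.filter (IsNear γ ((b (t + 1) : ℚ) / N))).filter
        fun α => ¬ IsNear γ (nextHeight N g b (t + 1)) α := by
    rw [Multiset.filter_filter]
    refine Multiset.filter_congr fun α hα => ?_
    rw [hB.hasContact_iff hJ hi.2 (by omega) hα, and_comm]
  have hsub : (s.filter (IsNear γ ((b (t + 1) : ℚ) / N))).filter
      (IsNear γ (nextHeight N g b (t + 1))) = s.filter (IsNear γ (nextHeight N g b (t + 1))) := by
    rw [Multiset.filter_filter]
    refine Multiset.filter_congr fun α _ => ?_
    exact and_iff_left_of_imp (IsNear.mono (hB.lt_nextHeight (by omega)).le)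
  have hadd := congrArg Multiset.card (Multiset.filter_add_not
    (IsNear γ (nextHeight N g b (t + 1))) (s.filter (IsNear γ ((b (t + 1) : ℚ) / N))))
  rw [Multiset.card_add, hsub, ← hcongr] at hadd
  have h1 := hJ.rest t (by omega) (by omega) _ (hB.div_lt_div (by omega) (by omega))
    fun _ => le_rfl
  have h2 := hB.card_isNear_nextHeight hJ hi.2 (by omega)
  have hP := prod_charQuot_mul_charGcd b t
  have hq := charQuot_mul b t
  have hl := (hB.charGcd_dvd_pos t).2
  have hl' := (hB.charGcd_dvd_pos (t + 1)).2
  rw [hB.zero] at hP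
  set P := ∏ j ∈ Finset.Icc 1 t, charQuot b j
  set n := charQuot b (t + 1)
  have h3 : (s.filter (IsNear γ ((b (t + 1) : ℚ) / N))).card = P * (charGcd b t - 1) := by
    refine Nat.eq_of_mul_eq_mul_left hl ?_
    rw [h1, ← hP]
    ring
  have h4 : (s.filter (IsNear γ (nextHeight N g b (t + 1)))).card =
      P * n * (charGcd b (t + 1) - 1) := by
    refine Nat.eq_of_mul_eq_mul_left hl' ?_
    rw [h2, ← hP, ← hq]
    ring
  rw [h3, h4, ← hq] at hadd
  have hn0 : 0 < n := Nat.pos_of_ne_zero fun h => by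
    rw [h, zero_mul] at hq
    omega
  obtain ⟨m, hm⟩ : ∃ m, charGcd b (t + 1) = m + 1 := ⟨_, (Nat.succ_pred_eq_of_pos hl').symm⟩
  obtain ⟨n', hn'⟩ : ∃ n', n = n' + 1 := ⟨_, (Nat.succ_pred_eq_of_pos hn0).symm⟩
  rw [hm, hn', Nat.add_sub_cancel] at hadd
  rw [hn', Nat.add_sub_cancel]
  have h5 : (n' + 1) * (m + 1) - 1 = (n' + 1) * m + n' := by
    rw [mul_add, mul_one]
    omega
  rw [h5] at hadd
  refine Nat.add_left_cancel (n := P * (n' + 1) * m) ?_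
  rw [hadd]
  ring

-- Every near root has exactly one of the contacts. The equality of multisets keeps multiplicities,
-- as the factorization of the jacobian requires.
open Classical in
theorem sum_filter_hasContact (hB : IsBranch N γ g b) (hJ : JacobianCount N γ g b k s)
    (hk : k < g) :
    ∑ i ∈ Finset.Icc (k + 2) g, s.filter (HasContact γ ((b i : ℚ) / N)) =
      s.filter (IsNear γ ((b (k + 1) : ℚ) / N)) := by
  have hN : (0 : ℚ) < N := by exact_mod_cast hB.pos
  ext α
  rw [Multiset.count_sum']
  simp only [Multiset.count_filter]
  by_cases hα : α ∈ s
  swap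
  · simp [Multiset.count_eq_zero_of_notMem hα]
  split_ifs with hn
  · obtain ⟨i, hi, hc⟩ := hB.exists_hasContact hJ hk hα hn
    rw [Finset.sum_eq_single i]
    · rw [if_pos hc]
    · intro j hj hji
      rw [if_neg]
      intro hc'
      apply hji
      rw [Finset.mem_Icc] at hi hj
      have h1 := hc'.unique hc
      rw [div_left_inj' hN.ne'] at h1
      exact hB.strictMono.injOn ⟨by omega, hj.2⟩ ⟨by omega, hi.2⟩ (by exact_mod_cast h1)
    · exact fun h => absurd hi h
  · refine Finset.sum_eq_zero fun i hi => ?_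
    rw [if_neg]
    rw [Finset.mem_Icc] at hi
    intro hc
    refine hn (hc.1.mono ?_)
    have h1 : b (k + 1) ≤ b i :=
      hB.strictMono.monotoneOn ⟨by omega, by omega⟩ ⟨by omega, hi.2⟩ (by omega)
    have h2 : (b (k + 1) : ℚ) ≤ b i := by exact_mod_cast h1
    gcongr

end

end IsBranch

end

end PlaneBranch

/-! ### The factors of the jacobian and the main theorem. -/

namespace PlaneBranch

noncomputable section

open Polynomial

section Contact

variable {F : MvPowerSeries (Fin 2) ℂ} {γ : HQ}

theorem HasContact.isContact (hF : ∀ α, α ∈ Zer F ↔ ∃ j : ℤ, α = twist j γ)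
    {h : ℚ} {α : HQ} (hα : HasContact γ h α) :
    IsContact α F (h : WithTop ℚ) := by
  have hle : ∀ j : ℤ, (α - twist j γ).orderTop ≤ h := by
    intro j
    by_contra hlt
    rw [not_le] at hlt
    rcases eq_or_ne (α - twist j γ).orderTop ⊤ with ht | ht
    -- Infinite contact means that `α` is itself a conjugate, hence near at every radius.
    · exact hα.2 (h + 1) (lt_add_one h) ⟨j, by rw [ht]; exact le_top⟩
    · obtain ⟨o, ho⟩ := WithTop.ne_top_iff_exists.1 ht
      rw [← ho, WithTop.coe_lt_coe] at hlt
      exact hα.2 o hlt ⟨j, ho.le⟩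
  obtain ⟨j, hj⟩ := hα.1
  refine ⟨⟨twist j γ, (hF _).2 ⟨j, rfl⟩, le_antisymm (hle j) hj⟩, ?_⟩
  rintro _ ⟨β, hβ, rfl⟩
  obtain ⟨i, rfl⟩ := (hF β).1 hβ
  exact hle i

/-- The conjugates of `γ` are finite in number, so the maximal contact exists. -/
theorem exists_isContact_lt (hF : ∀ α, α ∈ Zer F ↔ ∃ j : ℤ, α = twist j γ)
    {N : ℕ} (hN : 0 < N) (hper : twist (N : ℤ) γ = γ) {h : ℚ} {α : HQ}
    (hα : ¬ IsNear γ h α) : ∃ c : WithTop ℚ, IsContact α F c ∧ c < (h : WithTop ℚ) := by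
  have hfin : (contactOrder α '' Zer F).Finite := by
    refine ((Finset.range N).image fun j : ℕ =>
      contactOrder α (twist (j : ℤ) γ)).finite_toSet.subset ?_
    rintro _ ⟨β, hβ, rfl⟩
    obtain ⟨i, rfl⟩ := (hF β).1 hβ
    have hNZ : (0 : ℤ) < N := by exact_mod_cast hN
    obtain ⟨r, hr⟩ := Int.eq_ofNat_of_zero_le (Int.emod_nonneg i hNZ.ne')
    have hlt := Int.emod_lt_of_pos i hNZ
    rw [hr] at hlt
    have hir : twist i γ = twist (r : ℤ) γ := by
      rw [twist_eq_twist_iff]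
      obtain ⟨q, hq⟩ : (N : ℤ) ∣ i - r := hr ▸ Int.dvd_self_sub_emod
      rw [hq]
      exact twist_mul_eq_self hper q
    rw [Finset.mem_coe, Finset.mem_image]
    exact ⟨r, Finset.mem_range.2 (by exact_mod_cast hlt), by rw [hir]⟩
  have hne : (contactOrder α '' Zer F).Nonempty :=
    ⟨_, γ, (hF γ).2 ⟨0, (twist_zero γ).symm⟩, rfl⟩
  obtain ⟨c, hc, hmax⟩ := Set.exists_max_image _ id hfin hne
  refine ⟨c, ⟨hc, fun x hx => hmax x hx⟩, ?_⟩
  obtain ⟨β, hβ, rfl⟩ := hc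
  obtain ⟨i, rfl⟩ := (hF β).1 hβ
  by_contra hle
  exact hα ⟨i, not_lt.1 hle⟩

end Contact

theorem orderTop_pos_of_isNear {γ : HQ} (hγ : 0 < γ.orderTop) {h : ℚ} (hh : 0 < h) {α : HQ}
    (hα : IsNear γ h α) : 0 < α.orderTop := by
  obtain ⟨j, hj⟩ := hα
  have h1 : (0 : WithTop ℚ) < (α - twist j γ).orderTop := lt_of_lt_of_le (by exact_mod_cast hh) hj
  have h2 : (0 : WithTop ℚ) < (twist j γ).orderTop := by rwa [orderTop_twist]
  have h3 := HahnSeries.min_orderTop_le_orderTop_add (x := α - twist j γ) (y := twist j γ)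
  rw [sub_add_cancel] at h3
  exact (lt_min h1 h2).trans_le h3

open Classical in
/-- The Weierstrass factors of the jacobian with prescribed contact with the branch, and the
remaining factor. -/
theorem IsBranch.exists_jacPoly_factors {N : ℕ} {γ : HQ} {g : ℕ} {b : ℕ → ℕ}
    (hB : IsBranch N γ g b) {k : ℕ} (hk : k < g) {J : Cx[X]} (hJ0 : J ≠ 0)
    (hJ : IsBranch.JacobianCount N γ g b k (J.map toH).roots) :
    ∃ (Q : ℕ → Cx[X]) (R : Cx[X]), J = R * ∏ i ∈ Finset.Icc (k + 2) g, Q i ∧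
      (∀ α, (R.map toH).eval α = 0 → ¬ IsNear γ ((b (k + 1) : ℚ) / N) α) ∧
      ∀ i ∈ Finset.Icc (k + 2) g, IsWeierstrass (Q i) ∧
        (∀ α, ((Q i).map toH).eval α = 0 → HasContact γ ((b i : ℚ) / N) α) ∧
        (Q i).natDegree = (∏ j ∈ Finset.Icc 1 (i - 1), charQuot b j) * (charQuot b i - 1) := by
  set s := (J.map toH).roots with hs
  have hJH : J.map toH ≠ 0 := map_toH_ne_zero hJ0
  have hinv : s.map (twist 1) = s := roots_map_twist (map_toH_map_twist J)
  have hex : ∀ i, ∃ Q : Cx[X], i ∈ Finset.Icc (k + 2) g → IsWeierstrass Q ∧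
      Q.map toH = ((s.filter (HasContact γ ((b i : ℚ) / N))).map fun α => X - C α).prod ∧
      Q.natDegree = (s.filter (HasContact γ ((b i : ℚ) / N))).card := by
    intro i
    by_cases hi : i ∈ Finset.Icc (k + 2) g
    swap
    · exact ⟨0, fun h => absurd h hi⟩
    have hi' := Finset.mem_Icc.1 hi
    have hroot : ∀ α ∈ s.filter (HasContact γ ((b i : ℚ) / N)),
        (J.map toH).eval α = 0 ∧ 0 < α.orderTop := fun α hα => by
      obtain ⟨h1, h2⟩ := Multiset.mem_filter.1 hα
      exact ⟨(mem_roots hJH).1 h1, orderTop_pos_of_isNear hB.orderTop_pos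
        (hB.height_pos ⟨by omega, hi'.2⟩) h2.1⟩
    have htw : (s.filter (HasContact γ ((b i : ℚ) / N))).map (twist 1) =
        s.filter (HasContact γ ((b i : ℚ) / N)) := by
      conv_rhs => rw [← hinv]
      rw [Multiset.filter_map]
      congr 1
      refine Multiset.filter_congr fun α _ => ?_
      exact (hasContact_twist_iff 1).symm
    obtain ⟨Q, hQ⟩ := exists_isWeierstrass_of_roots hJ0 hroot htw
    exact ⟨Q, fun _ => hQ⟩
  choose Q hQ using hex
  have hmon : (∏ i ∈ Finset.Icc (k + 2) g, Q i).Monic :=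
    monic_prod_of_monic _ _ fun i hi => (hQ i hi).1.1
  have hmap : (∏ i ∈ Finset.Icc (k + 2) g, Q i).map toH =
      ((s.filter (IsNear γ ((b (k + 1) : ℚ) / N))).map fun α => X - C α).prod := by
    rw [Polynomial.map_prod, Finset.prod_congr rfl fun i hi => (hQ i hi).2.1,
      ← hB.sum_filter_hasContact hJ hk, ← Multiset.coe_mapAddMonoidHom, map_sum,
      Multiset.prod_sum]
  obtain ⟨R, hR⟩ : (∏ i ∈ Finset.Icc (k + 2) g, Q i) ∣ J := by
    rw [← map_dvd_map toH toH_injective hmon, hmap,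
      Multiset.prod_X_sub_C_dvd_iff_le_roots hJH]
    exact Multiset.filter_le _ _
  refine ⟨Q, R, by rw [hR, mul_comm], fun α hα hn => ?_, fun i hi => ⟨(hQ i hi).1, ?_, ?_⟩⟩
  · have hR0 : R ≠ 0 := by
      rintro rfl
      exact hJ0 (by rw [hR, mul_zero])
    -- The factors take every near root with its full multiplicity, so cancellation leaves exactly
    -- the roots that are not near to `R`.
    have hroots : s = s.filter (IsNear γ ((b (k + 1) : ℚ) / N)) + (R.map toH).roots := by
      have h1 : J.map toH = (∏ i ∈ Finset.Icc (k + 2) g, Q i).map toH * R.map toH := by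
        rw [← Polynomial.map_mul, ← hR]
      conv_lhs => rw [hs, h1, roots_mul (by rw [← h1]; exact hJH), hmap,
        roots_multiset_prod_X_sub_C]
    have h2 := Multiset.filter_add_not (IsNear γ ((b (k + 1) : ℚ) / N)) s
    have h3 : s.filter (fun α => ¬ IsNear γ ((b (k + 1) : ℚ) / N) α) = (R.map toH).roots :=
      add_left_cancel (h2.trans hroots)
    have h4 : α ∈ (R.map toH).roots := (mem_roots (map_toH_ne_zero hR0)).2 hα
    rw [← h3] at h4
    exact (Multiset.mem_filter.1 h4).2 hn
  · intro α hα
    have h1 : ((Q i).map toH).roots = s.filter (HasContact γ ((b i : ℚ) / N)) := by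
      rw [(hQ i hi).2.1, roots_multiset_prod_X_sub_C]
    have h2 := (mem_roots (map_toH_ne_zero (hQ i hi).1.1.ne_zero)).2 hα
    rw [h1] at h2
    exact (Multiset.mem_filter.1 h2).2
  · rw [(hQ i hi).2.2, hB.card_hasContact hJ hi]

end

end PlaneBranch

open PlaneBranch in
theorem mainTheorem1 (f : Polynomial Cx) (hW : IsWeierstrass f) (hf : Irreducible f)
    (g : ℕ) (b : ℕ → ℕ) (hb : IsPuiseuxCharacteristic f g b)
    (k : ℕ) (hk : k < g) (fk : Polynomial Cx) (hfk : IsApproximateRoot (charGcd b k) f fk) :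
    ∃ Γ : ℕ → Cxy,
      jac (toSeries fk) (toSeries f) = Cxy.incl (∏ i ∈ Finset.Icc (k + 1) g, Γ i) ∧
      IsRelPrime xVar (∏ i ∈ Finset.Icc (k + 2) g, Γ i) ∧
      (∀ α ∈ Zer (Cxy.incl (Γ (k + 1))), ∃ c : WithTop ℚ,
        IsContact α (toSeries f) c ∧ c < (((b (k + 1) : ℚ) / (b 0 : ℚ) : ℚ) : WithTop ℚ)) ∧
      (∀ i ∈ Finset.Icc (k + 2) g, ∀ α ∈ Zer (Cxy.incl (Γ i)),
        IsContact α (toSeries f) (((b i : ℚ) / (b 0 : ℚ) : ℚ) : WithTop ℚ)) ∧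
      (∀ i ∈ Finset.Icc (k + 2) g,
        interMult (Γ i) xVar =
          (((∏ j ∈ Finset.Icc 1 (i - 1), charQuot b j) * (charQuot b i - 1) : ℕ) : ℕ∞)) := by
  obtain ⟨γ, hB, hprod⟩ := exists_isBranch hW hf hb
  have hzer := fun α => mem_zer_iff_exists_twist (α := α) hW hB.pos hB.twist_iff hprod
  have hJ0 := (hB.ballCount_jacPoly hk hW.1 rfl hprod hfk).1
  obtain ⟨Q, R, hfac, hR, hQ⟩ :=
    hB.exists_jacPoly_factors hk hJ0 (hB.jacobianCount hk hW.1 rfl hprod hfk)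
  have hR0 : R ≠ 0 := by
    rintro rfl
    exact hJ0 (by rw [hfac, zero_mul])
  have hne : ∀ i ∈ Finset.Icc (k + 2) g, i ≠ k + 1 := fun i hi => by
    rw [Finset.mem_Icc] at hi
    omega
  have htail : ∏ i ∈ Finset.Icc (k + 2) g, (if i = k + 1 then toCxy R else toCxy (Q i)) =
      toCxy (∏ i ∈ Finset.Icc (k + 2) g, Q i) := by
    rw [map_prod]
    exact Finset.prod_congr rfl fun i hi => if_neg (hne i hi)
  rw [hb.zero]
  -- The factor of index `k + 1` is the cofactor `R`, for which neither the Weierstrass property nor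
  -- coprimality to `x` is asserted.
  refine ⟨fun i => if i = k + 1 then toCxy R else toCxy (Q i), ?_, ?_, ?_, ?_, ?_⟩
  · have hIcc : Finset.Icc (k + 1) g = insert (k + 1) (Finset.Icc (k + 2) g) := by
      ext i
      simp only [Finset.mem_insert, Finset.mem_Icc]
      omega
    rw [hIcc, Finset.prod_insert (by simp), htail, if_pos rfl, ← map_mul, ← hfac, incl_toCxy,
      jac_toSeries]
  · rw [htail]
    exact isRelPrime_xVar_toCxy (Polynomial.monic_prod_of_monic _ _ fun i hi => (hQ i hi).1.1)
  · intro α hα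
    simp only [if_true] at hα
    rw [incl_toCxy, mem_zer_toSeries_iff hR0] at hα
    exact exists_isContact_lt hzer hB.pos ((hB.twist_iff _).2 dvd_rfl) (hR α hα.1)
  · intro i hi α hα
    simp only [if_neg (hne i hi)] at hα
    rw [incl_toCxy, mem_zer_toSeries_iff (hQ i hi).1.1.ne_zero] at hα
    exact ((hQ i hi).2.1 α hα.1).isContact hzer
  · intro i hi
    simp only [if_neg (hne i hi)]
    rw [interMult_toCxy_xVar (hQ i hi).1, (hQ i hi).2.2]
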